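/- **Conventions.** A directed graph $E=(E^0,E^1,s,r)$ consists of sets $E^0$ (vertices), $E^1$ (edges) and maps $s,r:E^1\to E^0$, with no size restriction. A vertex $v$ is a sink if $s^{-1}(v)=\emptyset$, an infinite emitter if $s^{-1}(v)$ is infinite, and regular otherwise. $\mathbf{CKGr}$ is the category of all directed graphs, whose morphisms $\phi=(\phi^0,\phi^1):E\to F$ are the CK-morphisms: graph morphisms with $\phi^0,\phi^1$ injective such that $\phi^1$ restricts to a bijection $s_E^{-1}(v)\to s_F^{-1}(\phi^0(v))$ for every regular $v\in E^0$. Let $K$ be a field. $L_K(E)$ denotes the Leavitt path algebra, i.e. the (not necessarily unital) associative $K$-algebra generated by $E^0\cup E^1\cup\{e^*\mid e\in E^1\}$ with relations, for all $v,w\in E^0$ and $e,f\in E^1$: $vw=\delta_{v,w}w$; $s(e)e=e=e\,r(e)$; $r(e)e^*=e^*=e^*s(e)$; $e^*f=\delta_{e,f}r(e)$; and $v=\sum_{e\in s^{-1}(v)}ee^*$ for $v$ regular. A CK-morphism $\phi:E\to F$ induces $L_K(\phi):L_K(E)\to L_K(F)$ with $v\mapsto\phi^0(v)$, $e\mapsto\phi^1(e)$,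 $e^*\mapsto\phi^1(e)^*$. $K\text{-}\mathbf{Alg}$ is the category of associative, not necessarily unital, $K$-algebras. Let $E^*$ and $E^\infty$ be the sets of finite paths (vertices being the paths of length $0$) and infinite paths of $E$, and let $X_E$ consist of $E^\infty$ and the finite paths ending in a sink or an infinite emitter. The graph groupoid is $$\mathcal G_E=\{(\alpha x,|\alpha|-|\beta|,\beta x)\mid \alpha,\beta\in E^*,\ x\in X_E,\ r(\alpha)=s(x)=r(\beta)\},$$ where $(x,k,y)$ has range $x$ and source $y$, $(x,k,y)(y,l,z)=(x,k+l,z)$ and $(x,k,y)^{-1}=(y,-k,x)$, with the topology generated by the sets $Z(\alpha,\beta,F)=Z(\alpha,\beta)\setminus\bigcup_{e\in F}Z(\alpha e,\beta e)$ for $r(\alpha)=r(\beta)$ and $F\subseteq s^{-1}(r(\alpha))$ finite, where $Z(\alpha,\beta)=\{(\alpha x,|\alpha|-|\beta|,\beta x)\mid x\in X_E,\ r(\alpha)=s(x)=r(\beta)\}$. For $H\subseteq E^0$, $\mathcal G_E|_H$ is the subgroupoid of the elements $(\alpha x,|\alpha|-|\beta|,\beta x)\in\mathcal G_E$ with $s(\alpha),s(\beta)\in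 H$, with the subspace topology. For $\mathcal G=\mathcal G_E|_H$, the Steinberg algebra $A_K(\mathcal G)$ is the $K$-span of the characteristic functions $1_U:\mathcal G\to K$ of the compact open bisections $U$ of $\mathcal G$ (open sets on which source and range are homeomorphisms onto open subsets of the unit space), with the convolution product $(f*g)(\gamma)=\sum_{\gamma=\alpha\beta}f(\alpha)g(\beta)$. **Corollary.** Let $((E_i)_{i\in I},(\phi_{ij})_{i\le j})$ be a direct system in $\mathbf{CKGr}$ over a directed set $I$, and let $E$ be its direct limit in $\mathbf{CKGr}$ with canonical morphisms $\eta_i:E_i\to E$. For each $i\in I$ let $T_i$ be a finite subset of $E_i^0$ such that $\phi_{ij}^0(T_i)\subseteq T_j$ for all $i\le j$, and let $T=\bigcup_{i\in I}\eta_i^0(T_i)\subseteq E^0$. Let $K$ be a field. Then the span $A_K(\mathcal G_E|_T)$ is closed under convolution, and there are $K$-algebra homomorphisms $\theta_i:\big(\sum_{v\in T_i}v\big)L_K(E_i)\big(\sum_{v\in T_i}v\big)\to A_K(\mathcal G_E|_T)$ making $A_K(\mathcal G_E|_T)$ a direct limit in $K\text{-}\mathbf{Alg}$ of the system of corners $\big(\sum_{v\in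 T_i}v\big)L_K(E_i)\big(\sum_{v\in T_i}v\big)$, $i\in I$, with transition maps the restrictions of $L_K(\phi_{ij})$. -/

import Mathlib

open CategoryTheory

universe u v w t k

noncomputable section

/-! ## Directed graphs and the category of graphs with CK-morphisms -/

/-- A directed graph: vertices, edges, source and range. No finiteness or countability is assumed;
loops and parallel edges are allowed. -/
structure CKGr where
  Vert : Type u
  Edge : Type v
  s : Edge → Vert
  r : Edge → Vert

namespace CKGr

/-- A vertex emitting no edge. -/
def IsSink (E : CKGr.{u, v}) (a : E.Vert) : Prop := E.s ⁻¹' {a} = ∅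

/-- A vertex emitting infinitely many edges. -/
def IsInfiniteEmitter (E : CKGr.{u, v}) (a : E.Vert) : Prop := (E.s ⁻¹' {a}).Infinite

/-- A vertex emitting at least one and only finitely many edges. -/
def IsRegular (E : CKGr.{u, v}) (a : E.Vert) : Prop :=
  (E.s ⁻¹' {a}).Nonempty ∧ (E.s ⁻¹' {a}).Finite

/-- Cuntz-Krieger morphisms: graph morphisms that are injective on vertices and on edges and
restrict to a bijection `s⁻¹(a) → s⁻¹(φ(a))` for every regular vertex `a` of the domain. -/
@[ext]
structure CKHom (E F : CKGr.{u, v}) where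
  onVert : E.Vert → F.Vert
  onEdge : E.Edge → F.Edge
  map_s : ∀ e, F.s (onEdge e) = onVert (E.s e)
  map_r : ∀ e, F.r (onEdge e) = onVert (E.r e)
  injective_onVert : Function.Injective onVert
  injective_onEdge : Function.Injective onEdge
  bijOn : ∀ a, E.IsRegular a → Set.BijOn onEdge (E.s ⁻¹' {a}) (F.s ⁻¹' {onVert a})

theorem CKHom.isRegular {E F : CKGr.{u, v}} (φ : CKHom E F) {a : E.Vert} (ha : E.IsRegular a) :
    F.IsRegular (φ.onVert a) := by
  have h := φ.bijOn a ha
  refine ⟨?_, ?_⟩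
  · rw [← h.image_eq]; exact ha.1.image _
  · rw [← h.image_eq]; exact ha.2.image _

/-- The category of directed graphs and CK-morphisms. -/
instance : Category CKGr.{u, v} where
  Hom E F := CKHom E F
  id E :=
    { onVert := id
      onEdge := id
      map_s := fun _ => rfl
      map_r := fun _ => rfl
      injective_onVert := Function.injective_id
      injective_onEdge := Function.injective_id
      bijOn := fun _ _ => Set.bijOn_id _ }
  comp φ ψ :=
    { onVert := ψ.onVert ∘ φ.onVert
      onEdge := ψ.onEdge ∘ φ.onEdge
      map_s := fun e => by simp [ψ.map_s, φ.map_s]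
      map_r := fun e => by simp [ψ.map_r, φ.map_r]
      injective_onVert := ψ.injective_onVert.comp φ.injective_onVert
      injective_onEdge := ψ.injective_onEdge.comp φ.injective_onEdge
      bijOn := fun a ha => (ψ.bijOn _ (φ.isRegular ha)).comp (φ.bijOn a ha) }

/-! ## Leavitt path algebras -/

/-- The generators of the Leavitt path algebra: vertices `a`, edges `e` and ghost edges `e*`. -/
inductive LeavittGen (E : CKGr.{u, v}) where
  | vert (a : E.Vert)
  | edge (e : E.Edge)
  | ghost (e : E.Edge)

/-- The free associative non-unital `K`-algebra on the generators. -/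
abbrev LeavittFree (K : Type k) [Field K] (E : CKGr.{u, v}) :=
  MonoidAlgebra K (FreeSemigroup (LeavittGen E))

/-- A generator, as an element of the free non-unital algebra. -/
def leavittOf (K : Type k) [Field K] {E : CKGr.{u, v}} (x : LeavittGen E) : LeavittFree K E :=
  MonoidAlgebra.single (FreeSemigroup.of x) 1

/-- The defining relations of the Leavitt path algebra, closed under scalar multiples, translations
and multiplication on either side; the equivalence relation it generates is the congruence generated
by the defining relations. In `ck`, the finset `S` lists the set `s⁻¹(a)`, for `a` regular. -/
inductive LeavittRel (K : Type k) [Field K] (E : CKGr.{u, v}) :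
    LeavittFree K E → LeavittFree K E → Prop
  | vert_self (a : E.Vert) :
      LeavittRel K E (leavittOf K (.vert a) * leavittOf K (.vert a)) (leavittOf K (.vert a))
  | vert_orth (a b : E.Vert) : a ≠ b →
      LeavittRel K E (leavittOf K (.vert a) * leavittOf K (.vert b)) 0
  | s_edge (e : E.Edge) :
      LeavittRel K E (leavittOf K (.vert (E.s e)) * leavittOf K (.edge e)) (leavittOf K (.edge e))
  | edge_r (e : E.Edge) :
      LeavittRel K E (leavittOf K (.edge e) * leavittOf K (.vert (E.r e))) (leavittOf K (.edge e))
  | r_ghost (e : E.Edge) :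
      LeavittRel K E (leavittOf K (.vert (E.r e)) * leavittOf K (.ghost e)) (leavittOf K (.ghost e))
  | ghost_s (e : E.Edge) :
      LeavittRel K E (leavittOf K (.ghost e) * leavittOf K (.vert (E.s e))) (leavittOf K (.ghost e))
  | ghost_edge_self (e : E.Edge) :
      LeavittRel K E (leavittOf K (.ghost e) * leavittOf K (.edge e)) (leavittOf K (.vert (E.r e)))
  | ghost_edge_orth (e f : E.Edge) : e ≠ f →
      LeavittRel K E (leavittOf K (.ghost e) * leavittOf K (.edge f)) 0
  | ck (a : E.Vert) (S : Finset E.Edge) : E.IsRegular a → (∀ e, e ∈ S ↔ E.s e = a) →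
      LeavittRel K E (leavittOf K (.vert a))
        (∑ e ∈ S, leavittOf K (.edge e) * leavittOf K (.ghost e))
  | smul (c : K) {x y : LeavittFree K E} : LeavittRel K E x y → LeavittRel K E (c • x) (c • y)
  | add_right {x y : LeavittFree K E} (z : LeavittFree K E) :
      LeavittRel K E x y → LeavittRel K E (x + z) (y + z)
  | mul_left (z : LeavittFree K E) {x y : LeavittFree K E} :
      LeavittRel K E x y → LeavittRel K E (z * x) (z * y)
  | mul_right {x y : LeavittFree K E} (z : LeavittFree K E) :
      LeavittRel K E x y → LeavittRel K E (x * z) (y * z)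

/-- The Leavitt path algebra `L_K(E)`, a non-unital associative `K`-algebra: the quotient of the
free non-unital `K`-algebra on the generators by the defining relations. -/
def Leavitt (K : Type k) [Field K] (E : CKGr.{u, v}) := Quot (LeavittRel K E)

namespace Leavitt

variable {K : Type k} [Field K] {E : CKGr.{u, v}}

theorem rel_add_left (x : LeavittFree K E) {y z : LeavittFree K E} (h : LeavittRel K E y z) :
    LeavittRel K E (x + y) (x + z) := by
  rw [add_comm _ y, add_comm _ z]; exact h.add_right _

theorem rel_neg {x y : LeavittFree K E} (h : LeavittRel K E x y) : LeavittRel K E (-x) (-y) := by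
  simpa only [neg_one_smul] using h.smul (-1)

instance : Zero (Leavitt K E) where zero := Quot.mk _ 0

instance : Add (Leavitt K E) where
  add := Quot.map₂ (· + ·) (fun _ _ _ => rel_add_left _) fun _ _ _ => LeavittRel.add_right _

instance : Neg (Leavitt K E) where neg := Quot.map Neg.neg fun _ _ => rel_neg

instance : Sub (Leavitt K E) where
  sub := Quot.map₂ Sub.sub
    (fun x y z h => by
      change LeavittRel K E (x - y) (x - z)
      simpa only [sub_eq_add_neg] using rel_add_left _ (rel_neg h))
    (fun x y z h => by
      change LeavittRel K E (x - z) (y - z)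
      simpa only [sub_eq_add_neg] using h.add_right _)

instance : Mul (Leavitt K E) where
  mul := Quot.map₂ (· * ·) (fun _ _ _ => LeavittRel.mul_left _) fun _ _ _ => LeavittRel.mul_right _

instance : SMul K (Leavitt K E) where smul c := Quot.map (c • ·) fun _ _ => LeavittRel.smul c

instance : SMul ℕ (Leavitt K E) where
  smul n := Quot.map (n • ·) fun x y h => by
    simpa only [Nat.cast_smul_eq_nsmul] using h.smul (n : K)

instance : SMul ℤ (Leavitt K E) where
  smul n := Quot.map (n • ·) fun x y h => by
    simpa only [Int.cast_smul_eq_zsmul] using h.smul (n : K)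

instance : NonUnitalRing (Leavitt K E) :=
  Function.Surjective.nonUnitalRing (Quot.mk (LeavittRel K E)) Quot.mk_surjective rfl
    (fun _ _ => rfl) (fun _ _ => rfl) (fun _ => rfl) (fun _ _ => rfl) (fun _ _ => rfl)
    (fun _ _ => rfl)

instance : Module K (Leavitt K E) :=
  Function.Surjective.module K ⟨⟨Quot.mk (LeavittRel K E), rfl⟩, fun _ _ => rfl⟩
    Quot.mk_surjective (fun _ _ => rfl)

instance : IsScalarTower K (Leavitt K E) (Leavitt K E) where
  smul_assoc := by
    rintro c ⟨x⟩ ⟨y⟩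
    exact congrArg (Quot.mk _) (smul_mul_assoc c x y)

instance : SMulCommClass K (Leavitt K E) (Leavitt K E) where
  smul_comm := by
    rintro c ⟨x⟩ ⟨y⟩
    exact congrArg (Quot.mk _) (mul_smul_comm c x y).symm

/-- The quotient map from the free non-unital algebra. -/
def mk : LeavittFree K E →ₙₐ[K] Leavitt K E where
  toFun := Quot.mk (LeavittRel K E)
  map_smul' _ _ := rfl
  map_zero' := rfl
  map_add' _ _ := rfl
  map_mul' _ _ := rfl

variable (K) in
/-- The vertex `a`, as an element of `L_K(E)`. -/
def vert (a : E.Vert) : Leavitt K E := mk (leavittOf K (.vert a))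

variable (K) in
/-- The edge `e`, as an element of `L_K(E)`. -/
def edge (e : E.Edge) : Leavitt K E := mk (leavittOf K (.edge e))

variable (K) in
/-- The ghost edge `e*`, as an element of `L_K(E)`. -/
def ghost (e : E.Edge) : Leavitt K E := mk (leavittOf K (.ghost e))

theorem mk_eq {x y : LeavittFree K E} (h : LeavittRel K E x y) : mk x = mk y := Quot.sound h

theorem vert_mul_self (a : E.Vert) : vert K a * vert K a = vert K a := by
  simpa [vert] using mk_eq (LeavittRel.vert_self (K := K) a)

theorem vert_mul_of_ne {a b : E.Vert} (h : a ≠ b) : vert K a * vert K b = 0 := by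
  simpa [vert] using mk_eq (LeavittRel.vert_orth (K := K) a b h)

/-- Values for the generators in a non-unital `K`-algebra that satisfy the defining relations. -/
structure Family (K : Type k) [Field K] (E : CKGr.{u, v}) (B : Type w) [NonUnitalRing B]
    [Module K B] where
  vert : E.Vert → B
  edge : E.Edge → B
  ghost : E.Edge → B
  vert_self : ∀ a, vert a * vert a = vert a
  vert_orth : ∀ a b, a ≠ b → vert a * vert b = 0
  s_edge : ∀ e, vert (E.s e) * edge e = edge e
  edge_r : ∀ e, edge e * vert (E.r e) = edge e
  r_ghost : ∀ e, vert (E.r e) * ghost e = ghost e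
  ghost_s : ∀ e, ghost e * vert (E.s e) = ghost e
  ghost_edge_self : ∀ e, ghost e * edge e = vert (E.r e)
  ghost_edge_orth : ∀ e f, e ≠ f → ghost e * edge f = 0
  ck : ∀ a (S : Finset E.Edge), E.IsRegular a → (∀ e, e ∈ S ↔ E.s e = a) →
    vert a = ∑ e ∈ S, edge e * ghost e

section lift

variable {B : Type w} [NonUnitalRing B] [Module K B]

/-- The value assigned to a generator. -/
def Family.val (f : Family K E B) : LeavittGen E → B
  | .vert a => f.vert a
  | .edge e => f.edge e
  | .ghost e => f.ghost e

variable [IsScalarTower K B B] [SMulCommClass K B B]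

/-- The induced homomorphism on the free non-unital algebra. -/
def Family.freeLift (f : Family K E B) : LeavittFree K E →ₙₐ[K] B :=
  MonoidAlgebra.liftMagma K (FreeSemigroup.lift f.val)

@[simp]
theorem Family.freeLift_of (f : Family K E B) (x : LeavittGen E) :
    f.freeLift (leavittOf K x) = f.val x := by
  simp [Family.freeLift, leavittOf, MonoidAlgebra.liftMagma]

theorem Family.freeLift_rel (f : Family K E B) {x y : LeavittFree K E} (h : LeavittRel K E x y) :
    f.freeLift x = f.freeLift y := by
  induction h with
  | vert_self a => simpa [Family.val] using f.vert_self a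
  | vert_orth a b h => simpa [Family.val] using f.vert_orth a b h
  | s_edge e => simpa [Family.val] using f.s_edge e
  | edge_r e => simpa [Family.val] using f.edge_r e
  | r_ghost e => simpa [Family.val] using f.r_ghost e
  | ghost_s e => simpa [Family.val] using f.ghost_s e
  | ghost_edge_self e => simpa [Family.val] using f.ghost_edge_self e
  | ghost_edge_orth e g h => simpa [Family.val] using f.ghost_edge_orth e g h
  | ck a S ha hS => simpa [Family.val, map_sum] using f.ck a S ha hS
  | smul c _ ih => simp [ih]
  | add_right z _ ih => simp [ih]
  | mul_left z _ ih => simp [ih]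
  | mul_right z _ ih => simp [ih]

/-- The homomorphism `L_K(E) → B` with prescribed values on the generators. -/
def Family.lift (f : Family K E B) : Leavitt K E →ₙₐ[K] B where
  toFun := Quot.lift f.freeLift fun _ _ h => f.freeLift_rel h
  map_smul' := by rintro c ⟨x⟩; exact map_smul f.freeLift c x
  map_zero' := map_zero f.freeLift
  map_add' := by rintro ⟨x⟩ ⟨y⟩; exact map_add f.freeLift x y
  map_mul' := by rintro ⟨x⟩ ⟨y⟩; exact map_mul f.freeLift x y

theorem Family.lift_vert (f : Family K E B) (a : E.Vert) : f.lift (Leavitt.vert K a) = f.vert a :=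
  f.freeLift_of (.vert a)

theorem Family.lift_edge (f : Family K E B) (e : E.Edge) : f.lift (Leavitt.edge K e) = f.edge e :=
  f.freeLift_of (.edge e)

theorem Family.lift_ghost (f : Family K E B) (e : E.Edge) :
    f.lift (Leavitt.ghost K e) = f.ghost e :=
  f.freeLift_of (.ghost e)

end lift

/-- The images of the generators of `L_K(E)` in `L_K(F)` under a CK-morphism `E → F`. -/
def mapFamily (K : Type k) [Field K] {E F : CKGr.{u, v}} (φ : E ⟶ F) :
    Family K E (Leavitt K F) where
  vert a := vert K (CKHom.onVert φ a)
  edge e := edge K (CKHom.onEdge φ e)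
  ghost e := ghost K (CKHom.onEdge φ e)
  vert_self a := vert_mul_self _
  vert_orth a b h := vert_mul_of_ne fun h' => h (CKHom.injective_onVert φ h')
  s_edge e := by
    simpa [vert, edge, CKHom.map_s φ] using
      mk_eq (LeavittRel.s_edge (K := K) (CKHom.onEdge φ e))
  edge_r e := by
    simpa [vert, edge, CKHom.map_r φ] using
      mk_eq (LeavittRel.edge_r (K := K) (CKHom.onEdge φ e))
  r_ghost e := by
    simpa [vert, ghost, CKHom.map_r φ] using
      mk_eq (LeavittRel.r_ghost (K := K) (CKHom.onEdge φ e))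
  ghost_s e := by
    simpa [vert, ghost, CKHom.map_s φ] using
      mk_eq (LeavittRel.ghost_s (K := K) (CKHom.onEdge φ e))
  ghost_edge_self e := by
    simpa [vert, edge, ghost, CKHom.map_r φ] using
      mk_eq (LeavittRel.ghost_edge_self (K := K) (CKHom.onEdge φ e))
  ghost_edge_orth e f h := by
    simpa [edge, ghost] using
      mk_eq (LeavittRel.ghost_edge_orth (K := K) (CKHom.onEdge φ e) (CKHom.onEdge φ f)
        fun h' => h (CKHom.injective_onEdge φ h'))
  ck a S ha hS := by
    have hb := CKHom.bijOn φ a ha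
    have := mk_eq (LeavittRel.ck (K := K) (CKHom.onVert φ a)
      (S.map ⟨CKHom.onEdge φ, CKHom.injective_onEdge φ⟩) (CKHom.isRegular φ ha) (by
        intro e
        have h1 : e ∈ F.s ⁻¹' {CKHom.onVert φ a} ↔ e ∈ CKHom.onEdge φ '' (E.s ⁻¹' {a}) := by
          rw [hb.image_eq]
        simp only [Set.mem_preimage, Set.mem_singleton_iff, Set.mem_image] at h1
        simp [hS, h1]))
    simpa [vert, edge, ghost, map_sum] using this

/-- The homomorphism `L_K(φ) : L_K(E) → L_K(F)` induced by a CK-morphism `φ`. -/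
def map (K : Type k) [Field K] {E F : CKGr.{u, v}} (φ : E ⟶ F) : Leavitt K E →ₙₐ[K] Leavitt K F :=
  (mapFamily K φ).lift

theorem map_vert {E F : CKGr.{u, v}} (φ : E ⟶ F) (a : E.Vert) :
    map K φ (vert K a) = vert K (CKHom.onVert φ a) := (mapFamily K φ).lift_vert a

theorem map_edge {E F : CKGr.{u, v}} (φ : E ⟶ F) (e : E.Edge) :
    map K φ (edge K e) = edge K (CKHom.onEdge φ e) := (mapFamily K φ).lift_edge e

theorem map_ghost {E F : CKGr.{u, v}} (φ : E ⟶ F) (e : E.Edge) :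
    map K φ (ghost K e) = ghost K (CKHom.onEdge φ e) := (mapFamily K φ).lift_ghost e

variable (K) in
/-- The element `∑_{a ∈ T} a` of `L_K(E)`. -/
def vertSum (T : Finset E.Vert) : Leavitt K E := ∑ a ∈ T, vert K a

variable (K) in
/-- The corner `(∑_{a ∈ T} a) L_K(E) (∑_{a ∈ T} a)`, a (non-unital) subalgebra of `L_K(E)`. -/
def corner (T : Finset E.Vert) : NonUnitalSubalgebra K (Leavitt K E) where
  carrier := {x | ∃ y, x = vertSum K T * y * vertSum K T}
  zero_mem' := ⟨0, by simp⟩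
  add_mem' := by
    rintro _ _ ⟨x, rfl⟩ ⟨y, rfl⟩
    exact ⟨x + y, by rw [mul_add, add_mul]⟩
  mul_mem' := by
    rintro _ _ ⟨x, rfl⟩ ⟨y, rfl⟩
    exact ⟨x * vertSum K T * (vertSum K T * y), by simp only [mul_assoc]⟩
  smul_mem' := by
    rintro c _ ⟨x, rfl⟩
    exact ⟨c • x, by rw [mul_smul_comm, smul_mul_assoc]⟩

theorem vertSum_mul_vert {T : Finset E.Vert} {a : E.Vert} (ha : a ∈ T) :
    vertSum K T * vert K a = vert K a := by
  rw [vertSum, Finset.sum_mul, Finset.sum_eq_single a]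
  · exact vert_mul_self a
  · exact fun b _ hb => vert_mul_of_ne hb
  · exact fun h => absurd ha h

theorem vert_mul_vertSum {T : Finset E.Vert} {a : E.Vert} (ha : a ∈ T) :
    vert K a * vertSum K T = vert K a := by
  rw [vertSum, Finset.mul_sum, Finset.sum_eq_single a]
  · exact vert_mul_self a
  · exact fun b _ hb => vert_mul_of_ne hb.symm
  · exact fun h => absurd ha h

theorem map_mem_corner {E F : CKGr.{u, v}} (φ : E ⟶ F) {T : Finset E.Vert} {S : Finset F.Vert}
    (h : ∀ a ∈ T, CKHom.onVert φ a ∈ S) (x : corner K T) : map K φ x ∈ corner K S := by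
  obtain ⟨_, y, rfl⟩ := x
  refine ⟨map K φ (vertSum K T * y * vertSum K T), ?_⟩
  have h1 : vertSum K S * map K φ (vertSum K T) = map K φ (vertSum K T) := by
    rw [vertSum.eq_1 K T, map_sum, Finset.mul_sum]
    exact Finset.sum_congr rfl fun a ha => by rw [map_vert]; exact vertSum_mul_vert (h a ha)
  have h2 : map K φ (vertSum K T) * vertSum K S = map K φ (vertSum K T) := by
    rw [vertSum.eq_1 K T, map_sum, Finset.sum_mul]
    exact Finset.sum_congr rfl fun a ha => by rw [map_vert]; exact vert_mul_vertSum (h a ha)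
  simp only [map_mul]
  rw [← mul_assoc, ← mul_assoc, h1, mul_assoc _ _ (vertSum K S), h2]

variable (K) in
/-- The restriction of `L_K(φ)` to corners, for a CK-morphism `φ : E → F` with `φ(T) ⊆ S`. -/
def cornerMap {E F : CKGr.{u, v}} (φ : E ⟶ F) {T : Finset E.Vert} {S : Finset F.Vert}
    (h : ∀ a ∈ T, CKHom.onVert φ a ∈ S) : corner K T →ₙₐ[K] corner K S :=
  NonUnitalAlgHom.codRestrict
    ((map K φ).comp (NonUnitalSubalgebraClass.subtype (corner K T))) (corner K S)
    (map_mem_corner φ h)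

end Leavitt

end CKGr

/-! ## Groupoids and Steinberg algebras -/

/-- A groupoid, given by its set `G` of arrows. The product `mul x y` is defined exactly when
`src x = rng y`; sources and ranges are regarded as arrows (units). -/
class ArrowGroupoid (G : Type w) where
  src : G → G
  rng : G → G
  inv : G → G
  mul : (x y : G) → src x = rng y → G
  rng_src : ∀ x, rng (src x) = src x
  src_rng : ∀ x, src (rng x) = rng x
  src_inv : ∀ x, src (inv x) = rng x
  rng_inv : ∀ x, rng (inv x) = src x
  src_mul : ∀ x y h, src (mul x y h) = src y
  rng_mul : ∀ x y h, rng (mul x y h) = rng x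
  mul_assoc : ∀ x y z (hxy : src x = rng y) (hyz : src y = rng z),
    mul (mul x y hxy) z ((src_mul x y hxy).trans hyz) =
      mul x (mul y z hyz) (hxy.trans (rng_mul y z hyz).symm)
  mul_src : ∀ x, mul x (src x) (rng_src x).symm = x
  rng_mul_self : ∀ x, mul (rng x) x (src_rng x) = x
  inv_mul : ∀ x, mul (inv x) x (src_inv x) = src x
  mul_inv : ∀ x, mul x (inv x) (rng_inv x).symm = rng x

namespace ArrowGroupoid

/-- The unit space `G⁽⁰⁾ = s(G)` (which is also `r(G)`). -/
def unitSpace (G : Type w) [ArrowGroupoid G] : Set G := Set.range (src : G → G)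

/-- The source map `G → G⁽⁰⁾`. -/
def srcMap {G : Type w} [ArrowGroupoid G] (x : G) : unitSpace G := ⟨src x, x, rfl⟩

/-- The range map `G → G⁽⁰⁾`. -/
def rngMap {G : Type w} [ArrowGroupoid G] (x : G) : unitSpace G := ⟨rng x, rng x, src_rng x⟩

/-- Open bisections: open sets on which source and range are homeomorphisms onto open subsets of
the unit space (with the subspace topology). -/
def IsOpenBisection {G : Type w} [ArrowGroupoid G] [TopologicalSpace G] (U : Set G) : Prop :=
  IsOpen U ∧ Topology.IsOpenEmbedding (fun x : U => srcMap (x : G)) ∧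
    Topology.IsOpenEmbedding (fun x : U => rngMap (x : G))

/-- The pairs `(α, β)` of composable arrows with `α β = γ`. -/
def factorizations {G : Type w} [ArrowGroupoid G] (γ : G) : Set (G × G) :=
  {p | ∃ h : src p.1 = rng p.2, mul p.1 p.2 h = γ}

theorem mul_right_cancel {G : Type w} [ArrowGroupoid G] {a a' b : G} {h : src a = rng b}
    {h' : src a' = rng b} (e : mul a b h = mul a' b h') : a = a' := by
  have key : ∀ (c : G) (hc : src c = rng b) (d : G) (_ : mul c b hc = d)
      (hd : src d = rng (inv b)), mul d (inv b) hd = c := by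
    rintro c hc _ rfl hd
    rw [mul_assoc c b (inv b) hc (rng_inv b).symm]
    simp only [mul_inv]
    have : ∀ z (hz : src c = z) (hz' : src c = rng z), mul c z hz' = c := by
      rintro _ rfl _; exact mul_src c
    exact this _ hc _
  have hd : src (mul a b h) = rng (inv b) := by rw [src_mul, rng_inv]
  rw [← key a h _ rfl hd, key a' h' _ e.symm hd]

theorem mul_left_cancel {G : Type w} [ArrowGroupoid G] {a b b' : G} {h : src a = rng b}
    {h' : src a = rng b'} (e : mul a b h = mul a b' h') : b = b' := by
  have key : ∀ (c : G) (hc : src a = rng c) (d : G) (_ : mul a c hc = d)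
      (hd : src (inv a) = rng d), mul (inv a) d hd = c := by
    rintro c hc _ rfl hd
    rw [← mul_assoc (inv a) a c (src_inv a) hc]
    simp only [inv_mul]
    have : ∀ z (hz : rng c = z) (hz' : src z = rng c), mul z c hz' = c := by
      rintro _ rfl _; exact rng_mul_self c
    exact this _ hc.symm _
  have hd : src (inv a) = rng (mul a b h) := by rw [rng_mul, src_inv]
  rw [← key b h _ rfl hd, key b' h' _ e.symm hd]

variable (K : Type k) [Field K] (G : Type w) [ArrowGroupoid G]

/-- The functions `G → K` that have only finitely many nonzero values on each range fibre and on
each source fibre; on these, convolution is given by finite sums and is associative. Combinations of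
characteristic functions of bisections are of this kind. -/
def convSubmodule : Submodule K (G → K) where
  carrier := {f | ∀ x : G, {a | rng a = x ∧ f a ≠ 0}.Finite ∧ {a | src a = x ∧ f a ≠ 0}.Finite}
  zero_mem' := by intro x; simp
  add_mem' := by
    intro f g hf hg x
    refine ⟨((hf x).1.union (hg x).1).subset ?_, ((hf x).2.union (hg x).2).subset ?_⟩ <;>
    · rintro a ⟨ha, hne⟩
      by_cases h : f a = 0
      · exact Or.inr ⟨ha, fun h' => hne (by simp [h, h'])⟩
      · exact Or.inl ⟨ha, h⟩
  smul_mem' := by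
    intro c f hf x
    refine ⟨(hf x).1.subset ?_, (hf x).2.subset ?_⟩ <;>
    · rintro a ⟨ha, hne⟩
      exact ⟨ha, fun h => hne (by simp [h])⟩

/-- The convolution algebra of functions with finite support on every range and source fibre. -/
def ConvAlg : Type _ := ↥(convSubmodule K G)

instance : AddCommGroup (ConvAlg K G) := inferInstanceAs (AddCommGroup (convSubmodule K G))

instance : Module K (ConvAlg K G) := inferInstanceAs (Module K (convSubmodule K G))

variable {K G}

namespace ConvAlg

/-- The underlying function. -/
def fn (f : ConvAlg K G) : G → K := f.1

@[ext]
theorem ext {f g : ConvAlg K G} (h : ∀ x, f.fn x = g.fn x) : f = g := Subtype.ext (funext h)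

@[simp] theorem fn_add (f g : ConvAlg K G) (x : G) : (f + g).fn x = f.fn x + g.fn x := rfl
@[simp] theorem fn_zero (x : G) : (0 : ConvAlg K G).fn x = 0 := rfl
@[simp] theorem fn_smul (c : K) (f : ConvAlg K G) (x : G) : (c • f).fn x = c * f.fn x := rfl

theorem finite_left (f : ConvAlg K G) (γ : G) :
    {p | p ∈ factorizations γ ∧ f.fn p.1 ≠ 0}.Finite := by
  refine Set.Finite.of_finite_image (f := Prod.fst) (((f.2 (rng γ)).1).subset ?_) ?_
  · rintro _ ⟨p, ⟨⟨h, rfl⟩, hp⟩, rfl⟩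
    exact ⟨(rng_mul _ _ h).symm, hp⟩
  · rintro ⟨a, b⟩ ⟨⟨h, e⟩, -⟩ ⟨a', b'⟩ ⟨⟨h', e'⟩, -⟩ (rfl : a = a')
    exact congrArg (Prod.mk a) (mul_left_cancel (e.trans e'.symm))

theorem finite_right (f : ConvAlg K G) (γ : G) :
    {p | p ∈ factorizations γ ∧ f.fn p.2 ≠ 0}.Finite := by
  refine Set.Finite.of_finite_image (f := Prod.snd) (((f.2 (src γ)).2).subset ?_) ?_
  · rintro _ ⟨p, ⟨⟨h, rfl⟩, hp⟩, rfl⟩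
    exact ⟨(src_mul _ _ h).symm, hp⟩
  · rintro ⟨a, b⟩ ⟨⟨h, e⟩, -⟩ ⟨a', b'⟩ ⟨⟨h', e'⟩, -⟩ (rfl : b = b')
    exact congrArg (fun z => (z, b)) (mul_right_cancel (e.trans e'.symm))

/-- Convolution: `(f * g)(γ) = ∑_{γ = α β} f(α) g(β)`. -/
def conv (f g : G → K) (γ : G) : K := ∑ᶠ p ∈ factorizations γ, f p.1 * g p.2

theorem exists_of_conv_ne_zero {f g : G → K} {γ : G} (h : conv f g γ ≠ 0) :
    ∃ p ∈ factorizations γ, f p.1 ≠ 0 ∧ g p.2 ≠ 0 := by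
  obtain ⟨p, hp, hne⟩ := exists_ne_zero_of_finsum_mem_ne_zero h
  exact ⟨p, hp, left_ne_zero_of_mul hne, right_ne_zero_of_mul hne⟩

theorem conv_mem (f g : ConvAlg K G) : conv f.fn g.fn ∈ convSubmodule K G := by
  classical
  let m : G × G → G := fun p => if h : src p.1 = rng p.2 then mul p.1 p.2 h else p.1
  intro x
  constructor
  · refine (((f.2 x).1.biUnion (t := fun a => (fun b => (a, b)) '' {b | rng b = src a ∧ g.fn b ≠ 0})
      fun a _ => ((g.2 (src a)).1).image _).image m).subset ?_
    rintro γ ⟨rfl, hγ⟩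
    obtain ⟨⟨a, b⟩, ⟨h, rfl⟩, ha, hb⟩ := exists_of_conv_ne_zero hγ
    refine ⟨(a, b), ?_, dif_pos h⟩
    simp only [Set.mem_iUnion]
    exact ⟨a, ⟨(rng_mul _ _ h).symm, ha⟩, b, ⟨h.symm, hb⟩, rfl⟩
  · refine (((g.2 x).2.biUnion (t := fun b => (fun a => (a, b)) '' {a | src a = rng b ∧ f.fn a ≠ 0})
      fun b _ => ((f.2 (rng b)).2).image _).image m).subset ?_
    rintro γ ⟨rfl, hγ⟩
    obtain ⟨⟨a, b⟩, ⟨h, rfl⟩, ha, hb⟩ := exists_of_conv_ne_zero hγ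
    refine ⟨(a, b), ?_, dif_pos h⟩
    simp only [Set.mem_iUnion]
    exact ⟨b, ⟨(src_mul _ _ h).symm, hb⟩, a, ⟨h, ha⟩, rfl⟩

instance : Mul (ConvAlg K G) where mul f g := ⟨conv f.fn g.fn, conv_mem f g⟩

theorem fn_mul (f g : ConvAlg K G) (γ : G) :
    (f * g).fn γ = ∑ᶠ p ∈ factorizations γ, f.fn p.1 * g.fn p.2 := rfl

theorem fn_mul_left (f g : ConvAlg K G) (γ : G) :
    (f * g).fn γ = ∑ p ∈ (finite_left f γ).toFinset, f.fn p.1 * g.fn p.2 := by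
  rw [fn_mul]
  refine finsum_mem_eq_sum_of_subset _ ?_ ?_
  · rintro p ⟨hp, hne⟩
    simpa using ⟨hp, left_ne_zero_of_mul hne⟩
  · intro p hp
    exact (by simpa using hp : p ∈ factorizations γ ∧ _).1

theorem fn_mul_right (f g : ConvAlg K G) (γ : G) :
    (f * g).fn γ = ∑ p ∈ (finite_right g γ).toFinset, f.fn p.1 * g.fn p.2 := by
  rw [fn_mul]
  refine finsum_mem_eq_sum_of_subset _ ?_ ?_
  · rintro p ⟨hp, hne⟩
    simpa using ⟨hp, right_ne_zero_of_mul hne⟩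
  · intro p hp
    exact (by simpa using hp : p ∈ factorizations γ ∧ _).1

theorem conv_assoc (f g h : ConvAlg K G) : f * g * h = f * (g * h) := by
  classical
  let m : G → G → G := fun a b => if h : src a = rng b then mul a b h else a
  have hm : ∀ a b (h : src a = rng b), m a b = mul a b h := fun a b h => dif_pos h
  ext γ
  rw [fn_mul_right (f * g) h, fn_mul_left f (g * h)]
  simp_rw [fn_mul_left f g, fn_mul_right g h, Finset.sum_mul, Finset.mul_sum]
  rw [Finset.sum_sigma', Finset.sum_sigma']
  refine Finset.sum_bij'
    (fun x _ => ⟨(x.2.1, m x.2.2 x.1.2), (x.2.2, x.1.2)⟩)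
    (fun x _ => ⟨(m x.1.1 x.2.1, x.2.2), (x.1.1, x.2.1)⟩) ?_ ?_ ?_ ?_ ?_
  · rintro ⟨⟨a, b⟩, ⟨c, d⟩⟩ hx
    simp only [Finset.mem_sigma, Set.Finite.mem_toFinset, Set.mem_ofPred_eq] at hx ⊢
    obtain ⟨⟨⟨h1, e1⟩, hb⟩, ⟨h2, e2⟩, hc⟩ := hx
    dsimp only at *
    subst e2
    have h3 : src d = rng b := by rw [← h1, src_mul]
    rw [hm _ _ h3]
    refine ⟨⟨⟨h2.trans (rng_mul _ _ _).symm, ?_⟩, hc⟩, ⟨h3, rfl⟩, hb⟩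
    rw [← e1]; exact (mul_assoc c d b h2 h3).symm
  · rintro ⟨⟨c, a⟩, ⟨d, b⟩⟩ hx
    simp only [Finset.mem_sigma, Set.Finite.mem_toFinset, Set.mem_ofPred_eq] at hx ⊢
    obtain ⟨⟨⟨h1, e1⟩, hc⟩, ⟨h2, e2⟩, hb⟩ := hx
    dsimp only at *
    subst e2
    have h3 : src c = rng d := by rw [h1, rng_mul]
    rw [hm _ _ h3]
    refine ⟨⟨⟨(src_mul _ _ _).trans h2, ?_⟩, hb⟩, ⟨h3, rfl⟩, hc⟩
    rw [← e1]; exact mul_assoc c d b h3 h2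
  · rintro ⟨⟨a, b⟩, ⟨c, d⟩⟩ hx
    simp only [Finset.mem_sigma, Set.Finite.mem_toFinset, Set.mem_ofPred_eq] at hx
    obtain ⟨-, ⟨h2, e2⟩, -⟩ := hx
    dsimp only at *
    rw [hm _ _ h2, e2]
  · rintro ⟨⟨c, a⟩, ⟨d, b⟩⟩ hx
    simp only [Finset.mem_sigma, Set.Finite.mem_toFinset, Set.mem_ofPred_eq] at hx
    obtain ⟨-, ⟨h2, e2⟩, -⟩ := hx
    dsimp only at *
    rw [hm _ _ h2, e2]
  · rintro ⟨⟨a, b⟩, ⟨c, d⟩⟩ hx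
    exact _root_.mul_assoc _ _ _

instance : NonUnitalRing (ConvAlg K G) where
  left_distrib f g h := by
    ext γ
    rw [fn_add, fn_mul_left, fn_mul_left, fn_mul_left, ← Finset.sum_add_distrib]
    exact Finset.sum_congr rfl fun p _ => by rw [fn_add, mul_add]
  right_distrib f g h := by
    ext γ
    rw [fn_add, fn_mul_right, fn_mul_right, fn_mul_right, ← Finset.sum_add_distrib]
    exact Finset.sum_congr rfl fun p _ => by rw [fn_add, add_mul]
  zero_mul f := by ext γ; simp [fn_mul_right]
  mul_zero f := by ext γ; simp [fn_mul_left]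
  mul_assoc := conv_assoc

instance : IsScalarTower K (ConvAlg K G) (ConvAlg K G) where
  smul_assoc c f g := by
    ext γ
    simp only [smul_eq_mul, fn_smul, fn_mul_right, Finset.mul_sum, _root_.mul_assoc]

instance : SMulCommClass K (ConvAlg K G) (ConvAlg K G) where
  smul_comm c f g := by
    ext γ
    simp only [smul_eq_mul, fn_smul, fn_mul_left, Finset.mul_sum, mul_left_comm]

end ConvAlg

variable (K) [TopologicalSpace G]

theorem indicator_mem {U : Set G} (hU : IsOpenBisection U) :
    U.indicator (1 : G → K) ∈ convSubmodule K G := by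
  intro x
  refine ⟨Set.Subsingleton.finite ?_, Set.Subsingleton.finite ?_⟩
  · rintro a ⟨ha, ha'⟩ b ⟨hb, hb'⟩
    have h := hU.2.2.injective (a₁ := ⟨a, Set.mem_of_indicator_ne_zero ha'⟩)
      (a₂ := ⟨b, Set.mem_of_indicator_ne_zero hb'⟩) (Subtype.ext (ha.trans hb.symm))
    exact congrArg Subtype.val h
  · rintro a ⟨ha, ha'⟩ b ⟨hb, hb'⟩
    have h := hU.2.1.injective (a₁ := ⟨a, Set.mem_of_indicator_ne_zero ha'⟩)
      (a₂ := ⟨b, Set.mem_of_indicator_ne_zero hb'⟩) (Subtype.ext (ha.trans hb.symm))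
    exact congrArg Subtype.val h

/-- The characteristic function `1_U` of an open bisection. -/
def charFun (U : Set G) (hU : IsOpenBisection U) : ConvAlg K G :=
  ⟨U.indicator 1, indicator_mem K hU⟩

variable (G) in
/-- The underlying `K`-vector space of the Steinberg algebra `A_K(G)`: the span of the
characteristic functions of the compact open bisections of `G`. -/
def steinbergSpan : Submodule K (ConvAlg K G) :=
  Submodule.span K {f | ∃ (U : Set G) (hU : IsOpenBisection U), IsCompact U ∧ f = charFun K U hU}

/-- `A` is the Steinberg algebra `A_K(G)`: the span of the characteristic functions of the compact
open bisections of `G`, with convolution as multiplication. (For given `K` and `G` there is at most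
one such `A`; its existence says that the span is closed under convolution.) -/
def IsSteinbergAlgebra (A : NonUnitalSubalgebra K (ConvAlg K G)) : Prop :=
  A.toSubmodule = steinbergSpan K G

end ArrowGroupoid

/-! ## The graph groupoid -/

namespace CKGr

/-- The edges in `l` form a path starting at the vertex `a`. -/
def IsPathFrom (E : CKGr.{u, v}) : E.Vert → List E.Edge → Prop
  | _, [] => True
  | a, e :: l => E.s e = a ∧ E.IsPathFrom (E.r e) l

/-- The vertex at which a path from `a` along `l` ends. -/
def endFrom (E : CKGr.{u, v}) : E.Vert → List E.Edge → E.Vert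
  | a, [] => a
  | _, e :: l => E.endFrom (E.r e) l

/-- Finite paths, including the vertices as paths of length `0`. -/
structure FinPath (E : CKGr.{u, v}) where
  start : E.Vert
  edges : List E.Edge
  isPath : E.IsPathFrom start edges

/-- Infinite paths. -/
structure InfPath (E : CKGr.{u, v}) where
  edges : Stream' E.Edge
  isPath : ∀ n, E.r (edges.get n) = E.s (edges.get (n + 1))

/-- The set `E* ∪ E^∞` of finite and infinite paths. -/
inductive GenPath (E : CKGr.{u, v}) where
  | fin (p : E.FinPath)
  | inf (p : E.InfPath)

variable {E : CKGr.{u, v}}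

/-- The range (final vertex) of a finite path. -/
def FinPath.range (α : E.FinPath) : E.Vert := E.endFrom α.start α.edges

/-- The length of a finite path. -/
def FinPath.length (α : E.FinPath) : ℕ := α.edges.length

/-- The source of a finite or infinite path. -/
def GenPath.source : E.GenPath → E.Vert
  | .fin p => p.start
  | .inf p => E.s (p.edges.get 0)

/-- `X_E` consists of the infinite paths and of the finite paths that end in a sink or in an
infinite emitter. -/
def GenPath.IsBoundary : E.GenPath → Prop
  | .fin p => E.IsSink p.range ∨ E.IsInfiniteEmitter p.range
  | .inf _ => True

theorem isPathFrom_append {a : E.Vert} {l m : List E.Edge} (hl : E.IsPathFrom a l)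
    (hm : E.IsPathFrom (E.endFrom a l) m) : E.IsPathFrom a (l ++ m) := by
  induction l generalizing a with
  | nil => exact hm
  | cons e l ih => exact ⟨hl.1, ih hl.2 hm⟩

theorem endFrom_append (a : E.Vert) (l m : List E.Edge) :
    E.endFrom a (l ++ m) = E.endFrom (E.endFrom a l) m := by
  induction l generalizing a with
  | nil => rfl
  | cons e l ih => exact ih _

theorem isPath_appendStream {a : E.Vert} {l : List E.Edge} {x : Stream' E.Edge}
    (hl : E.IsPathFrom a l) (hx : ∀ n, E.r (x.get n) = E.s (x.get (n + 1)))
    (h : E.endFrom a l = E.s (x.get 0)) :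
    E.s ((l ++ₛ x).get 0) = a ∧
      ∀ n, E.r ((l ++ₛ x).get n) = E.s ((l ++ₛ x).get (n + 1)) := by
  induction l generalizing a with
  | nil => exact ⟨h.symm, hx⟩
  | cons e l ih =>
    obtain ⟨h0, h1⟩ := ih hl.2 h
    refine ⟨hl.1, fun n => ?_⟩
    cases n with
    | zero => exact h0.symm
    | succ n => exact h1 n

/-- The concatenation `α x` of a finite path `α` and a finite or infinite path `x` with
`r(α) = s(x)`. -/
def FinPath.concat (α : E.FinPath) : (x : E.GenPath) → α.range = x.source → E.GenPath
  | .fin p, h => .fin ⟨α.start, α.edges ++ p.edges, isPathFrom_append α.isPath (by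
    have h' : E.endFrom α.start α.edges = p.start := h
    rw [h']; exact p.isPath)⟩
  | .inf p, h => .inf ⟨α.edges ++ₛ p.edges, (isPath_appendStream α.isPath p.isPath h).2⟩

theorem FinPath.source_concat (α : E.FinPath) (x : E.GenPath) (h : α.range = x.source) :
    (α.concat x h).source = α.start := by
  cases x with
  | fin p => rfl
  | inf p => exact (isPath_appendStream α.isPath p.isPath h).1

/-- The path `α e`, for an edge `e` with `s(e) = r(α)`. -/
def FinPath.snoc (α : E.FinPath) (e : E.Edge) (h : E.s e = α.range) : E.FinPath :=
  ⟨α.start, α.edges ++ [e], isPathFrom_append α.isPath ⟨h, trivial⟩⟩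

variable (E) in
/-- The graph groupoid `G_E`, as a set of triples `(α x, |α| - |β|, β x)` with `x ∈ X_E` and
`r(α) = s(x) = r(β)`. -/
def groupoidSet : Set (E.GenPath × ℤ × E.GenPath) :=
  {g | ∃ (α β : E.FinPath) (x : E.GenPath) (hα : α.range = x.source) (hβ : β.range = x.source),
    x.IsBoundary ∧ g = (α.concat x hα, (α.length : ℤ) - (β.length : ℤ), β.concat x hβ)}

theorem groupoidSet_src {g : E.GenPath × ℤ × E.GenPath} (hg : g ∈ E.groupoidSet) :
    (g.2.2, 0, g.2.2) ∈ E.groupoidSet := by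
  obtain ⟨α, β, x, hα, hβ, hx, rfl⟩ := hg
  exact ⟨β, β, x, hβ, hβ, hx, by simp⟩

theorem groupoidSet_rng {g : E.GenPath × ℤ × E.GenPath} (hg : g ∈ E.groupoidSet) :
    (g.1, 0, g.1) ∈ E.groupoidSet := by
  obtain ⟨α, β, x, hα, hβ, hx, rfl⟩ := hg
  exact ⟨α, α, x, hα, hα, hx, by simp⟩

theorem groupoidSet_inv {g : E.GenPath × ℤ × E.GenPath} (hg : g ∈ E.groupoidSet) :
    (g.2.2, -g.2.1, g.1) ∈ E.groupoidSet := by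
  obtain ⟨α, β, x, hα, hβ, hx, rfl⟩ := hg
  exact ⟨β, α, x, hβ, hα, hx, by simp⟩

theorem appendStream_eq {A : Type w} {l m : List A} {x y : Stream' A} (h : l ++ₛ x = m ++ₛ y)
    (hl : l.length ≤ m.length) : ∃ n, m = l ++ n ∧ x = n ++ₛ y := by
  induction l generalizing m with
  | nil => exact ⟨m, rfl, h⟩
  | cons a l ih =>
    cases m with
    | nil => simp at hl
    | cons b m =>
      obtain ⟨rfl, h'⟩ := Stream'.cons_injective2 h
      obtain ⟨n, rfl, rfl⟩ := ih h' (by simpa using hl)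
      exact ⟨n, rfl, rfl⟩

theorem isPathFrom_of_append {a : E.Vert} {l m : List E.Edge} (h : E.IsPathFrom a (l ++ m)) :
    E.IsPathFrom (E.endFrom a l) m := by
  induction l generalizing a with
  | nil => exact h
  | cons e l ih => exact ih h.2

theorem exists_of_concat_eq {β γ : E.FinPath} {x y : E.GenPath} {hβ : β.range = x.source}
    {hγ : γ.range = y.source} (h : β.concat x hβ = γ.concat y hγ) (hl : β.length ≤ γ.length) :
    ∃ (ε : E.FinPath) (hε : ε.range = y.source), ε.start = β.range ∧
      γ.length = β.length + ε.length ∧ x = ε.concat y hε := by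
  have hs : β.start = γ.start := by
    rw [← β.source_concat x hβ, h, γ.source_concat]
  have key : ∀ n, γ.edges = β.edges ++ n →
      ∃ (ε : E.FinPath) (_ : ε.range = y.source), ε.start = β.range ∧
        γ.length = β.length + ε.length ∧ ε.edges = n := by
    intro n hn
    have hp := γ.isPath
    have hγ' := hγ
    rw [FinPath.range] at hγ'
    rw [hn, ← hs] at hp hγ'
    exact ⟨⟨β.range, n, isPathFrom_of_append hp⟩, by rw [← hγ', endFrom_append]; rfl, rfl,
      by simp [FinPath.length, hn], rfl⟩
  cases x with
  | fin p =>
    cases y with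
    | fin q =>
      simp only [FinPath.concat, GenPath.fin.injEq, FinPath.mk.injEq] at h
      obtain ⟨n, hn, hp⟩ : ∃ n, γ.edges = β.edges ++ n ∧ p.edges = n ++ q.edges := by
        rcases List.append_eq_append_iff.1 h.2 with ⟨n, h1, h2⟩ | ⟨n, h1, h2⟩
        · exact ⟨n, h1, h2⟩
        · have : n = [] := by
            have := congrArg List.length h1
            simp only [FinPath.length] at hl
            simp only [List.length_append] at this
            exact List.eq_nil_of_length_eq_zero (by omega)
          subst this
          exact ⟨[], by simpa using h1.symm, by simpa using h2.symm⟩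
      obtain ⟨ε, hε, h1, h2, rfl⟩ := key n hn
      refine ⟨ε, hε, h1, h2, ?_⟩
      cases p
      simp only [FinPath.concat, GenPath.fin.injEq, FinPath.mk.injEq]
      exact ⟨(h1.trans hβ).symm, hp⟩
    | inf q => simp [FinPath.concat] at h
  | inf p =>
    cases y with
    | fin q => simp [FinPath.concat] at h
    | inf q =>
      simp only [FinPath.concat, GenPath.inf.injEq, InfPath.mk.injEq] at h
      obtain ⟨n, hn, hp⟩ := appendStream_eq h hl
      obtain ⟨ε, hε, h1, h2, rfl⟩ := key n hn
      refine ⟨ε, hε, h1, h2, ?_⟩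
      cases p
      simp only [FinPath.concat, GenPath.inf.injEq, InfPath.mk.injEq]
      exact hp

theorem exists_concat_concat (α ε : E.FinPath) (y : E.GenPath) (hε : ε.range = y.source)
    (h : α.range = (ε.concat y hε).source) :
    ∃ (δ : E.FinPath) (hδ : δ.range = y.source), δ.length = α.length + ε.length ∧
      α.concat (ε.concat y hε) h = δ.concat y hδ := by
  have h' : α.range = ε.start := h.trans (ε.source_concat y hε)
  have hr : E.endFrom α.start (α.edges ++ ε.edges) = y.source := by
    rw [endFrom_append, ← hε]
    exact congrArg (fun a => E.endFrom a ε.edges) h'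
  refine ⟨⟨α.start, α.edges ++ ε.edges, isPathFrom_append α.isPath (by
    have h2 : E.endFrom α.start α.edges = ε.start := h'
    rw [h2]; exact ε.isPath)⟩, hr,
    by simp [FinPath.length], ?_⟩
  cases y with
  | fin q => simp [FinPath.concat]
  | inf q => simp [FinPath.concat, Stream'.append_append_stream]

theorem groupoidSet_mul {p q z : E.GenPath} {m n : ℤ} (h1 : (p, m, q) ∈ E.groupoidSet)
    (h2 : (q, n, z) ∈ E.groupoidSet) : (p, m + n, z) ∈ E.groupoidSet := by
  obtain ⟨α, β, x, hα, hβ, hx, e1⟩ := h1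
  obtain ⟨γ, δ, y, hγ, hδ, hy, e2⟩ := h2
  simp only [Prod.mk.injEq] at e1 e2
  obtain ⟨rfl, rfl, rfl⟩ := e1
  obtain ⟨e, rfl, rfl⟩ := e2
  rcases le_total β.length γ.length with hl | hl
  · obtain ⟨ε, hε, -, h4, rfl⟩ := exists_of_concat_eq e hl
    obtain ⟨κ, hκ, h5, h6⟩ := exists_concat_concat α ε y hε hα
    exact ⟨κ, δ, y, hκ, hδ, hy, by rw [h6, h5, h4]; push_cast; ring_nf⟩
  · obtain ⟨ε, hε, -, h4, rfl⟩ := exists_of_concat_eq e.symm hl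
    obtain ⟨κ, hκ, h5, h6⟩ := exists_concat_concat δ ε x hε hδ
    exact ⟨α, κ, x, hα, hκ, hx, by rw [h6, h5, h4]; push_cast; ring_nf⟩

variable (E) in
/-- The type of arrows of the graph groupoid `G_E`. -/
def GraphGroupoid := E.groupoidSet

/-- `(x, m, y)` has range `x` and source `y`, and `(x, m, y)(y, n, z) = (x, m + n, z)`,
`(x, m, y)⁻¹ = (y, -m, x)`; units are the triples `(x, 0, x)`. -/
instance : ArrowGroupoid E.GraphGroupoid where
  src g := ⟨(g.1.2.2, 0, g.1.2.2), groupoidSet_src g.2⟩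
  rng g := ⟨(g.1.1, 0, g.1.1), groupoidSet_rng g.2⟩
  inv g := ⟨(g.1.2.2, -g.1.2.1, g.1.1), groupoidSet_inv g.2⟩
  mul g h e := ⟨(g.1.1, g.1.2.1 + h.1.2.1, h.1.2.2), by
    have e' : g.1.2.2 = h.1.1 := congrArg (fun a => a.1.1) e
    exact groupoidSet_mul (m := g.1.2.1) (q := g.1.2.2) g.2 (e' ▸ h.2)⟩
  rng_src _ := rfl
  src_rng _ := rfl
  src_inv _ := rfl
  rng_inv _ := rfl
  src_mul _ _ _ := rfl
  rng_mul _ _ _ := rfl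
  mul_assoc _ _ _ _ _ := Subtype.ext (by simp [add_assoc])
  mul_src _ := Subtype.ext (by simp)
  rng_mul_self _ := Subtype.ext (by simp)
  inv_mul _ := Subtype.ext (by simp)
  mul_inv _ := Subtype.ext (by simp)

/-- `Z(α, β) = {(α x, |α| - |β|, β x) | x ∈ X_E, r(α) = s(x) = r(β)}`. -/
def cylinder (α β : E.FinPath) : Set E.GraphGroupoid :=
  {g | ∃ (x : E.GenPath) (hα : α.range = x.source) (hβ : β.range = x.source),
    x.IsBoundary ∧ g.1 = (α.concat x hα, (α.length : ℤ) - (β.length : ℤ), β.concat x hβ)}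

/-- `Z(α, β, F) = Z(α, β) \ ⋃_{e ∈ F} Z(α e, β e)`, where `r(α) = r(β)` and `F` is a finite subset
of `s⁻¹(r(α))`. -/
def basicSet (α β : E.FinPath) (hαβ : α.range = β.range) (F : Finset E.Edge)
    (hF : ∀ e ∈ F, E.s e = α.range) : Set E.GraphGroupoid :=
  cylinder α β \ ⋃ (e : E.Edge) (he : e ∈ F),
    cylinder (α.snoc e (hF e he)) (β.snoc e ((hF e he).trans hαβ))

/-- The topology on `G_E` generated by the sets `Z(α, β, F)`. -/
instance : TopologicalSpace E.GraphGroupoid :=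
  TopologicalSpace.generateFrom {U | ∃ (α β : E.FinPath) (hαβ : α.range = β.range)
    (F : Finset E.Edge) (hF : ∀ e ∈ F, E.s e = α.range), U = basicSet α β hαβ F hF}

variable (E) in
/-- The subset `G_E|_H` of the triples `(α x, |α| - |β|, β x)` in `G_E` with `s(α), s(β) ∈ H`. -/
def restrictSet (H : Set E.Vert) : Set E.GraphGroupoid :=
  {g | ∃ (α β : E.FinPath) (x : E.GenPath) (hα : α.range = x.source) (hβ : β.range = x.source),
    x.IsBoundary ∧ α.start ∈ H ∧ β.start ∈ H ∧
      g.1 = (α.concat x hα, (α.length : ℤ) - (β.length : ℤ), β.concat x hβ)}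

theorem mem_restrictSet {H : Set E.Vert} {g : E.GraphGroupoid} :
    g ∈ E.restrictSet H ↔ g.1.1.source ∈ H ∧ g.1.2.2.source ∈ H := by
  constructor
  · rintro ⟨α, β, x, hα, hβ, hx, h1, h2, e⟩
    rw [e]
    exact ⟨by rwa [α.source_concat], by rwa [β.source_concat]⟩
  · rintro ⟨h1, h2⟩
    obtain ⟨α, β, x, hα, hβ, hx, e⟩ := g.2
    rw [e] at h1 h2
    simp only [FinPath.source_concat] at h1 h2
    exact ⟨α, β, x, hα, hβ, hx, h1, h2, e⟩

variable (E) in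
/-- The restricted groupoid `G_E|_H`, with the subspace topology of `G_E`. -/
abbrev RestrictedGroupoid (H : Set E.Vert) := ↥(E.restrictSet H)

open ArrowGroupoid in
/-- `G_E|_H` is a subgroupoid of `G_E`. -/
instance (H : Set E.Vert) : ArrowGroupoid (E.RestrictedGroupoid H) where
  src g := ⟨src g.1, mem_restrictSet.2 ⟨(mem_restrictSet.1 g.2).2, (mem_restrictSet.1 g.2).2⟩⟩
  rng g := ⟨rng g.1, mem_restrictSet.2 ⟨(mem_restrictSet.1 g.2).1, (mem_restrictSet.1 g.2).1⟩⟩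
  inv g := ⟨inv g.1, mem_restrictSet.2 ⟨(mem_restrictSet.1 g.2).2, (mem_restrictSet.1 g.2).1⟩⟩
  mul g h e := ⟨mul g.1 h.1 (congrArg Subtype.val e),
    mem_restrictSet.2 ⟨(mem_restrictSet.1 g.2).1, (mem_restrictSet.1 h.2).2⟩⟩
  rng_src g := Subtype.ext (rng_src g.1)
  src_rng g := Subtype.ext (src_rng g.1)
  src_inv g := Subtype.ext (src_inv g.1)
  rng_inv g := Subtype.ext (rng_inv g.1)
  src_mul g h e := Subtype.ext (src_mul g.1 h.1 (congrArg Subtype.val e))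
  rng_mul g h e := Subtype.ext (rng_mul g.1 h.1 (congrArg Subtype.val e))
  mul_assoc g h l e e' := Subtype.ext
    (mul_assoc g.1 h.1 l.1 (congrArg Subtype.val e) (congrArg Subtype.val e'))
  mul_src g := Subtype.ext (mul_src g.1)
  rng_mul_self g := Subtype.ext (rng_mul_self g.1)
  inv_mul g := Subtype.ext (inv_mul g.1)
  mul_inv g := Subtype.ext (mul_inv g.1)

end CKGr

/-! ## Direct limits of non-unital algebras -/

/-- The `K`-algebra `A`, with the homomorphisms `θ i : C i → A`, is a direct limit of the system
`(C i, ψ)` in the category of (not necessarily unital) `K`-algebras. The test algebras `B` range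
over an arbitrary universe `t`. -/
structure IsAlgDirectLimit (K : Type k) [Field K] {I : Type w} [Preorder I] (C : I → Type u)
    [∀ i, NonUnitalRing (C i)] [∀ i, Module K (C i)] (ψ : ∀ i j, i ≤ j → (C i →ₙₐ[K] C j))
    (A : Type v) [NonUnitalRing A] [Module K A] (θ : ∀ i, C i →ₙₐ[K] A) : Prop where
  compatible : ∀ i j (hij : i ≤ j) (x : C i), θ j (ψ i j hij x) = θ i x
  universal : ∀ (B : Type t) [NonUnitalRing B] [Module K B] [IsScalarTower K B B]
    [SMulCommClass K B B] (g : ∀ i, C i →ₙₐ[K] B),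
    (∀ i j (hij : i ≤ j) (x : C i), g j (ψ i j hij x) = g i x) →
      ∃! f : A →ₙₐ[K] B, ∀ i (x : C i), f (θ i x) = g i x

end

/-!
# Corners of Leavitt path algebras and Steinberg algebras of restricted graph groupoids

Write `G` for the groupoid of the direct limit `E` and `T` for the union of the images of the sets
`T i`. For every CK-morphism `E i → E`, composing `L_K(E i) → L_K(E)` with the homomorphism from
`L_K(E)` to functions on `G` that sends a monomial `α β*` to the characteristic function of the
cylinder set `Z(α, β)` (`CKGr.toConv`), and restricting functions to `G|_T`, yields the
homomorphisms `θ i` from the corners (`CKGr.cornerToConv`). A directed system of algebras with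
compatible homomorphisms to `A` that are injective and jointly surjective has `A` as its direct
limit (`isAlgDirectLimit_of_injective`), so the following facts suffice.

* *Injectivity* (`CKGr.injective_toConv_comp_map`). Monomials `α β*` span a Leavitt path algebra,
  and they are sent to functions supported in degree `|α| - |β|`. So, the kernel contains the
  homogeneous components of its elements. A nonzero homogeneous element can be multiplied from both
  sides into a nonzero multiple of a vertex (`CKGr.Leavitt.isReducible_of_mem_degSpan`): removing
  first edges reduces to degree `0`, where one argues by induction on the length of the paths, with
  the Cuntz-Krieger relation at regular vertices, and with an edge orthogonal to all terms of
  positive length at infinite emitters. Finally, no vertex is sent to `0`, as every vertex is the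
  source of a boundary path.
* *The span* (`CKGr.steinbergSpan_eq_cylSpan`). The Steinberg algebra of `G|_T` is the span of the
  characteristic functions of the sets `Z(α, β)` with `s(α), s(β) ∈ T`. These sets are compact open
  bisections; compactness is an ultrafilter argument (`CKGr.isCompact_cylinder`). Conversely, as
  cylinder sets are nested or disjoint, the span of their characteristic functions is closed under
  pointwise multiplication, hence contains the characteristic functions of the basic open sets
  `Z(α, β, F)` and of their finite unions, and so of all compact open sets.
* *Surjectivity* (`CKGr.exists_cornerToConv_eq`). The direct limit `E` is the union of the images of
  the graphs `E i`: this union is a subgraph whose inclusion is again a CK-morphism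
  (`CKGr.imageGraphInclusion`), because a vertex regular in it is regular in some `E i`, and
  the universal property of `E` provides a section of this inclusion. So, finite paths in `E` come
  from some `E i`.

The last two facts also show that the span is closed under convolution.
-/

noncomputable section

/-! ### Finite paths, infinite paths and cylinder sets -/

namespace CKGr

variable {E : CKGr.{u, v}}

@[ext]
theorem FinPath.ext {α β : E.FinPath} (h : α.start = β.start) (h' : α.edges = β.edges) :
    α = β := by
  cases α; cases β; simp_all

/-- The path of length `0` at the vertex `a`. -/
def FinPath.nil (a : E.Vert) : E.FinPath := ⟨a, [], trivial⟩

/-- The path of length `1` along the edge `e`. -/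
def FinPath.single (e : E.Edge) : E.FinPath := ⟨E.s e, [e], rfl, trivial⟩

/-- The concatenation of two finite paths. -/
def FinPath.append (α ε : E.FinPath) (h : α.range = ε.start) : E.FinPath :=
  ⟨α.start, α.edges ++ ε.edges, isPathFrom_append α.isPath (by
    have h' : E.endFrom α.start α.edges = ε.start := h
    rw [h']; exact ε.isPath)⟩

@[simp] theorem FinPath.start_nil (a : E.Vert) : (FinPath.nil a).start = a := rfl
@[simp] theorem FinPath.range_nil (a : E.Vert) : (FinPath.nil a).range = a := rfl
@[simp] theorem FinPath.length_nil (a : E.Vert) : (FinPath.nil a).length = 0 := rfl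
@[simp] theorem FinPath.start_single (e : E.Edge) : (FinPath.single e).start = E.s e := rfl
@[simp] theorem FinPath.range_single (e : E.Edge) : (FinPath.single e).range = E.r e := rfl
@[simp] theorem FinPath.length_single (e : E.Edge) : (FinPath.single e).length = 1 := rfl

@[simp]
theorem FinPath.range_append (α ε : E.FinPath) (h : α.range = ε.start) :
    (α.append ε h).range = ε.range := by
  have h' : E.endFrom α.start α.edges = ε.start := h
  simp [FinPath.range, FinPath.append, endFrom_append, h']

@[simp]
theorem FinPath.length_append (α ε : E.FinPath) (h : α.range = ε.start) :
    (α.append ε h).length = α.length + ε.length := by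
  simp [FinPath.length, FinPath.append]

@[simp]
theorem FinPath.append_nil (α : E.FinPath) (a : E.Vert) (h : α.range = a) :
    α.append (FinPath.nil a) h = α := by
  ext1
  · rfl
  · simp [FinPath.append, FinPath.nil]

@[simp]
theorem FinPath.nil_append (ε : E.FinPath) (a : E.Vert) (h : a = ε.start) :
    (FinPath.nil a).append ε h = ε := by
  ext1
  · exact h
  · rfl

theorem FinPath.append_assoc (α β γ : E.FinPath) (h : α.range = β.start)
    (h' : β.range = γ.start) :
    (α.append β h).append γ (by simpa using h') = α.append (β.append γ h') h := by
  ext1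
  · rfl
  · simp [FinPath.append]

theorem FinPath.snoc_eq_append (α : E.FinPath) (e : E.Edge) (h : E.s e = α.range) :
    α.snoc e h = α.append (FinPath.single e)
      (show α.range = (FinPath.single e).start from h.symm) := rfl

@[simp]
theorem FinPath.range_snoc (α : E.FinPath) (e : E.Edge) (h : E.s e = α.range) :
    (α.snoc e h).range = E.r e := by
  rw [snoc_eq_append, range_append, range_single]

@[simp]
theorem FinPath.length_snoc (α : E.FinPath) (e : E.Edge) (h : E.s e = α.range) :
    (α.snoc e h).length = α.length + 1 := by
  rw [snoc_eq_append, length_append, length_single]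

theorem FinPath.eq_nil_of_length {α : E.FinPath} (h : α.length = 0) :
    α = FinPath.nil α.start := by
  ext1
  · rfl
  · exact List.eq_nil_of_length_eq_zero h

/-- A path of positive length starts with an edge. -/
theorem FinPath.exists_eq_single_append {α : E.FinPath} (h : α.length ≠ 0) :
    ∃ (e : E.Edge) (β : E.FinPath) (he : (FinPath.single e).range = β.start),
      α = (FinPath.single e).append β he := by
  obtain ⟨a, l, hl⟩ := α
  cases l with
  | nil => simp [FinPath.length] at h
  | cons e l => exact ⟨e, ⟨E.r e, l, hl.2⟩, rfl, by ext1; exacts [hl.1.symm, rfl]⟩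

theorem FinPath.concat_append (α ε : E.FinPath) (h : α.range = ε.start) (x : E.GenPath)
    (hx : ε.range = x.source) :
    (α.append ε h).concat x (by simpa using hx) =
      α.concat (ε.concat x hx) (by rw [source_concat, h]) := by
  cases x with
  | fin q => simp [concat, append]
  | inf q => simp [concat, append, Stream'.append_append_stream]

theorem FinPath.isBoundary_concat (α : E.FinPath) (x : E.GenPath) (h : α.range = x.source) :
    (α.concat x h).IsBoundary ↔ x.IsBoundary := by
  cases x with
  | fin q =>
    have : (α.append q h).range = q.range := range_append ..
    show (_ ∨ _) ↔ (_ ∨ _)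
    rw [← this]; rfl
  | inf q => exact Iff.rfl

/-- Prefixes of the same length of a path agree, and so do the remainders. -/
theorem eq_of_concat_eq {α β : E.FinPath} {x y : E.GenPath} {hα : α.range = x.source}
    {hβ : β.range = y.source} (h : α.concat x hα = β.concat y hβ) (hl : α.length = β.length) :
    α = β ∧ x = y := by
  have hs : α.start = β.start := by
    rw [← α.source_concat x hα, h, β.source_concat]
  have key : α.edges = β.edges → α = β := fun h => FinPath.ext hs h
  cases x with
  | fin p =>
    cases y with
    | fin q =>
      simp only [FinPath.concat, GenPath.fin.injEq, FinPath.mk.injEq] at h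
      obtain ⟨h1, h2⟩ := List.append_inj h.2 hl
      obtain rfl := key h1
      exact ⟨rfl, congrArg _ (FinPath.ext (hα.symm.trans hβ) h2)⟩
    | inf q => simp [FinPath.concat] at h
  | inf p =>
    cases y with
    | fin q => simp [FinPath.concat] at h
    | inf q =>
      simp only [FinPath.concat, GenPath.inf.injEq, InfPath.mk.injEq] at h
      obtain ⟨n, h1, h2⟩ := appendStream_eq h hl.le
      have h3 : n = [] := by
        have := congrArg List.length h1
        simp only [FinPath.length] at hl
        simp only [List.length_append] at this
        exact List.eq_nil_of_length_eq_zero (by omega)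
      subst h3
      refine ⟨key (by simpa using h1.symm), ?_⟩
      cases p; cases q
      congr 2

/-- Two finite initial pieces of the same path are comparable. -/
theorem exists_append_of_concat_eq {β γ : E.FinPath} {x y : E.GenPath} {hβ : β.range = x.source}
    {hγ : γ.range = y.source} (h : β.concat x hβ = γ.concat y hγ) (hl : β.length ≤ γ.length) :
    ∃ (ε : E.FinPath) (hε : ε.range = y.source) (h' : β.range = ε.start),
      γ = β.append ε h' ∧ x = ε.concat y hε := by
  obtain ⟨ε, hε, h1, h2, rfl⟩ := exists_of_concat_eq h hl
  refine ⟨ε, hε, h1.symm, ?_, rfl⟩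
  rw [← FinPath.concat_append β ε h1.symm y hε] at h
  exact ((eq_of_concat_eq h (by simp [h2])).1).symm

/-- The arrow `(α x, |α| - |β|, β x)`. -/
def arrow (α β : E.FinPath) (x : E.GenPath) (hα : α.range = x.source) (hβ : β.range = x.source)
    (hx : x.IsBoundary) : E.GraphGroupoid :=
  ⟨(α.concat x hα, (α.length : ℤ) - (β.length : ℤ), β.concat x hβ), α, β, x, hα, hβ, hx, rfl⟩

theorem mem_cylinder {α β : E.FinPath} {g : E.GraphGroupoid} :
    g ∈ cylinder α β ↔ ∃ (x : E.GenPath) (hα : α.range = x.source) (hβ : β.range = x.source)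
      (hx : x.IsBoundary), g = arrow α β x hα hβ hx := by
  constructor
  · rintro ⟨x, hα, hβ, hx, e⟩
    exact ⟨x, hα, hβ, hx, Subtype.ext e⟩
  · rintro ⟨x, hα, hβ, hx, rfl⟩
    exact ⟨x, hα, hβ, hx, rfl⟩

theorem arrow_mem_cylinder (α β : E.FinPath) (x : E.GenPath) (hα : α.range = x.source)
    (hβ : β.range = x.source) (hx : x.IsBoundary) : arrow α β x hα hβ hx ∈ cylinder α β :=
  mem_cylinder.2 ⟨x, hα, hβ, hx, rfl⟩

theorem exists_mem_cylinder (g : E.GraphGroupoid) :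
    ∃ α β : E.FinPath, α.range = β.range ∧ g ∈ cylinder α β := by
  obtain ⟨_, α, β, x, hα, hβ, hx, rfl⟩ := g
  exact ⟨α, β, hα.trans hβ.symm, arrow_mem_cylinder α β x hα hβ hx⟩

theorem range_eq_of_mem_cylinder {α β : E.FinPath} {g : E.GraphGroupoid}
    (h : g ∈ cylinder α β) : α.range = β.range := by
  obtain ⟨x, hα, hβ, -⟩ := h
  exact hα.trans hβ.symm

theorem arrow_append (α β ε : E.FinPath) (hα : α.range = ε.start) (hβ : β.range = ε.start)
    (x : E.GenPath) (hx : ε.range = x.source) (hb : x.IsBoundary) :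
    arrow (α.append ε hα) (β.append ε hβ) x (by simpa using hx) (by simpa using hx) hb =
      arrow α β (ε.concat x hx) (by rw [FinPath.source_concat, hα])
        (by rw [FinPath.source_concat, hβ]) ((ε.isBoundary_concat x hx).2 hb) := by
  apply Subtype.ext
  simp [arrow, FinPath.concat_append _ _ _ x hx]

theorem cylinder_append_subset (α β ε : E.FinPath) (hα : α.range = ε.start)
    (hβ : β.range = ε.start) : cylinder (α.append ε hα) (β.append ε hβ) ⊆ cylinder α β := by
  intro g hg
  obtain ⟨x, h1, h2, hx, rfl⟩ := mem_cylinder.1 hg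
  rw [FinPath.range_append] at h1
  rw [arrow_append α β ε hα hβ x h1 hx]
  exact arrow_mem_cylinder ..

/-- Two cylinder sets that meet are nested. -/
theorem exists_append_of_mem_cylinder {α β γ δ : E.FinPath} {g : E.GraphGroupoid}
    (h : g ∈ cylinder α β) (h' : g ∈ cylinder γ δ) (hl : α.length ≤ γ.length) :
    ∃ (ε : E.FinPath) (hα : α.range = ε.start) (hβ : β.range = ε.start),
      γ = α.append ε hα ∧ δ = β.append ε hβ := by
  obtain ⟨x, hα, hβ, hx, e⟩ := h
  obtain ⟨y, hγ, hδ, hy, e'⟩ := h'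
  rw [e] at e'
  simp only [Prod.mk.injEq] at e'
  obtain ⟨e1, e2, e3⟩ := e'
  obtain ⟨ε, hε, h1, rfl, rfl⟩ := exists_append_of_concat_eq e1 hl
  have h2 : β.range = ε.start := by rw [hβ, FinPath.source_concat]
  refine ⟨ε, h1, h2, rfl, ?_⟩
  rw [← FinPath.concat_append β ε h2 y hε] at e3
  refine (eq_of_concat_eq e3 ?_).1.symm
  rw [FinPath.length_append] at e2 ⊢
  push_cast at e2
  omega

/-- A property of finite paths that holds for the path of length `0` at `a` either holds for some
path from `a` and for none of its extensions by an edge, or holds for all finite initial pieces of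
some infinite path from `a`. -/
theorem exists_maximal_or_infinite (P : E.FinPath → Prop) (a : E.Vert) (h : P (FinPath.nil a)) :
    (∃ ε : E.FinPath, ε.start = a ∧ P ε ∧ ∀ e (he : E.s e = ε.range), ¬ P (ε.snoc e he)) ∨
      ∃ x : E.InfPath, (GenPath.inf x).source = a ∧
        ∀ n : ℕ, ∃ (ε : E.FinPath) (y : E.GenPath) (hε : ε.range = y.source),
          ε.length = n ∧ P ε ∧ GenPath.inf x = ε.concat y hε := by
  by_cases hmax : ∃ ε : E.FinPath, ε.start = a ∧ P ε ∧
      ∀ e (he : E.s e = ε.range), ¬ P (ε.snoc e he)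
  · exact Or.inl hmax
  right
  have step : ∀ ε : {ε : E.FinPath // ε.start = a ∧ P ε},
      ∃ e, ∃ he : E.s e = ε.1.range, P (ε.1.snoc e he) := by
    rintro ⟨ε, h1, h2⟩
    by_contra hc
    refine hmax ⟨ε, h1, h2, fun e he hP => hc ⟨e, he, hP⟩⟩
  choose next hnext hP using step
  let p : ℕ → {ε : E.FinPath // ε.start = a ∧ P ε} := fun n =>
    Nat.rec ⟨FinPath.nil a, rfl, h⟩
      (fun _ q => ⟨q.1.snoc (next q) (hnext q), q.2.1, hP q⟩) n
  have hp : ∀ n, (p (n + 1)).1 = (p n).1.snoc (next (p n)) (hnext (p n)) := fun n => rfl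
  let st : Stream' E.Edge := fun n => next (p n)
  have hlen : ∀ n, (p n).1.length = n := by
    intro n
    induction n with
    | zero => rfl
    | succ n ih => rw [hp, FinPath.length_snoc, ih]
  have hst : ∀ n, (p n).1.edges ++ₛ st.drop n = st := by
    intro n
    induction n with
    | zero => rfl
    | succ n ih =>
      have : (p (n + 1)).1.edges = (p n).1.edges ++ [next (p n)] := rfl
      rw [this, Stream'.append_append_stream]
      conv_rhs => rw [← ih]
      congr 1
      rw [← Stream'.eta (st.drop n)]
      simp only [Stream'.head_drop, Stream'.tail_drop]
      rfl
  have hr : ∀ n, E.r (st.get n) = E.s (st.get (n + 1)) := by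
    intro n
    have h1 : E.s (next (p (n + 1))) = (p (n + 1)).1.range := hnext _
    rw [hp, FinPath.range_snoc] at h1
    exact h1.symm
  refine ⟨⟨st, hr⟩, hnext (p 0), fun n => ?_⟩
  refine ⟨(p n).1, .inf ⟨st.drop n, fun m => ?_⟩, ?_, hlen n, (p n).2.2, ?_⟩
  · simp only [Stream'.get_drop]
    have := hr (n + m)
    rwa [show n + (m + 1) = n + m + 1 by omega]
  · show _ = E.s _
    simp only [Stream'.get_drop]
    exact (hnext (p n)).symm
  · simp only [FinPath.concat, GenPath.inf.injEq, InfPath.mk.injEq]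
    exact (hst n).symm

theorem exists_isBoundary (a : E.Vert) : ∃ x : E.GenPath, a = x.source ∧ x.IsBoundary := by
  rcases exists_maximal_or_infinite (fun _ : E.FinPath => True) a trivial with
    ⟨ε, h1, -, h2⟩ | ⟨x, h1, -⟩
  · refine ⟨.fin ε, h1.symm, Or.inl (Set.eq_empty_of_forall_notMem fun e he => h2 e he trivial)⟩
  · exact ⟨.inf x, h1.symm, trivial⟩

theorem cylinder_nonempty (α β : E.FinPath) (h : α.range = β.range) :
    (cylinder α β).Nonempty := by
  obtain ⟨x, h1, hx⟩ := exists_isBoundary α.range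
  exact ⟨_, arrow_mem_cylinder α β x h1 (h.symm.trans h1) hx⟩

end CKGr

/-! ### The topology of the graph groupoid -/

namespace CKGr

open ArrowGroupoid Topology

variable {E : CKGr.{u, v}}

theorem not_isRegular_iff {a : E.Vert} :
    ¬ E.IsRegular a ↔ E.IsSink a ∨ E.IsInfiniteEmitter a := by
  unfold IsRegular IsSink IsInfiniteEmitter Set.Infinite
  rw [← Set.not_nonempty_iff_eq_empty]
  tauto

theorem GenPath.eq_nil_or_eq_concat (x : E.GenPath) :
    x = .fin (FinPath.nil x.source) ∨ ∃ (e : E.Edge) (y : E.GenPath)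
      (he : (FinPath.single e).range = y.source), x = (FinPath.single e).concat y he := by
  cases x with
  | fin p =>
    by_cases h : p.length = 0
    · left
      conv_lhs => rw [FinPath.eq_nil_of_length h]
      rfl
    · right
      obtain ⟨e, q, he, rfl⟩ := FinPath.exists_eq_single_append h
      exact ⟨e, .fin q, he, rfl⟩
  | inf p =>
    right
    refine ⟨p.edges.get 0, .inf ⟨p.edges.drop 1, fun n => ?_⟩, ?_, ?_⟩
    · exact p.isPath (n + 1)
    · exact p.isPath 0
    · cases p
      simp only [FinPath.concat, GenPath.inf.injEq, InfPath.mk.injEq]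
      exact (Stream'.eta _).symm

/-- A boundary path starting at a regular vertex has a first edge. -/
theorem GenPath.IsBoundary.exists_eq_concat {x : E.GenPath} (hx : x.IsBoundary)
    (h : E.IsRegular x.source) : ∃ (e : E.Edge) (y : E.GenPath)
      (he : (FinPath.single e).range = y.source), x = (FinPath.single e).concat y he := by
  rcases x.eq_nil_or_eq_concat with h' | h'
  · rw [h'] at hx
    exact absurd h (not_isRegular_iff.2 hx)
  · exact h'

theorem length_eq_zero_of_concat_eq_nil {ε : E.FinPath} {y : E.GenPath} {hy : ε.range = y.source}
    {a : E.Vert} (h : GenPath.fin (FinPath.nil a) = ε.concat y hy) : ε.length = 0 := by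
  cases y with
  | fin q =>
    have h' := congrArg FinPath.length (GenPath.fin.inj h)
    simp only [FinPath.length, FinPath.nil, List.length_append, List.length_nil] at h'
    simp only [FinPath.length]
    omega
  | inf q => simp [FinPath.concat] at h

theorem eq_of_mem_cylinder {α β γ δ : E.FinPath} {g : E.GraphGroupoid}
    (h : g ∈ cylinder α β) (h' : g ∈ cylinder γ δ) (hl : α.length = γ.length) :
    γ = α ∧ δ = β := by
  obtain ⟨ε, hα, hβ, rfl, rfl⟩ := exists_append_of_mem_cylinder h h' hl.le
  rw [FinPath.length_append] at hl
  obtain h0 : ε = FinPath.nil ε.start := FinPath.eq_nil_of_length (by omega)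
  generalize ε.start = a at h0
  subst h0
  exact ⟨FinPath.append_nil _ _ _, FinPath.append_nil _ _ _⟩

theorem cylinder_subset_of_mem {α β γ δ : E.FinPath} {g : E.GraphGroupoid}
    (h : g ∈ cylinder α β) (h' : g ∈ cylinder γ δ) (hl : α.length ≤ γ.length) :
    cylinder γ δ ⊆ cylinder α β := by
  obtain ⟨ε, hα, hβ, rfl, rfl⟩ := exists_append_of_mem_cylinder h h' hl
  exact cylinder_append_subset ..

theorem arrow_mem_cylinder_append_iff {α β : E.FinPath} {x : E.GenPath} {hα : α.range = x.source}
    {hβ : β.range = x.source} {hx : x.IsBoundary} {ε : E.FinPath}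
    {h1 : α.range = ε.start} {h2 : β.range = ε.start} :
    arrow α β x hα hβ hx ∈ cylinder (α.append ε h1) (β.append ε h2) ↔
      ∃ (y : E.GenPath) (hy : ε.range = y.source), x = ε.concat y hy := by
  constructor
  · intro h
    obtain ⟨y, h3, h4, hy, e⟩ := mem_cylinder.1 h
    rw [FinPath.range_append] at h3
    rw [arrow_append α β ε h1 h2 y h3 hy] at e
    exact ⟨y, h3, (eq_of_concat_eq (congrArg (fun g => g.1.1) e) rfl).2⟩
  · rintro ⟨y, hy, rfl⟩
    rw [← arrow_append α β ε h1 h2 y hy ((ε.isBoundary_concat y hy).1 hx)]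
    exact arrow_mem_cylinder ..

theorem arrow_mem_cylinder_snoc_iff {α β : E.FinPath} {x : E.GenPath} {hα : α.range = x.source}
    {hβ : β.range = x.source} {hx : x.IsBoundary} {e : E.Edge}
    {h1 : E.s e = α.range} {h2 : E.s e = β.range} :
    arrow α β x hα hβ hx ∈ cylinder (α.snoc e h1) (β.snoc e h2) ↔
      ∃ (y : E.GenPath) (hy : (FinPath.single e).range = y.source),
        x = (FinPath.single e).concat y hy :=
  arrow_mem_cylinder_append_iff (ε := FinPath.single e) (h1 := h1.symm) (h2 := h2.symm)

theorem mem_basicSet {α β : E.FinPath} {hαβ : α.range = β.range} {F : Finset E.Edge}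
    {hF : ∀ e ∈ F, E.s e = α.range} {g : E.GraphGroupoid} :
    g ∈ basicSet α β hαβ F hF ↔ g ∈ cylinder α β ∧ ∀ (e : E.Edge) (he : e ∈ F),
      g ∉ cylinder (α.snoc e (hF e he)) (β.snoc e ((hF e he).trans hαβ)) := by
  simp [basicSet]

/-- For arrows `(α x, |α| - |β|, β x)`, membership in `Z(α, β, F)` depends on `x` only. -/
theorem arrow_mem_basicSet_iff {α β : E.FinPath} {x : E.GenPath} {hα : α.range = x.source}
    {hβ : β.range = x.source} {hx : x.IsBoundary} {hαβ : α.range = β.range} {F : Finset E.Edge}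
    {hF : ∀ e ∈ F, E.s e = α.range} :
    arrow α β x hα hβ hx ∈ basicSet α β hαβ F hF ↔
      ∀ e ∈ F, ¬ ∃ (y : E.GenPath) (hy : (FinPath.single e).range = y.source),
        x = (FinPath.single e).concat y hy := by
  rw [mem_basicSet]
  constructor
  · rintro ⟨-, h⟩ e he h'
    exact h e he (arrow_mem_cylinder_snoc_iff.2 h')
  · intro h
    exact ⟨arrow_mem_cylinder .., fun e he h' => h e he (arrow_mem_cylinder_snoc_iff.1 h')⟩

theorem basicSet_subset_cylinder {α β : E.FinPath} {hαβ : α.range = β.range} {F : Finset E.Edge}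
    {hF : ∀ e ∈ F, E.s e = α.range} : basicSet α β hαβ F hF ⊆ cylinder α β :=
  Set.sdiff_subset

theorem basicSet_empty (α β : E.FinPath) (hαβ : α.range = β.range) :
    basicSet α β hαβ ∅ (by simp) = cylinder α β := by
  ext g; simp [mem_basicSet]

/-- A longer cylinder set that meets `Z(α, β, F)` is contained in it. -/
theorem cylinder_subset_basicSet {α β γ δ : E.FinPath} {hαβ : α.range = β.range}
    {F : Finset E.Edge} {hF : ∀ e ∈ F, E.s e = α.range} {g : E.GraphGroupoid}
    (h : g ∈ basicSet α β hαβ F hF) (h' : g ∈ cylinder γ δ) (hl : α.length < γ.length) :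
    cylinder γ δ ⊆ basicSet α β hαβ F hF := by
  rw [mem_basicSet] at h
  intro g' hg'
  refine mem_basicSet.2 ⟨cylinder_subset_of_mem h.1 h' hl.le hg', fun e he h2 => ?_⟩
  exact h.2 e he (cylinder_subset_of_mem h2 hg' (by rw [FinPath.length_snoc]; omega) h')

/-- The sets `Z(α, β, F)` form a basis, not only a subbasis, of the topology of `G_E`. -/
theorem isTopologicalBasis_basicSet :
    TopologicalSpace.IsTopologicalBasis {U : Set E.GraphGroupoid |
      ∃ (α β : E.FinPath) (hαβ : α.range = β.range) (F : Finset E.Edge)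
        (hF : ∀ e ∈ F, E.s e = α.range), U = basicSet α β hαβ F hF} where
  exists_subset_inter := by
    classical
    rintro _ ⟨α, β, hαβ, F, hF, rfl⟩ _ ⟨γ, δ, hγδ, F', hF', rfl⟩ g ⟨h, h'⟩
    rcases lt_trichotomy α.length γ.length with hl | hl | hl
    · refine ⟨_, ⟨γ, δ, hγδ, F', hF', rfl⟩, h', Set.subset_inter ?_ subset_rfl⟩
      exact basicSet_subset_cylinder.trans
        (cylinder_subset_basicSet h (basicSet_subset_cylinder h') hl)
    · obtain ⟨rfl, rfl⟩ :=
        eq_of_mem_cylinder (basicSet_subset_cylinder h) (basicSet_subset_cylinder h') hl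
      refine ⟨_, ⟨_, _, hαβ, F ∪ F', fun e he => ?_, rfl⟩, ?_, ?_⟩
      · rcases Finset.mem_union.1 he with he | he
        exacts [hF e he, hF' e he]
      · rw [mem_basicSet] at h h' ⊢
        refine ⟨h.1, fun e he => ?_⟩
        rcases Finset.mem_union.1 he with he | he
        exacts [h.2 e he, h'.2 e he]
      · intro g' hg'
        rw [mem_basicSet] at hg'
        exact ⟨mem_basicSet.2 ⟨hg'.1, fun e he => hg'.2 e (Finset.mem_union_left _ he)⟩,
          mem_basicSet.2 ⟨hg'.1, fun e he => hg'.2 e (Finset.mem_union_right _ he)⟩⟩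
    · refine ⟨_, ⟨α, β, hαβ, F, hF, rfl⟩, h, Set.subset_inter subset_rfl ?_⟩
      exact basicSet_subset_cylinder.trans
        (cylinder_subset_basicSet h' (basicSet_subset_cylinder h) hl)
  sUnion_eq := by
    refine Set.eq_univ_of_forall fun g => ?_
    obtain ⟨α, β, hαβ, hg⟩ := exists_mem_cylinder g
    exact ⟨_, ⟨α, β, hαβ, ∅, by simp, rfl⟩, by rwa [basicSet_empty]⟩
  eq_generateFrom := rfl

theorem isOpen_basicSet (α β : E.FinPath) (hαβ : α.range = β.range) (F : Finset E.Edge)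
    (hF : ∀ e ∈ F, E.s e = α.range) : IsOpen (basicSet α β hαβ F hF) :=
  isTopologicalBasis_basicSet.isOpen ⟨α, β, hαβ, F, hF, rfl⟩

theorem isOpen_cylinder (α β : E.FinPath) : IsOpen (cylinder α β) := by
  by_cases h : α.range = β.range
  · rw [← basicSet_empty α β h]
    exact isOpen_basicSet ..
  · rw [Set.eq_empty_of_forall_notMem fun g hg => h (range_eq_of_mem_cylinder hg)]
    exact isOpen_empty

@[simp]
theorem src_arrow (α β : E.FinPath) (x : E.GenPath) (hα : α.range = x.source)
    (hβ : β.range = x.source) (hx : x.IsBoundary) :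
    src (arrow α β x hα hβ hx) = arrow β β x hβ hβ hx :=
  Subtype.ext (by simp [arrow, src])

@[simp]
theorem rng_arrow (α β : E.FinPath) (x : E.GenPath) (hα : α.range = x.source)
    (hβ : β.range = x.source) (hx : x.IsBoundary) :
    rng (arrow α β x hα hβ hx) = arrow α α x hα hα hx :=
  Subtype.ext (by simp [arrow, rng])

@[simp]
theorem inv_arrow (α β : E.FinPath) (x : E.GenPath) (hα : α.range = x.source)
    (hβ : β.range = x.source) (hx : x.IsBoundary) :
    inv (arrow α β x hα hβ hx) = arrow β α x hβ hα hx :=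
  Subtype.ext (by simp [arrow, ArrowGroupoid.inv])

theorem graphGroupoid_inv_inv (g : E.GraphGroupoid) : inv (inv g) = g :=
  Subtype.ext (by simp [ArrowGroupoid.inv])

theorem inv_mem_cylinder {α β : E.FinPath} {g : E.GraphGroupoid} :
    inv g ∈ cylinder α β ↔ g ∈ cylinder β α := by
  have key : ∀ {α β : E.FinPath} {g : E.GraphGroupoid}, g ∈ cylinder β α →
      inv g ∈ cylinder α β := by
    intro α β g h
    obtain ⟨x, hα, hβ, hx, rfl⟩ := mem_cylinder.1 h
    rw [inv_arrow]
    exact arrow_mem_cylinder ..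
  exact ⟨fun h => by simpa [graphGroupoid_inv_inv] using key h, key⟩

theorem continuous_inv : Continuous (inv : E.GraphGroupoid → E.GraphGroupoid) := by
  refine continuous_generateFrom_iff.2 ?_
  rintro _ ⟨α, β, hαβ, F, hF, rfl⟩
  convert isOpen_basicSet β α hαβ.symm F (fun e he => (hF e he).trans hαβ) using 1
  ext g
  simp only [Set.mem_preimage, mem_basicSet, inv_mem_cylinder]

theorem continuous_src : Continuous (src : E.GraphGroupoid → E.GraphGroupoid) := by
  refine continuous_generateFrom_iff.2 ?_
  rintro _ ⟨γ, δ, hγδ, F, hF, rfl⟩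
  refine isOpen_iff_forall_mem_open.2 fun g hg => ?_
  obtain ⟨α, β, -, h⟩ := exists_mem_cylinder g
  obtain ⟨x, hα, hβ, hx, rfl⟩ := mem_cylinder.1 h
  rw [Set.mem_preimage, src_arrow] at hg
  rcases lt_or_ge γ.length β.length with hl | hl
  · refine ⟨cylinder α β, ?_, isOpen_cylinder _ _, h⟩
    intro g' hg'
    obtain ⟨x', hα', hβ', hx', rfl⟩ := mem_cylinder.1 hg'
    rw [Set.mem_preimage, src_arrow]
    exact cylinder_subset_basicSet hg (arrow_mem_cylinder ..) hl (arrow_mem_cylinder ..)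
  · obtain ⟨ε, h1, h2, rfl, rfl⟩ := exists_append_of_mem_cylinder
      (arrow_mem_cylinder β β x hβ hβ hx) (basicSet_subset_cylinder hg) hl
    obtain ⟨y, hy, rfl⟩ := arrow_mem_cylinder_append_iff.1 (basicSet_subset_cylinder hg)
    have hb : y.IsBoundary := (ε.isBoundary_concat y hy).1 hx
    have h3 : α.range = ε.start := by rw [hα, FinPath.source_concat]
    refine ⟨basicSet (α.append ε h3) (β.append ε h1) (by simp) F
      (fun e he => (hF e he).trans (by simp)), ?_, isOpen_basicSet .., ?_⟩
    · intro g' hg'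
      obtain ⟨x', hα', hβ', hx', rfl⟩ := mem_cylinder.1 (basicSet_subset_cylinder hg')
      rw [Set.mem_preimage, src_arrow]
      rw [arrow_mem_basicSet_iff] at hg' ⊢
      exact hg'
    · rw [← arrow_append β β ε h1 h1 y hy hb, arrow_mem_basicSet_iff] at hg
      rw [← arrow_append α β ε h3 h1 y hy hb, arrow_mem_basicSet_iff]
      exact hg

theorem isOpenMap_src : IsOpenMap (src : E.GraphGroupoid → E.GraphGroupoid) := by
  refine isTopologicalBasis_basicSet.isOpenMap_iff.2 ?_
  rintro _ ⟨α, β, hαβ, F, hF, rfl⟩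
  convert isOpen_basicSet β β rfl F (fun e he => (hF e he).trans hαβ) using 1
  ext g
  constructor
  · rintro ⟨g', hg, rfl⟩
    obtain ⟨x, hα, hβ, hx, rfl⟩ := mem_cylinder.1 (basicSet_subset_cylinder hg)
    rw [src_arrow, arrow_mem_basicSet_iff]
    exact arrow_mem_basicSet_iff.1 hg
  · intro hg
    obtain ⟨x, hβ, hβ', hx, rfl⟩ := mem_cylinder.1 (basicSet_subset_cylinder hg)
    refine ⟨arrow α β x (hαβ.trans hβ) hβ hx, ?_, src_arrow ..⟩
    rw [arrow_mem_basicSet_iff] at hg ⊢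
    exact hg

theorem injOn_src_cylinder (α β : E.FinPath) :
    Set.InjOn (src : E.GraphGroupoid → E.GraphGroupoid) (cylinder α β) := by
  intro g hg g' hg' e
  obtain ⟨x, hα, hβ, hx, rfl⟩ := mem_cylinder.1 hg
  obtain ⟨x', hα', hβ', hx', rfl⟩ := mem_cylinder.1 hg'
  rw [src_arrow, src_arrow] at e
  obtain rfl := (eq_of_concat_eq (congrArg (fun g => g.1.1) e) rfl).2
  rfl

theorem injOn_rng_cylinder (α β : E.FinPath) :
    Set.InjOn (rng : E.GraphGroupoid → E.GraphGroupoid) (cylinder α β) := by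
  intro g hg g' hg' e
  obtain ⟨x, hα, hβ, hx, rfl⟩ := mem_cylinder.1 hg
  obtain ⟨x', hα', hβ', hx', rfl⟩ := mem_cylinder.1 hg'
  rw [rng_arrow, rng_arrow] at e
  obtain rfl := (eq_of_concat_eq (congrArg (fun g => g.1.1) e) rfl).2
  rfl

/-! ### Compactness of cylinder sets -/

/-- An ultrafilter that contains exactly the cylinder sets around `g` converges to `g`. -/
theorem le_nhds_of_cylinder (f : Ultrafilter E.GraphGroupoid) (g : E.GraphGroupoid)
    (h : ∀ α β : E.FinPath, g ∈ cylinder α β ↔ cylinder α β ∈ f) : ↑f ≤ 𝓝 g := by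
  rw [TopologicalSpace.nhds_generateFrom]
  refine le_iInf₂ ?_
  rintro _ ⟨hg, α, β, hαβ, F, hF, rfl⟩
  rw [Filter.le_principal_iff]
  rw [mem_basicSet] at hg
  have h1 : (⋂ e : {e // e ∈ F}, (cylinder (α.snoc e.1 (hF e.1 e.2))
      (β.snoc e.1 ((hF e.1 e.2).trans hαβ)))ᶜ) ∈ (f : Filter E.GraphGroupoid) := by
    refine Filter.iInter_mem.2 fun e => ?_
    rw [Ultrafilter.mem_coe, Ultrafilter.compl_mem_iff_notMem, ← h]
    exact hg.2 e.1 e.2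
  refine Filter.mem_of_superset (Filter.inter_mem ((h α β).1 hg.1) h1) ?_
  rintro g' ⟨h2, h3⟩
  rw [Set.mem_iInter] at h3
  exact mem_basicSet.2 ⟨h2, fun e he => h3 ⟨e, he⟩⟩

/-- Given an ultrafilter on `Z(α, β)`, either there is a longest path `ε` with `Z(αε, βε)` in the
ultrafilter, which must end at a sink or an infinite emitter, or the paths of this kind are
the initial pieces of an infinite path; in both cases this path gives the limit. -/
theorem isCompact_cylinder (α β : E.FinPath) : IsCompact (cylinder α β) := by
  refine isCompact_iff_ultrafilter_le_nhds.2 fun f hf => ?_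
  replace hf : cylinder α β ∈ f := Filter.le_principal_iff.1 hf
  obtain ⟨g₀, hg₀⟩ := f.nonempty_of_mem hf
  have hαβ := range_eq_of_mem_cylinder hg₀
  let P : E.FinPath → Prop := fun ε => ∃ (h1 : α.range = ε.start) (h2 : β.range = ε.start),
    cylinder (α.append ε h1) (β.append ε h2) ∈ f
  have hP : P (FinPath.nil α.range) := ⟨rfl, hαβ.symm, by simpa using hf⟩
  rcases exists_maximal_or_infinite P α.range hP with ⟨ε, -, ⟨h1, h2, hε⟩, hmax⟩ | ⟨x, hx, hpre⟩
  · obtain ⟨μ, hμ⟩ : ∃ μ, μ = α.append ε h1 := ⟨_, rfl⟩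
    obtain ⟨ν, hν⟩ : ∃ ν, ν = β.append ε h2 := ⟨_, rfl⟩
    rw [← hμ, ← hν] at hε
    have hμr : μ.range = ε.range := by simp [hμ]
    have hνr : ν.range = ε.range := by simp [hν]
    have hext : ∀ e (he : E.s e = ε.range),
        cylinder (μ.snoc e (he.trans hμr.symm)) (ν.snoc e (he.trans hνr.symm)) ∉ f := by
      intro e he hmem
      refine hmax e he ⟨h1, h2, ?_⟩
      subst hμ hν
      have he' : ε.range = (FinPath.single e).start := he.symm
      have h3 := FinPath.append_assoc α ε _ h1 he'
      have h4 := FinPath.append_assoc β ε _ h2 he'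
      exact (congrArg₂ (fun μ ν => cylinder μ ν ∈ f) h3 h4).mp hmem
    have hreg : ¬ E.IsRegular ε.range := by
      intro hreg
      have : (⋃ e ∈ E.s ⁻¹' {ε.range}, {g | ∃ he : E.s e = ε.range,
          g ∈ cylinder (μ.snoc e (he.trans hμr.symm)) (ν.snoc e (he.trans hνr.symm))}) ∈ f := by
        refine Filter.mem_of_superset hε fun g hg => ?_
        obtain ⟨x, hα, hβ, hx, rfl⟩ := mem_cylinder.1 hg
        obtain ⟨e, y, he, rfl⟩ := hx.exists_eq_concat (by rwa [← hα, hμr])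
        have he' : E.s e = ε.range := by rw [← hμr, hα, FinPath.source_concat]; rfl
        simp only [Set.mem_iUnion]
        exact ⟨e, he', he', arrow_mem_cylinder_snoc_iff.2 ⟨y, he, rfl⟩⟩
      rw [Ultrafilter.finite_biUnion_mem_iff hreg.2] at this
      obtain ⟨e, he, he'⟩ := this
      refine hext e he (Filter.mem_of_superset he' ?_)
      exact fun g hg => hg.2
    have hb : (GenPath.fin (FinPath.nil ε.range)).IsBoundary := not_isRegular_iff.1 hreg
    have hg : arrow μ ν (.fin (FinPath.nil ε.range)) hμr hνr hb ∈ cylinder μ ν :=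
      arrow_mem_cylinder ..
    have hsub : cylinder μ ν ⊆ cylinder α β := by
      rw [hμ, hν]; exact cylinder_append_subset α β ε h1 h2
    refine ⟨_, hsub hg,
      le_nhds_of_cylinder f _ fun γ δ => ⟨fun h => ?_, fun h => ?_⟩⟩
    · rcases le_total γ.length μ.length with hl | hl
      · exact Filter.mem_of_superset hε (cylinder_subset_of_mem h hg hl)
      · obtain ⟨ζ, h3, h4, rfl, rfl⟩ := exists_append_of_mem_cylinder hg h hl
        obtain ⟨y, hy, e⟩ := arrow_mem_cylinder_append_iff.1 h
        have := length_eq_zero_of_concat_eq_nil e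
        exact Filter.mem_of_superset hε
          (cylinder_subset_of_mem h hg (by
            rw [FinPath.length_append]; omega))
    · obtain ⟨g', hg'1, hg'2⟩ := f.nonempty_of_mem (Filter.inter_mem hε h)
      rcases le_or_gt γ.length μ.length with hl | hl
      · exact cylinder_subset_of_mem hg'2 hg'1 hl hg
      · obtain ⟨ζ, h3, h4, rfl, rfl⟩ := exists_append_of_mem_cylinder hg'1 hg'2 hl.le
        rw [FinPath.length_append] at hl
        obtain ⟨e, ζ', he, rfl⟩ := FinPath.exists_eq_single_append (α := ζ) (by omega)
        refine absurd (Filter.mem_of_superset h ?_) (hext e (h3.symm.trans hμr))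
        refine cylinder_subset_of_mem (g := g') ?_ hg'2 (by
          simp only [FinPath.length_snoc, FinPath.length_append]
          simp only [FinPath.length_append] at hl
          omega)
        rw [← FinPath.append_assoc μ (FinPath.single e) ζ' h3 he,
          ← FinPath.append_assoc ν (FinPath.single e) ζ' h4 he] at hg'2
        exact cylinder_append_subset (μ.append (.single e) h3) (ν.append (.single e) h4) _ _ _ hg'2
  · have hg : arrow α β (.inf x) hx.symm (hαβ.symm.trans hx.symm) trivial ∈ cylinder α β :=
      arrow_mem_cylinder ..
    refine ⟨_, hg, le_nhds_of_cylinder f _ fun γ δ => ?_⟩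
    obtain ⟨ε, y, hy, hl, ⟨h1, h2, hε⟩, e⟩ := hpre γ.length
    have hg' := arrow_mem_cylinder_append_iff (α := α) (β := β) (hα := hx.symm)
      (hβ := hαβ.symm.trans hx.symm) (hx := trivial) (h1 := h1) (h2 := h2).2 ⟨y, hy, e⟩
    have hl' : γ.length ≤ (α.append ε h1).length := by rw [FinPath.length_append]; omega
    constructor
    · intro h
      exact Filter.mem_of_superset hε (cylinder_subset_of_mem h hg' hl')
    · intro h
      obtain ⟨g', hg'1, hg'2⟩ := f.nonempty_of_mem (Filter.inter_mem hε h)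
      exact cylinder_subset_of_mem hg'2 hg'1 hl' hg'

/-! ### Cylinder sets in restricted groupoids -/

theorem isOpen_restrictSet (H : Set E.Vert) : IsOpen (E.restrictSet H) := by
  refine isOpen_iff_forall_mem_open.2 fun g hg => ?_
  obtain ⟨α, β, x, hα, hβ, hx, h1, h2, e⟩ := hg
  refine ⟨cylinder α β, ?_, isOpen_cylinder _ _, x, hα, hβ, hx, e⟩
  rintro g' ⟨x', hα', hβ', hx', e'⟩
  exact ⟨α, β, x', hα', hβ', hx', h1, h2, e'⟩

theorem cylinder_subset_restrictSet {H : Set E.Vert} {α β : E.FinPath} (hα : α.start ∈ H)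
    (hβ : β.start ∈ H) : cylinder α β ⊆ E.restrictSet H := by
  rintro g ⟨x, h1, h2, hx, e⟩
  exact ⟨α, β, x, h1, h2, hx, hα, hβ, e⟩

theorem isOpenMap_srcMap_restricted (H : Set E.Vert) :
    IsOpenMap (srcMap : E.RestrictedGroupoid H → unitSpace (E.RestrictedGroupoid H)) := by
  intro V hV
  have h1 : IsOpen (src '' (Subtype.val '' V)) :=
    isOpenMap_src _ ((isOpen_restrictSet H).isOpenMap_subtype_val V hV)
  convert h1.preimage (continuous_subtype_val.comp continuous_subtype_val) using 1
  ext u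
  constructor
  · rintro ⟨g, hg, rfl⟩
    exact ⟨g.1, ⟨g, hg, rfl⟩, rfl⟩
  · rintro ⟨_, ⟨g, hg, rfl⟩, e⟩
    exact ⟨g, hg, Subtype.ext (Subtype.ext e)⟩

theorem continuous_srcMap_restricted (H : Set E.Vert) :
    Continuous (srcMap : E.RestrictedGroupoid H → unitSpace (E.RestrictedGroupoid H)) :=
  Continuous.subtype_mk (Continuous.subtype_mk (continuous_src.comp continuous_subtype_val) _) _

theorem continuous_inv_restricted (H : Set E.Vert) :
    Continuous (inv : E.RestrictedGroupoid H → E.RestrictedGroupoid H) :=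
  Continuous.subtype_mk (continuous_inv.comp continuous_subtype_val) _

theorem rngMap_eq_srcMap_comp_inv (H : Set E.Vert) :
    (rngMap : E.RestrictedGroupoid H → unitSpace (E.RestrictedGroupoid H)) = srcMap ∘ inv := by
  funext g
  exact Subtype.ext (src_inv g).symm

theorem isOpenMap_inv_restricted (H : Set E.Vert) :
    IsOpenMap (inv : E.RestrictedGroupoid H → E.RestrictedGroupoid H) := by
  have h : ∀ g : E.RestrictedGroupoid H, inv (inv g) = g := fun g =>
    Subtype.ext (graphGroupoid_inv_inv g.1)
  exact IsOpenMap.of_inverse (continuous_inv_restricted H) h h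

theorem isOpenBisection_cylinder (H : Set E.Vert) (α β : E.FinPath) :
    IsOpenBisection (Subtype.val ⁻¹' cylinder α β : Set (E.RestrictedGroupoid H)) := by
  have ho : IsOpen (Subtype.val ⁻¹' cylinder α β : Set (E.RestrictedGroupoid H)) :=
    (isOpen_cylinder α β).preimage continuous_subtype_val
  refine ⟨ho, ?_, ?_⟩
  · refine .of_continuous_injective_isOpenMap
      ((continuous_srcMap_restricted H).comp continuous_subtype_val) ?_
      ((isOpenMap_srcMap_restricted H).comp ho.isOpenMap_subtype_val)
    rintro ⟨g, hg⟩ ⟨g', hg'⟩ e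
    exact Subtype.ext (Subtype.ext (injOn_src_cylinder α β hg hg'
      (congrArg (fun u => u.1.1) e)))
  · refine .of_continuous_injective_isOpenMap ?_ ?_ ?_
    · rw [rngMap_eq_srcMap_comp_inv]
      exact ((continuous_srcMap_restricted H).comp (continuous_inv_restricted H)).comp
        continuous_subtype_val
    · rintro ⟨g, hg⟩ ⟨g', hg'⟩ e
      exact Subtype.ext (Subtype.ext (injOn_rng_cylinder α β hg hg'
        (congrArg (fun u => u.1.1) e)))
    · rw [rngMap_eq_srcMap_comp_inv]
      exact ((isOpenMap_srcMap_restricted H).comp (isOpenMap_inv_restricted H)).comp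
        ho.isOpenMap_subtype_val

theorem isCompact_preimage_cylinder {H : Set E.Vert} {α β : E.FinPath} (hα : α.start ∈ H)
    (hβ : β.start ∈ H) :
    IsCompact (Subtype.val ⁻¹' cylinder α β : Set (E.RestrictedGroupoid H)) := by
  rw [Subtype.isCompact_iff, Subtype.image_preimage_coe,
    Set.inter_eq_right.2 (cylinder_subset_restrictSet hα hβ)]
  exact isCompact_cylinder α β

end CKGr

/-! ### Monomials in Leavitt path algebras -/

namespace CKGr

namespace Leavitt

variable {K : Type k} [Field K] {E : CKGr.{u, v}}

/-! The generators satisfy the defining relations, as `mapFamily` of the identity records. -/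

theorem vert_mul_edge (e : E.Edge) : vert K (E.s e) * edge K e = edge K e :=
  (mapFamily K (𝟙 E)).s_edge e

theorem edge_mul_vert (e : E.Edge) : edge K e * vert K (E.r e) = edge K e :=
  (mapFamily K (𝟙 E)).edge_r e

theorem vert_mul_ghost (e : E.Edge) : vert K (E.r e) * ghost K e = ghost K e :=
  (mapFamily K (𝟙 E)).r_ghost e

theorem ghost_mul_vert (e : E.Edge) : ghost K e * vert K (E.s e) = ghost K e :=
  (mapFamily K (𝟙 E)).ghost_s e

theorem ghost_mul_edge_self (e : E.Edge) : ghost K e * edge K e = vert K (E.r e) :=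
  (mapFamily K (𝟙 E)).ghost_edge_self e

theorem ghost_mul_edge_of_ne {e f : E.Edge} (h : e ≠ f) : ghost K e * edge K f = 0 :=
  (mapFamily K (𝟙 E)).ghost_edge_orth e f h

theorem vert_eq_sum {a : E.Vert} (ha : E.IsRegular a) :
    vert K a = ∑ e ∈ ha.2.toFinset, edge K e * ghost K e :=
  (mapFamily K (𝟙 E)).ck a _ ha (by simp)

variable (K) in
/-- The product of the edges in the list `l`, regarded as a path from `a`. -/
def pathElt : E.Vert → List E.Edge → Leavitt K E
  | a, [] => vert K a
  | _, e :: l => edge K e * pathElt (E.r e) l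

variable (K) in
/-- The product of the ghost edges of the list `l`, regarded as a path from `a`, in reverse
order. -/
def ghostElt : E.Vert → List E.Edge → Leavitt K E
  | a, [] => vert K a
  | _, e :: l => ghostElt (E.r e) l * ghost K e

theorem vert_mul_pathElt {a : E.Vert} {l : List E.Edge} (h : E.IsPathFrom a l) :
    vert K a * pathElt K a l = pathElt K a l := by
  cases l with
  | nil => exact vert_mul_self a
  | cons e l => rw [pathElt, ← mul_assoc, ← h.1, vert_mul_edge]

theorem ghostElt_mul_vert {a : E.Vert} {l : List E.Edge} (h : E.IsPathFrom a l) :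
    ghostElt K a l * vert K a = ghostElt K a l := by
  cases l with
  | nil => exact vert_mul_self a
  | cons e l => rw [ghostElt, mul_assoc, ← h.1, ghost_mul_vert]

theorem vert_mul_ghostElt (a : E.Vert) (l : List E.Edge) :
    vert K (E.endFrom a l) * ghostElt K a l = ghostElt K a l := by
  induction l generalizing a with
  | nil => exact vert_mul_self a
  | cons e l ih => rw [ghostElt, ← mul_assoc]; exact congrArg (· * _) (ih _)

theorem ghostElt_append_singleton {a : E.Vert} {l : List E.Edge} {e : E.Edge}
    (h : E.s e = E.endFrom a l) : ghostElt K a (l ++ [e]) = ghost K e * ghostElt K a l := by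
  induction l generalizing a with
  | nil =>
    have h' : E.s e = a := h
    simp only [List.nil_append, ghostElt]
    rw [vert_mul_ghost, ← h', ghost_mul_vert]
  | cons f l ih => rw [List.cons_append, ghostElt, ghostElt, ih h, mul_assoc]

variable (K) in
/-- The monomial `α β*`. -/
def mono (α β : E.FinPath) : Leavitt K E :=
  pathElt K α.start α.edges * ghostElt K β.start β.edges

theorem mono_nil_nil (a : E.Vert) : mono K (FinPath.nil a) (FinPath.nil a) = vert K a :=
  vert_mul_self a

theorem vert_mul_mono (α β : E.FinPath) : vert K α.start * mono K α β = mono K α β := by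
  rw [mono, ← mul_assoc, vert_mul_pathElt α.isPath]

theorem vert_mul_mono_of_ne {a : E.Vert} {α : E.FinPath} (h : a ≠ α.start) (β : E.FinPath) :
    vert K a * mono K α β = 0 := by
  rw [← vert_mul_mono, ← mul_assoc, vert_mul_of_ne h, zero_mul]

theorem mono_mul_vert (α β : E.FinPath) : mono K α β * vert K β.start = mono K α β := by
  rw [mono, mul_assoc, ghostElt_mul_vert β.isPath]

theorem mono_mul_vert_of_ne {a : E.Vert} {β : E.FinPath} (h : a ≠ β.start) (α : E.FinPath) :
    mono K α β * vert K a = 0 := by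
  rw [← mono_mul_vert, mul_assoc, vert_mul_of_ne h.symm, mul_zero]

theorem edge_mul_mono (e : E.Edge) (α β : E.FinPath) (h : (FinPath.single e).range = α.start) :
    edge K e * mono K α β = mono K ((FinPath.single e).append α h) β := by
  have h' : E.r e = α.start := h
  simp only [mono, FinPath.append, FinPath.single, List.singleton_append, pathElt, mul_assoc, h']

theorem edge_mul_mono_of_ne {e : E.Edge} {α : E.FinPath} (h : E.r e ≠ α.start) (β : E.FinPath) :
    edge K e * mono K α β = 0 := by
  rw [← edge_mul_vert, mul_assoc, vert_mul_mono_of_ne h, mul_zero]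

theorem mono_mul_ghost (α β : E.FinPath) (e : E.Edge) (h : (FinPath.single e).range = β.start) :
    mono K α β * ghost K e = mono K α ((FinPath.single e).append β h) := by
  have h' : E.r e = β.start := h
  simp only [mono, FinPath.append, FinPath.single, List.singleton_append, ghostElt, mul_assoc, h']

theorem ghost_mul_mono_self (e : E.Edge) (α β : E.FinPath)
    (h : (FinPath.single e).range = α.start) :
    ghost K e * mono K ((FinPath.single e).append α h) β = mono K α β := by
  have h' : E.r e = α.start := h
  rw [← edge_mul_mono, ← mul_assoc, ghost_mul_edge_self, h', vert_mul_mono]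

theorem ghost_mul_mono_of_ne {e f : E.Edge} (hef : e ≠ f) (α β : E.FinPath)
    (h : (FinPath.single f).range = α.start) :
    ghost K e * mono K ((FinPath.single f).append α h) β = 0 := by
  rw [← edge_mul_mono, ← mul_assoc, ghost_mul_edge_of_ne hef, zero_mul]

theorem mono_mul_edge_self (α β : E.FinPath) (e : E.Edge)
    (h : (FinPath.single e).range = β.start) :
    mono K α ((FinPath.single e).append β h) * edge K e = mono K α β := by
  have h' : E.r e = β.start := h
  rw [← mono_mul_ghost, mul_assoc, ghost_mul_edge_self, h', mono_mul_vert]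

theorem mono_mul_edge_of_ne {e f : E.Edge} (hef : e ≠ f) (α β : E.FinPath)
    (h : (FinPath.single f).range = β.start) :
    mono K α ((FinPath.single f).append β h) * edge K e = 0 := by
  rw [← mono_mul_ghost, mul_assoc, ghost_mul_edge_of_ne hef.symm, mul_zero]

theorem ghost_mul_mono_nil (e : E.Edge) (β : E.FinPath) (h : E.s e = β.range) :
    ghost K e * mono K (FinPath.nil β.range) β = mono K (FinPath.nil (E.r e)) (β.snoc e h) := by
  have h1 : mono K (FinPath.nil β.range) β = ghostElt K β.start β.edges :=
    vert_mul_ghostElt _ _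
  have h2 : mono K (FinPath.nil (E.r e)) (β.snoc e h) =
      ghostElt K β.start (β.edges ++ [e]) := by
    have := vert_mul_ghostElt (K := K) (β.snoc e h).start (β.snoc e h).edges
    change vert K (β.snoc e h).range * _ = _ at this
    rw [FinPath.range_snoc] at this
    exact this
  rw [h1, h2, ghostElt_append_singleton h]

theorem ghost_mul_mono_nil_of_ne {e : E.Edge} {a : E.Vert} (h : E.s e ≠ a) (β : E.FinPath) :
    ghost K e * mono K (FinPath.nil a) β = 0 := by
  rw [← ghost_mul_vert, mul_assoc, vert_mul_mono_of_ne (by exact h), mul_zero]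

theorem mul_mem_of_mem_span {a x : Leavitt K E} {s : Set (Leavitt K E)}
    {S : Submodule K (Leavitt K E)} (hx : x ∈ Submodule.span K s) (h : ∀ y ∈ s, a * y ∈ S) :
    a * x ∈ S :=
  Submodule.span_le (p := S.comap (LinearMap.mulLeft K a)).2 h hx

theorem mem_mul_of_mem_span {a x : Leavitt K E} {s : Set (Leavitt K E)}
    {S : Submodule K (Leavitt K E)} (hx : x ∈ Submodule.span K s) (h : ∀ y ∈ s, y * a ∈ S) :
    x * a ∈ S :=
  Submodule.span_le (p := S.comap (LinearMap.mulRight K a)).2 h hx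

variable (K) in
/-- The span of the monomials `α β*` with `r(α) = r(β)` for which `p α β` holds. -/
def monoSpan (p : E.FinPath → E.FinPath → Prop) : Submodule K (Leavitt K E) :=
  Submodule.span K {x | ∃ α β : E.FinPath, α.range = β.range ∧ p α β ∧ x = mono K α β}

theorem mono_mem_monoSpan {p : E.FinPath → E.FinPath → Prop} {α β : E.FinPath}
    (h : α.range = β.range) (hp : p α β) : mono K α β ∈ monoSpan K p :=
  Submodule.subset_span ⟨α, β, h, hp, rfl⟩

theorem monoSpan_mono {p q : E.FinPath → E.FinPath → Prop} (h : ∀ α β, p α β → q α β) :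
    monoSpan K p ≤ monoSpan K q := by
  refine Submodule.span_mono ?_
  rintro x ⟨α, β, h1, h2, rfl⟩
  exact ⟨α, β, h1, h _ _ h2, rfl⟩

theorem vert_mem_monoSpan_top (a : E.Vert) : vert K a ∈ monoSpan K fun _ _ : E.FinPath => True := by
  rw [← mono_nil_nil]
  exact mono_mem_monoSpan rfl trivial

/-- The span of all monomials is stable under left multiplication by generators. -/
theorem gen_mul_mem_monoSpan_top (g : LeavittGen E) {x : Leavitt K E}
    (hx : x ∈ monoSpan K fun _ _ : E.FinPath => True) :
    mk (leavittOf K g) * x ∈ monoSpan K fun _ _ : E.FinPath => True := by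
  classical
  refine mul_mem_of_mem_span hx ?_
  rintro _ ⟨α, β, h, -, rfl⟩
  cases g with
  | vert a =>
    change vert K a * _ ∈ _
    by_cases ha : a = α.start
    · rw [ha, vert_mul_mono]
      exact mono_mem_monoSpan h trivial
    · rw [vert_mul_mono_of_ne ha]
      exact zero_mem _
  | edge e =>
    change edge K e * _ ∈ _
    by_cases ha : E.r e = α.start
    · rw [edge_mul_mono e α β ha]
      exact mono_mem_monoSpan ((FinPath.range_append _ _ _).trans h) trivial
    · rw [edge_mul_mono_of_ne ha]
      exact zero_mem _
  | ghost e =>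
    change ghost K e * _ ∈ _
    by_cases hl : α.length = 0
    · rw [FinPath.eq_nil_of_length hl] at h ⊢
      rw [FinPath.range_nil] at h
      rw [h]
      by_cases he : E.s e = β.range
      · rw [ghost_mul_mono_nil e β he]
        exact mono_mem_monoSpan (by simp) trivial
      · rw [ghost_mul_mono_nil_of_ne he]
        exact zero_mem _
    · obtain ⟨f, α', hf, rfl⟩ := FinPath.exists_eq_single_append hl
      by_cases hef : e = f
      · subst hef
        rw [ghost_mul_mono_self]
        exact mono_mem_monoSpan (by simpa using h) trivial
      · rw [ghost_mul_mono_of_ne hef]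
        exact zero_mem _

theorem mem_monoSpan_top (x : Leavitt K E) : x ∈ monoSpan K fun _ _ : E.FinPath => True := by
  have hword : ∀ m : FreeSemigroup (LeavittGen E),
      mk (MonoidAlgebra.single m (1 : K)) ∈ monoSpan K fun _ _ : E.FinPath => True := by
    intro m
    induction m using FreeSemigroup.recOnMul with
    | ih1 g =>
      change mk (leavittOf K g) ∈ _
      cases g with
      | vert a => exact vert_mem_monoSpan_top a
      | edge e =>
        have := gen_mul_mem_monoSpan_top (.edge e) (vert_mem_monoSpan_top (K := K) (E.r e))
        change edge K e * _ ∈ _ at this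
        rwa [edge_mul_vert] at this
      | ghost e =>
        have := gen_mul_mem_monoSpan_top (.ghost e) (vert_mem_monoSpan_top (K := K) (E.s e))
        change ghost K e * _ ∈ _ at this
        rwa [ghost_mul_vert] at this
    | ih2 g m _ ih =>
      have h : (MonoidAlgebra.single (FreeSemigroup.of g * m) (1 : K)) =
          leavittOf K g * MonoidAlgebra.single m 1 := by
        simp [leavittOf, MonoidAlgebra.single_mul_single]
      rw [h, map_mul]
      exact gen_mul_mem_monoSpan_top g ih
  obtain ⟨y, rfl⟩ := Quot.exists_rep x
  change mk y ∈ _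
  induction y using MonoidAlgebra.induction_linear with
  | zero => rw [map_zero]; exact zero_mem _
  | add f g hf hg => rw [map_add]; exact add_mem hf hg
  | single m c =>
    have : (MonoidAlgebra.single m c : LeavittFree K E) = c • MonoidAlgebra.single m 1 := by
      simp
    rw [this, map_smul]
    exact Submodule.smul_mem _ _ (hword m)

theorem mem_monoSpan_of_mem_corner {T : Finset E.Vert} {x : Leavitt K E} (hx : x ∈ corner K T) :
    x ∈ monoSpan K fun α β : E.FinPath => α.start ∈ T ∧ β.start ∈ T := by
  classical
  obtain ⟨y, rfl⟩ := hx
  refine mem_mul_of_mem_span (s := {x | ∃ α β : E.FinPath, α.range = β.range ∧ α.start ∈ T ∧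
    x = mono K α β}) (mul_mem_of_mem_span (mem_monoSpan_top y) ?_) ?_
  · rintro _ ⟨α, β, h, -, rfl⟩
    by_cases hα : α.start ∈ T
    · rw [← vert_mul_mono, ← mul_assoc, vertSum_mul_vert hα, vert_mul_mono]
      exact Submodule.subset_span ⟨α, β, h, hα, rfl⟩
    · rw [vertSum, Finset.sum_mul, Finset.sum_eq_zero]
      · exact zero_mem _
      · exact fun a ha => vert_mul_mono_of_ne (by rintro rfl; exact hα ha) _
  · rintro _ ⟨α, β, h, hα, rfl⟩
    by_cases hβ : β.start ∈ T
    · rw [← mono_mul_vert, mul_assoc, vert_mul_vertSum hβ, mono_mul_vert]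
      exact mono_mem_monoSpan h ⟨hα, hβ⟩
    · rw [vertSum, Finset.mul_sum, Finset.sum_eq_zero]
      · exact zero_mem _
      · exact fun a ha => mono_mul_vert_of_ne (by rintro rfl; exact hβ ha) _

theorem mono_mem_corner {T : Finset E.Vert} {α β : E.FinPath} (hα : α.start ∈ T)
    (hβ : β.start ∈ T) : mono K α β ∈ corner K T := by
  refine ⟨mono K α β, ?_⟩
  rw [← vert_mul_mono α β, ← mul_assoc, vertSum_mul_vert hα, vert_mul_mono, ← mono_mul_vert,
    mul_assoc, vert_mul_vertSum hβ, mono_mul_vert]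

/-! ### Reduction of homogeneous elements to vertices -/

/-- The element `x` can be multiplied into a nonzero multiple of a vertex. -/
def IsReducible (x : Leavitt K E) : Prop :=
  ∃ (a b : Leavitt K E) (c : K) (w : E.Vert), c ≠ 0 ∧ a * x * b = c • vert K w

theorem IsReducible.of_mul_left {a x : Leavitt K E} (h : IsReducible (a * x)) :
    IsReducible x := by
  obtain ⟨p, q, c, w, hc, e⟩ := h
  exact ⟨p * a, q, c, w, hc, by rw [← e, mul_assoc p a x]⟩

theorem IsReducible.of_mul_right {a x : Leavitt K E} (h : IsReducible (x * a)) :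
    IsReducible x := by
  obtain ⟨p, q, c, w, hc, e⟩ := h
  exact ⟨p, a * q, c, w, hc, by rw [← e]; simp only [mul_assoc]⟩

theorem exists_eq_sum_edge_mul {x : Leavitt K E}
    (hx : x ∈ monoSpan K fun α _ : E.FinPath => α.length ≠ 0) :
    ∃ F : Finset E.Edge, ∀ F', F ⊆ F' → x = ∑ e ∈ F', edge K e * (ghost K e * x) := by
  classical
  induction hx using Submodule.span_induction with
  | mem x hx =>
    obtain ⟨α, β, -, hl, rfl⟩ := hx
    obtain ⟨f, α', hf, rfl⟩ := FinPath.exists_eq_single_append hl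
    refine ⟨{f}, fun F' hF' => ?_⟩
    rw [Finset.sum_eq_single f]
    · rw [ghost_mul_mono_self, edge_mul_mono]
    · exact fun e _ hef => by rw [ghost_mul_mono_of_ne hef, mul_zero]
    · exact fun h => absurd (hF' (Finset.mem_singleton_self f)) h
  | zero => exact ⟨∅, fun F' _ => by simp⟩
  | add x y _ _ hx hy =>
    obtain ⟨F, hF⟩ := hx
    obtain ⟨F₁, hF₁⟩ := hy
    refine ⟨F ∪ F₁, fun F' hF' => ?_⟩
    simp only [mul_add, Finset.sum_add_distrib]
    rw [← hF F' (Finset.union_subset_left hF'), ← hF₁ F' (Finset.union_subset_right hF')]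
  | smul c x _ hx =>
    obtain ⟨F, hF⟩ := hx
    refine ⟨F, fun F' hF' => ?_⟩
    simp only [mul_smul_comm, ← Finset.smul_sum]
    rw [← hF F' hF']

theorem exists_eq_sum_mul_ghost {x : Leavitt K E}
    (hx : x ∈ monoSpan K fun _ β : E.FinPath => β.length ≠ 0) :
    ∃ F : Finset E.Edge, ∀ F', F ⊆ F' → x = ∑ e ∈ F', x * edge K e * ghost K e := by
  classical
  induction hx using Submodule.span_induction with
  | mem x hx =>
    obtain ⟨α, β, -, hl, rfl⟩ := hx
    obtain ⟨f, β', hf, rfl⟩ := FinPath.exists_eq_single_append hl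
    refine ⟨{f}, fun F' hF' => ?_⟩
    rw [Finset.sum_eq_single f]
    · rw [mono_mul_edge_self, mono_mul_ghost]
    · exact fun e _ hef => by rw [mono_mul_edge_of_ne hef, zero_mul]
    · exact fun h => absurd (hF' (Finset.mem_singleton_self f)) h
  | zero => exact ⟨∅, fun F' _ => by simp⟩
  | add x y _ _ hx hy =>
    obtain ⟨F, hF⟩ := hx
    obtain ⟨F₁, hF₁⟩ := hy
    refine ⟨F ∪ F₁, fun F' hF' => ?_⟩
    simp only [add_mul, Finset.sum_add_distrib]
    rw [← hF F' (Finset.union_subset_left hF'), ← hF₁ F' (Finset.union_subset_right hF')]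
  | smul c x _ hx =>
    obtain ⟨F, hF⟩ := hx
    refine ⟨F, fun F' hF' => ?_⟩
    simp only [smul_mul_assoc, ← Finset.smul_sum]
    rw [← hF F' hF']

theorem exists_ghost_mul_ne_zero {x : Leavitt K E} (h0 : x ≠ 0)
    (hx : x ∈ monoSpan K fun α _ : E.FinPath => α.length ≠ 0) : ∃ e, ghost K e * x ≠ 0 := by
  by_contra! h
  obtain ⟨F, hF⟩ := exists_eq_sum_edge_mul hx
  exact h0 (by rw [hF F subset_rfl]; simp [h])

theorem exists_mul_edge_ne_zero {x : Leavitt K E} (h0 : x ≠ 0)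
    (hx : x ∈ monoSpan K fun _ β : E.FinPath => β.length ≠ 0) : ∃ e, x * edge K e ≠ 0 := by
  by_contra! h
  obtain ⟨F, hF⟩ := exists_eq_sum_mul_ghost hx
  exact h0 (by rw [hF F subset_rfl]; simp [h])

variable (K E) in
/-- The span of the monomials `α β*` with `|α| = |β| ≤ N`. -/
abbrev zeroSpan (N : ℕ) : Submodule K (Leavitt K E) :=
  monoSpan K fun α β => α.length = β.length ∧ α.length ≤ N

variable (K E) in
/-- The span of the monomials `α β*` with `1 ≤ |α| = |β| ≤ N`. -/
abbrev posSpan (N : ℕ) : Submodule K (Leavitt K E) :=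
  monoSpan K fun α β => α.length = β.length ∧ α.length ≠ 0 ∧ α.length ≤ N

/-- By the Cuntz-Krieger relation, regular vertices may be traded for monomials of
positive length. -/
theorem zeroSpan_succ_le (N : ℕ) : zeroSpan K E (N + 1) ≤
    Submodule.span K (Set.range fun a : {a : E.Vert // ¬ E.IsRegular a} => vert K a.1) ⊔
      posSpan K E (N + 1) := by
  refine Submodule.span_le.2 ?_
  rintro _ ⟨α, β, h, ⟨hl, hN⟩, rfl⟩
  by_cases h0 : α.length = 0
  · obtain ⟨a, rfl⟩ : ∃ a, α = FinPath.nil a := ⟨_, FinPath.eq_nil_of_length h0⟩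
    obtain ⟨b, rfl⟩ : ∃ b, β = FinPath.nil b := ⟨_, FinPath.eq_nil_of_length (hl ▸ h0)⟩
    obtain rfl : a = b := h
    rw [mono_nil_nil]
    by_cases ha : E.IsRegular a
    · refine Submodule.mem_sup_right ?_
      rw [vert_eq_sum ha]
      refine Submodule.sum_mem _ fun e _ => ?_
      have h1 : mono K (FinPath.single e) (FinPath.single e) = edge K e * ghost K e := by
        simp only [mono, FinPath.single, pathElt, ghostElt]
        rw [edge_mul_vert, vert_mul_ghost]
      rw [← h1]
      exact mono_mem_monoSpan rfl ⟨rfl, by simp, by simp⟩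
    · exact Submodule.mem_sup_left (Submodule.subset_span ⟨⟨a, ha⟩, rfl⟩)
  · exact Submodule.mem_sup_right (mono_mem_monoSpan h ⟨hl, h0, hN⟩)

theorem vert_mul_sum_mul_vert {p : E.Vert → Prop} (c : {a // p a} →₀ K) (a : {a // p a}) :
    vert K a.1 * (c.sum fun i r => r • vert K i.1) * vert K a.1 = c a • vert K a.1 := by
  rw [Finsupp.sum, Finset.mul_sum, Finset.sum_mul, Finset.sum_eq_single a]
  · rw [mul_smul_comm, vert_mul_self, smul_mul_assoc, vert_mul_self]
  · intro b _ hb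
    rw [mul_smul_comm, vert_mul_of_ne (fun h => hb (Subtype.ext h.symm)), smul_zero, zero_mul]
  · intro h
    simp [Finsupp.notMem_support_iff.1 h]

/-- In degree `0`, the length is reduced by removing first edges on both sides, unless a multiple
of a sink or of an infinite emitter occurs, which can be isolated. -/
theorem isReducible_of_mem_zeroSpan {N : ℕ} {x : Leavitt K E} (hx : x ∈ zeroSpan K E N)
    (h0 : x ≠ 0) : IsReducible x := by
  classical
  induction N generalizing x with
  | zero =>
    have hle : zeroSpan K E 0 ≤
        Submodule.span K (Set.range fun a : {a : E.Vert // True} => vert K a.1) := by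
      refine Submodule.span_le.2 ?_
      rintro _ ⟨α, β, h, ⟨hl, hN⟩, rfl⟩
      obtain ⟨a, rfl⟩ : ∃ a, α = FinPath.nil a := ⟨_, FinPath.eq_nil_of_length (by omega)⟩
      obtain ⟨b, rfl⟩ : ∃ b, β = FinPath.nil b := ⟨_, FinPath.eq_nil_of_length (by omega)⟩
      obtain rfl : a = b := h
      exact Submodule.subset_span ⟨⟨a, trivial⟩, (mono_nil_nil a).symm⟩
    obtain ⟨c, rfl⟩ := Finsupp.mem_span_range_iff_exists_finsupp.1 (hle hx)
    obtain ⟨a, ha⟩ : ∃ a, c a ≠ 0 := by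
      by_contra! hc
      exact h0 (by rw [Finsupp.ext (g := 0) hc]; simp)
    exact ⟨_, _, c a, a.1, ha, vert_mul_sum_mul_vert c a⟩
  | succ N ih =>
    obtain ⟨z, hz, y, hy, rfl⟩ := Submodule.mem_sup.1 (zeroSpan_succ_le N hx)
    obtain ⟨c, rfl⟩ := Finsupp.mem_span_range_iff_exists_finsupp.1 hz
    by_cases hc : ∃ a, c a ≠ 0
    · obtain ⟨a, ha⟩ := hc
      rcases not_isRegular_iff.1 a.2 with hs | hs
      · -- No path of positive length starts at a sink.
        have hy0 : vert K a.1 * y = 0 := by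
          rw [← Submodule.mem_bot K]
          refine mul_mem_of_mem_span hy ?_
          rintro _ ⟨α, β, -, ⟨-, hl, -⟩, rfl⟩
          obtain ⟨f, α', hf, rfl⟩ := FinPath.exists_eq_single_append hl
          rw [Submodule.mem_bot]
          refine vert_mul_mono_of_ne (fun h => ?_) _
          have : f ∈ E.s ⁻¹' {a.1} := h.symm
          rw [hs] at this
          exact this
        refine ⟨vert K a.1, vert K a.1, c a, a.1, ha, ?_⟩
        rw [mul_add, add_mul, hy0, zero_mul, add_zero, vert_mul_sum_mul_vert]
      · -- All but finitely many edges at an infinite emitter are orthogonal to `y`.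
        obtain ⟨F, hF⟩ := exists_eq_sum_edge_mul (monoSpan_mono (fun _ _ h => h.2.1) hy)
        obtain ⟨e, he, heF⟩ := Set.Infinite.exists_notMem_finset hs F
        have hy0 : ghost K e * y = 0 := by
          rw [hF F subset_rfl, Finset.mul_sum]
          refine Finset.sum_eq_zero fun f hf => ?_
          rw [← mul_assoc, ghost_mul_edge_of_ne (by rintro rfl; exact heF hf), zero_mul]
        have he' : E.s e = a.1 := he
        refine ⟨ghost K e, edge K e, c a, E.r e, ha, ?_⟩
        rw [mul_add, hy0, add_zero]
        calc ghost K e * (c.sum fun i r => r • vert K i.1) * edge K e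
            = ghost K e * (vert K a.1 * (c.sum fun i r => r • vert K i.1) * vert K a.1) *
                edge K e := by
              rw [← mul_assoc, ← mul_assoc, ← he', ghost_mul_vert, mul_assoc _ (vert K (E.s e)),
                vert_mul_edge]
          _ = c a • vert K (E.r e) := by
              rw [vert_mul_sum_mul_vert, mul_smul_comm, smul_mul_assoc, ← he', ghost_mul_vert,
                ghost_mul_edge_self]
    · push Not at hc
      have hc0 : c = 0 := Finsupp.ext hc
      subst hc0
      rw [Finsupp.sum_zero_index, zero_add] at h0 ⊢
      obtain ⟨e, he⟩ : ∃ e, ghost K e * y ≠ 0 :=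
        exists_ghost_mul_ne_zero h0 (monoSpan_mono (fun _ _ h => h.2.1) hy)
      obtain ⟨f, hf⟩ : ∃ f, ghost K e * y * edge K f ≠ 0 := by
        by_contra! h
        obtain ⟨F, hF⟩ := exists_eq_sum_mul_ghost
          (monoSpan_mono (q := fun _ β => β.length ≠ 0) (fun _ _ h => h.1 ▸ h.2.1) hy)
        refine he ?_
        rw [hF F subset_rfl, Finset.mul_sum]
        refine Finset.sum_eq_zero fun f _ => ?_
        rw [← mul_assoc, ← mul_assoc, h, zero_mul]
      refine (ih ?_ hf).of_mul_right.of_mul_left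
      rw [mul_assoc]
      refine mul_mem_of_mem_span (s := {x | ∃ α β : E.FinPath, α.range = β.range ∧
        α.length = β.length + 1 ∧ α.length ≤ N + 1 ∧ x = mono K α β})
        (mem_mul_of_mem_span hy ?_) ?_
      · rintro _ ⟨α, β, h, ⟨hl, h0, hN⟩, rfl⟩
        obtain ⟨f', β', hf', rfl⟩ := FinPath.exists_eq_single_append (hl ▸ h0)
        by_cases hff : f = f'
        · subst hff
          rw [mono_mul_edge_self]
          refine Submodule.subset_span ⟨α, β', by simpa using h, ?_, hN, rfl⟩
          rw [hl, FinPath.length_append, FinPath.length_single, add_comm]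
        · rw [mono_mul_edge_of_ne hff]
          exact zero_mem _
      · rintro _ ⟨α, β, h, hl, hN, rfl⟩
        obtain ⟨e', α', he', rfl⟩ := FinPath.exists_eq_single_append (α := α) (by omega)
        by_cases hee : e = e'
        · subst hee
          rw [ghost_mul_mono_self]
          rw [FinPath.length_append, FinPath.length_single] at hl hN
          exact mono_mem_monoSpan (by simpa using h) ⟨by omega, by omega⟩
        · rw [ghost_mul_mono_of_ne hee]
          exact zero_mem _

variable (K E) in
/-- The span of the monomials `α β*` with `|α| - |β| = n`: the homogeneous component of degree
`n`. -/
abbrev degSpan (n : ℤ) : Submodule K (Leavitt K E) :=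
  monoSpan K fun α β => (α.length : ℤ) - β.length = n

theorem exists_mem_zeroSpan {x : Leavitt K E} (hx : x ∈ degSpan K E 0) :
    ∃ N, x ∈ zeroSpan K E N := by
  have hmono : ∀ {M N : ℕ}, M ≤ N → zeroSpan K E M ≤ zeroSpan K E N := fun h =>
    monoSpan_mono fun _ _ h' => ⟨h'.1, h'.2.trans h⟩
  induction hx using Submodule.span_induction with
  | mem x hx =>
    obtain ⟨α, β, h, hl, rfl⟩ := hx
    exact ⟨α.length, mono_mem_monoSpan h ⟨by omega, le_rfl⟩⟩
  | zero => exact ⟨0, zero_mem _⟩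
  | add x y _ _ hx hy =>
    obtain ⟨M, hM⟩ := hx
    obtain ⟨N, hN⟩ := hy
    exact ⟨max M N, add_mem (hmono (le_max_left _ _) hM) (hmono (le_max_right _ _) hN)⟩
  | smul c x _ hx =>
    obtain ⟨N, hN⟩ := hx
    exact ⟨N, Submodule.smul_mem _ _ hN⟩

/-- Nonzero homogeneous elements can be multiplied into nonzero multiples of vertices: first edges
are removed on the left or on the right until the degree is `0`. -/
theorem isReducible_of_mem_degSpan {n : ℤ} {x : Leavitt K E} (hx : x ∈ degSpan K E n)
    (h0 : x ≠ 0) : IsReducible x := by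
  classical
  induction n using Int.induction_on generalizing x with
  | zero =>
    obtain ⟨N, hN⟩ := exists_mem_zeroSpan hx
    exact isReducible_of_mem_zeroSpan hN h0
  | succ n ih =>
    obtain ⟨e, he⟩ := exists_ghost_mul_ne_zero h0 (monoSpan_mono (fun _ _ h => by omega) hx)
    refine (ih (mul_mem_of_mem_span hx ?_) he).of_mul_left
    rintro _ ⟨α, β, h, hl, rfl⟩
    obtain ⟨e', α', he', rfl⟩ := FinPath.exists_eq_single_append (α := α) (by omega)
    by_cases hee : e = e'
    · subst hee
      rw [ghost_mul_mono_self]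
      rw [FinPath.length_append, FinPath.length_single] at hl
      exact mono_mem_monoSpan (by simpa using h) (by push_cast at hl; omega)
    · rw [ghost_mul_mono_of_ne hee]
      exact zero_mem _
  | pred n ih =>
    obtain ⟨e, he⟩ := exists_mul_edge_ne_zero h0 (monoSpan_mono (fun _ _ h => by omega) hx)
    refine (ih (mem_mul_of_mem_span hx ?_) he).of_mul_right
    rintro _ ⟨α, β, h, hl, rfl⟩
    obtain ⟨e', β', he', rfl⟩ := FinPath.exists_eq_single_append (α := β) (by omega)
    by_cases hee : e = e'
    · subst hee
      rw [mono_mul_edge_self]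
      rw [FinPath.length_append, FinPath.length_single] at hl
      exact mono_mem_monoSpan (by simpa using h) (by push_cast at hl; omega)
    · rw [mono_mul_edge_of_ne hee]
      exact zero_mem _

theorem exists_homogeneous_sum (x : Leavitt K E) :
    ∃ f : ℤ →₀ Leavitt K E, (∀ n, f n ∈ degSpan K E n) ∧ f.sum (fun _ y => y) = x := by
  rw [← Submodule.mem_iSup_iff_exists_finsupp]
  refine Submodule.span_le.2 ?_ (mem_monoSpan_top x)
  rintro _ ⟨α, β, h, -, rfl⟩
  exact Submodule.mem_iSup_of_mem _ (mono_mem_monoSpan (p := fun α β =>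
    (α.length : ℤ) - β.length = _) h rfl)

/-- The graded uniqueness theorem, for homomorphisms to convolution algebras: if monomials are
sent to functions supported in their degree and no vertex is sent to `0`, then the homomorphism is
injective. -/
theorem injective_of_graded {G : Type w} [ArrowGroupoid G]
    (π : Leavitt K E →ₙₐ[K] ArrowGroupoid.ConvAlg K G) (deg : G → ℤ)
    (hdeg : ∀ α β : E.FinPath, α.range = β.range → ∀ g, (π (mono K α β)).fn g ≠ 0 →
      deg g = (α.length : ℤ) - β.length)
    (hvert : ∀ a : E.Vert, π (vert K a) ≠ 0) : Function.Injective π := by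
  refine (injective_iff_map_eq_zero π).2 fun x hx => ?_
  obtain ⟨f, hf, rfl⟩ := exists_homogeneous_sum x
  have hsupp : ∀ n, ∀ y ∈ degSpan K E n, ∀ g, (π y).fn g ≠ 0 → deg g = n := by
    intro n y hy
    induction hy using Submodule.span_induction with
    | mem x hx =>
      obtain ⟨α, β, h, hl, rfl⟩ := hx
      rw [← hl]
      exact hdeg α β h
    | zero => intro g hg; simp at hg
    | add x y _ _ hx hy =>
      intro g hg
      rw [map_add, ArrowGroupoid.ConvAlg.fn_add] at hg
      by_cases h : (π x).fn g = 0
      · exact hy g (by rwa [h, zero_add] at hg)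
      · exact hx g h
    | smul c x _ hx =>
      intro g hg
      rw [map_smul, ArrowGroupoid.ConvAlg.fn_smul] at hg
      exact hx g (right_ne_zero_of_mul hg)
  have fn_sum : ∀ (s : Finset ℤ) (φ : ℤ → ArrowGroupoid.ConvAlg K G) (g : G),
      (∑ n ∈ s, φ n).fn g = ∑ n ∈ s, (φ n).fn g := by
    classical
    intro s φ g
    induction s using Finset.induction_on with
    | empty => simp
    | insert a s ha ih => simp [Finset.sum_insert ha, ih]
  have hzero : ∀ n, π (f n) = 0 := by
    intro n
    ext g
    rw [ArrowGroupoid.ConvAlg.fn_zero]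
    by_contra hne
    have hn : deg g = n := hsupp n _ (hf n) g hne
    have h1 : (π (f.sum fun _ y => y)).fn g = (π (f n)).fn g := by
      rw [Finsupp.sum, map_sum, fn_sum, Finset.sum_eq_single n]
      · intro m _ hm
        by_contra h2
        exact hm ((hsupp m _ (hf m) g h2).symm.trans hn)
      · intro h2
        rw [Finsupp.notMem_support_iff.1 h2]
        simp
    rw [hx] at h1
    exact hne h1.symm
  have hf0 : f = 0 := by
    ext n
    by_contra hne
    obtain ⟨a, b, c, w, hc, e⟩ := isReducible_of_mem_degSpan (hf n) hne
    have h1 := congrArg π e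
    rw [map_mul, map_mul, hzero, mul_zero, zero_mul, map_smul] at h1
    exact (smul_ne_zero hc (hvert w)) h1.symm
  rw [hf0, Finsupp.sum_zero_index]

end Leavitt

end CKGr

/-! ### Characteristic functions of cylinder sets under convolution -/

namespace ArrowGroupoid

namespace ConvAlg

variable {K : Type k} [Field K] {G : Type w} [ArrowGroupoid G]

variable (K G) in
/-- The inclusion of the convolution algebra into the space of all functions. -/
def fnₗ : ConvAlg K G →ₗ[K] (G → K) := (convSubmodule K G).subtype

theorem fnₗ_apply (f : ConvAlg K G) (g : G) : fnₗ K G f g = f.fn g := rfl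

theorem fn_sum {ι : Type*} (s : Finset ι) (φ : ι → ConvAlg K G) (g : G) :
    (∑ n ∈ s, φ n).fn g = ∑ n ∈ s, (φ n).fn g := by
  rw [← fnₗ_apply, map_sum, Finset.sum_apply]
  rfl

variable (K) in
/-- The characteristic function of a set on which source and range are injective. -/
def ind (U : Set G) (h1 : U.InjOn src) (h2 : U.InjOn rng) : ConvAlg K G :=
  ⟨U.indicator 1, fun _ =>
    ⟨Set.Subsingleton.finite fun _ ha _ hb => h2 (Set.mem_of_indicator_ne_zero ha.2)
      (Set.mem_of_indicator_ne_zero hb.2) (ha.1.trans hb.1.symm),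
    Set.Subsingleton.finite fun _ ha _ hb => h1 (Set.mem_of_indicator_ne_zero ha.2)
      (Set.mem_of_indicator_ne_zero hb.2) (ha.1.trans hb.1.symm)⟩⟩

theorem fn_ind (U : Set G) (h1 : U.InjOn src) (h2 : U.InjOn rng) :
    (ind K U h1 h2).fn = U.indicator 1 := rfl

/-- The product of characteristic functions is the characteristic function of the product. -/
theorem ind_mul_ind {U V W : Set G} (hU : U.InjOn src) (hU' : U.InjOn rng) (hV : V.InjOn src)
    (hV' : V.InjOn rng) (hW : W.InjOn src) (hW' : W.InjOn rng)
    (h1 : ∀ a ∈ U, ∀ b ∈ V, ∀ h : src a = rng b, mul a b h ∈ W)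
    (h2 : ∀ g ∈ W, ∃ a ∈ U, ∃ b ∈ V, ∃ h : src a = rng b, mul a b h = g) :
    ind K U hU hU' * ind K V hV hV' = ind K W hW hW' := by
  classical
  ext g
  rw [fn_mul, fn_ind, fn_ind, fn_ind]
  by_cases hg : g ∈ W
  · obtain ⟨a, ha, b, hb, h, rfl⟩ := h2 g hg
    rw [finsum_eq_single _ (a, b)]
    · have : (a, b) ∈ factorizations (mul a b h) := ⟨h, rfl⟩
      simp [this, ha, hb, hg]
    · rintro ⟨a', b'⟩ hne
      refine (finsum_congr fun hp => ?_).trans finsum_zero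
      obtain ⟨h', e⟩ := hp
      by_contra h3
      have ha' : a' = a := hU' (Set.mem_of_indicator_ne_zero (left_ne_zero_of_mul h3)) ha
        ((rng_mul a' b' h').symm.trans ((congrArg rng e).trans (rng_mul a b h)))
      subst ha'
      exact hne (congrArg (Prod.mk a') (mul_left_cancel e))
  · rw [Set.indicator_of_notMem hg]
    refine finsum_mem_eq_zero_of_forall_eq_zero ?_
    rintro ⟨a, b⟩ ⟨h, rfl⟩
    by_contra hne
    exact hg (h1 a (Set.mem_of_indicator_ne_zero (left_ne_zero_of_mul hne)) b
      (Set.mem_of_indicator_ne_zero (right_ne_zero_of_mul hne)) h)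

theorem ind_mul_ind_eq_zero {U V : Set G} (hU : U.InjOn src) (hU' : U.InjOn rng)
    (hV : V.InjOn src) (hV' : V.InjOn rng) (h1 : ∀ a ∈ U, ∀ b ∈ V, src a ≠ rng b) :
    ind K U hU hU' * ind K V hV hV' = 0 := by
  ext g
  rw [fn_mul, fn_ind, fn_ind, fn_zero]
  refine finsum_mem_eq_zero_of_forall_eq_zero ?_
  rintro ⟨a, b⟩ ⟨h, rfl⟩
  by_contra hne
  exact h1 a (Set.mem_of_indicator_ne_zero (left_ne_zero_of_mul hne)) b
      (Set.mem_of_indicator_ne_zero (right_ne_zero_of_mul hne)) h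

end ConvAlg

end ArrowGroupoid

namespace CKGr

open ArrowGroupoid

variable {E : CKGr.{u, v}} (K : Type k) [Field K]

/-- The characteristic function of `Z(α, β)`. -/
def cyl (α β : E.FinPath) : ConvAlg K E.GraphGroupoid :=
  ConvAlg.ind K (cylinder α β) (injOn_src_cylinder α β) (injOn_rng_cylinder α β)

theorem fn_cyl (α β : E.FinPath) : (cyl K α β).fn = (cylinder α β).indicator 1 := rfl

theorem mul_arrow {α β γ : E.FinPath} {x : E.GenPath} (hα : α.range = x.source)
    (hβ : β.range = x.source) (hγ : γ.range = x.source) (hx : x.IsBoundary)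
    (h : src (arrow α β x hα hβ hx) = rng (arrow β γ x hβ hγ hx)) :
    mul (arrow α β x hα hβ hx) (arrow β γ x hβ hγ hx) h = arrow α γ x hα hγ hx :=
  Subtype.ext (by simp [arrow, mul])

theorem cyl_mul_cyl_append {α β δ ε : E.FinPath} (hα : α.range = ε.start)
    (hβ : β.range = ε.start) :
    cyl K α β * cyl K (β.append ε hβ) δ = cyl K (α.append ε hα) δ := by
  refine ConvAlg.ind_mul_ind _ _ _ _ _ _ ?_ ?_
  · intro a ha b hb h
    obtain ⟨x, h1, h2, hx, rfl⟩ := mem_cylinder.1 ha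
    obtain ⟨y, h3, h4, hy, rfl⟩ := mem_cylinder.1 hb
    have h5 : ε.range = y.source := by simpa using h3
    have e : β.concat x h2 = (β.append ε hβ).concat y h3 := congrArg (fun g => g.1.1) h
    rw [FinPath.concat_append _ _ _ y h5] at e
    obtain rfl := (eq_of_concat_eq e rfl).2
    have h6 := arrow_append α β ε hα hβ y h5 hy
    refine mem_cylinder.2 ⟨y, (FinPath.range_append ..).trans h5, h4, hy, ?_⟩
    generalize_proofs at h6 ⊢
    revert h
    rw [← h6]
    intro h
    exact mul_arrow _ h3 h4 hy h
  · intro g hg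
    obtain ⟨y, h3, h4, hy, rfl⟩ := mem_cylinder.1 hg
    have h5 : ε.range = y.source := by simpa using h3
    have h6 : (β.append ε hβ).range = y.source := (FinPath.range_append ..).trans h5
    refine ⟨arrow (α.append ε hα) (β.append ε hβ) y h3 h6 hy,
      cylinder_append_subset _ _ _ _ _ (arrow_mem_cylinder ..), arrow (β.append ε hβ) δ y h6 h4 hy,
      arrow_mem_cylinder .., ?_, mul_arrow _ _ h4 hy _⟩
    rw [src_arrow, rng_arrow]

theorem cyl_append_mul_cyl {α β δ ε : E.FinPath} (hδ : δ.range = ε.start)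
    (hβ : β.range = ε.start) :
    cyl K α (β.append ε hβ) * cyl K β δ = cyl K α (δ.append ε hδ) := by
  refine ConvAlg.ind_mul_ind _ _ _ _ _ _ ?_ ?_
  · intro a ha b hb h
    obtain ⟨x, h1, h2, hx, rfl⟩ := mem_cylinder.1 hb
    obtain ⟨y, h3, h4, hy, rfl⟩ := mem_cylinder.1 ha
    have h5 : ε.range = y.source := by simpa using h4
    have e : (β.append ε hβ).concat y h4 = β.concat x h1 := congrArg (fun g => g.1.1) h
    rw [FinPath.concat_append _ _ _ y h5] at e
    obtain rfl := (eq_of_concat_eq e rfl).2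
    have h6 := arrow_append β δ ε hβ hδ y h5 hy
    refine mem_cylinder.2 ⟨y, h3, (FinPath.range_append ..).trans h5, hy, ?_⟩
    generalize_proofs at h6 ⊢
    revert h
    rw [← h6]
    intro h
    exact mul_arrow h3 h4 _ hy h
  · intro g hg
    obtain ⟨y, h3, h4, hy, rfl⟩ := mem_cylinder.1 hg
    have h5 : ε.range = y.source := by simpa using h4
    have h6 : (β.append ε hβ).range = y.source := (FinPath.range_append ..).trans h5
    refine ⟨arrow α (β.append ε hβ) y h3 h6 hy, arrow_mem_cylinder ..,
      arrow (β.append ε hβ) (δ.append ε hδ) y h6 h4 hy,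
      cylinder_append_subset _ _ _ _ _ (arrow_mem_cylinder ..), ?_, mul_arrow h3 _ _ hy _⟩
    rw [src_arrow, rng_arrow]

theorem cyl_mul_cyl {α β δ : E.FinPath} (h : α.range = β.range) :
    cyl K α β * cyl K β δ = cyl K α δ := by
  have := cyl_mul_cyl_append K (α := α) (β := β) (δ := δ) (ε := FinPath.nil β.range) h rfl
  rwa [FinPath.append_nil, FinPath.append_nil] at this

theorem cyl_mul_cyl_eq_zero {α β γ δ : E.FinPath}
    (h : ∀ (x y : E.GenPath) (hx : β.range = x.source) (hy : γ.range = y.source),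
      β.concat x hx ≠ γ.concat y hy) : cyl K α β * cyl K γ δ = 0 := by
  refine ConvAlg.ind_mul_ind_eq_zero _ _ _ _ ?_
  intro a ha b hb e
  obtain ⟨x, h1, h2, hx, rfl⟩ := mem_cylinder.1 ha
  obtain ⟨y, h3, h4, hy, rfl⟩ := mem_cylinder.1 hb
  exact h x y h2 h3 (congrArg (fun g => g.1.1) e)

/-- At a regular vertex `a`, `Z(a, a)` is the disjoint union of the sets `Z(e, e)`, where `e` runs
through the edges from `a`. -/
theorem cyl_nil_eq_sum {a : E.Vert} {S : Finset E.Edge} (ha : E.IsRegular a)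
    (hS : ∀ e, e ∈ S ↔ E.s e = a) :
    cyl K (FinPath.nil a) (FinPath.nil a) =
      ∑ e ∈ S, cyl K (FinPath.single e) (FinPath.single e) := by
  classical
  have hsub : ∀ e ∈ S, cylinder (FinPath.single e) (FinPath.single e) ⊆
      cylinder (FinPath.nil a) (FinPath.nil a) := by
    intro e he
    have h := cylinder_append_subset (FinPath.nil a) (FinPath.nil a) (FinPath.single e)
      ((hS e).1 he).symm ((hS e).1 he).symm
    have h' := FinPath.nil_append (FinPath.single e) a ((hS e).1 he).symm
    exact h' ▸ h
  ext g
  rw [ConvAlg.fn_sum]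
  simp only [fn_cyl]
  by_cases hg : g ∈ cylinder (FinPath.nil a) (FinPath.nil a)
  · rw [Set.indicator_of_mem hg]
    obtain ⟨x, h1, h2, hx, rfl⟩ := mem_cylinder.1 hg
    obtain ⟨e, y, he, rfl⟩ := hx.exists_eq_concat (h1 ▸ ha)
    have hae : a = E.s e := by
      have : a = (FinPath.single e).start := by
        rw [← FinPath.source_concat _ y he]; exact h1
      exact this
    have hmem := (arrow_mem_cylinder_append_iff (hα := h1) (hβ := h2) (hx := hx)
      (ε := FinPath.single e) (h1 := hae) (h2 := hae)).2 ⟨y, he, rfl⟩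
    have hnil := FinPath.nil_append (FinPath.single e) a hae
    replace hmem : _ ∈ cylinder (FinPath.single e) (FinPath.single e) := hnil ▸ hmem
    rw [Finset.sum_eq_single e, Set.indicator_of_mem hmem]
    · intro f _ hfe
      refine Set.indicator_of_notMem (fun hf => hfe ?_) _
      have := (eq_of_mem_cylinder hf hmem rfl).1
      simpa [FinPath.single] using (congrArg FinPath.edges this).symm
    · intro h
      exact absurd ((hS e).2 hae.symm) h
  · rw [Set.indicator_of_notMem hg]
    refine (Finset.sum_eq_zero fun e he => ?_).symm
    exact Set.indicator_of_notMem (fun h => hg (hsub e he h)) _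

variable (E) in
/-- The representation of the generators of `L_K(E)` by characteristic functions on `G_E`. -/
def graphFamily : Leavitt.Family K E (ConvAlg K E.GraphGroupoid) where
  vert a := cyl K (FinPath.nil a) (FinPath.nil a)
  edge e := cyl K (FinPath.single e) (FinPath.nil (E.r e))
  ghost e := cyl K (FinPath.nil (E.r e)) (FinPath.single e)
  vert_self a := cyl_mul_cyl K rfl
  vert_orth a b h := cyl_mul_cyl_eq_zero K fun x y hx hy e => h (by
    have := congrArg GenPath.source e
    rwa [FinPath.source_concat, FinPath.source_concat] at this)
  s_edge e := by
    have := cyl_mul_cyl_append K (α := FinPath.nil (E.s e)) (β := FinPath.nil (E.s e))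
      (δ := FinPath.nil (E.r e)) (ε := FinPath.single e) rfl rfl
    exact this
  edge_r e := cyl_mul_cyl K rfl
  r_ghost e := cyl_mul_cyl K rfl
  ghost_s e := by
    have := cyl_append_mul_cyl K (α := FinPath.nil (E.r e)) (β := FinPath.nil (E.s e))
      (δ := FinPath.nil (E.s e)) (ε := FinPath.single e) rfl rfl
    exact this
  ghost_edge_self e := cyl_mul_cyl K rfl
  ghost_edge_orth e f h := cyl_mul_cyl_eq_zero K fun x y hx hy h' => h (by
    have := (eq_of_concat_eq h' rfl).1
    simpa [FinPath.single] using congrArg FinPath.edges this)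
  ck a S ha hS := by
    rw [cyl_nil_eq_sum K ha hS]
    exact Finset.sum_congr rfl fun e _ =>
      (cyl_mul_cyl K (α := FinPath.single e) (β := FinPath.nil (E.r e)) (δ := FinPath.single e)
        rfl).symm

variable (E) in
/-- The homomorphism from `L_K(E)` to the convolution algebra of `G_E`. -/
def toConv : Leavitt K E →ₙₐ[K] ConvAlg K E.GraphGroupoid := (graphFamily E K).lift

theorem toConv_vert (a : E.Vert) :
    toConv E K (Leavitt.vert K a) = cyl K (FinPath.nil a) (FinPath.nil a) :=
  (graphFamily E K).lift_vert a

theorem toConv_edge (e : E.Edge) :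
    toConv E K (Leavitt.edge K e) = cyl K (FinPath.single e) (FinPath.nil (E.r e)) :=
  (graphFamily E K).lift_edge e

theorem toConv_ghost (e : E.Edge) :
    toConv E K (Leavitt.ghost K e) = cyl K (FinPath.nil (E.r e)) (FinPath.single e) :=
  (graphFamily E K).lift_ghost e

theorem toConv_pathElt (a : E.Vert) (l : List E.Edge) (h : E.IsPathFrom a l) :
    toConv E K (Leavitt.pathElt K a l) = cyl K ⟨a, l, h⟩ (FinPath.nil (E.endFrom a l)) := by
  induction l generalizing a with
  | nil => exact toConv_vert K a
  | cons e l ih =>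
    rw [Leavitt.pathElt, map_mul, ih _ h.2, toConv_edge]
    have := cyl_mul_cyl_append K (α := FinPath.single e) (β := FinPath.nil (E.r e))
      (δ := FinPath.nil (E.endFrom (E.r e) l)) (ε := ⟨E.r e, l, h.2⟩) rfl rfl
    refine this.trans ?_
    congr 1
    exact FinPath.ext h.1 rfl

theorem toConv_ghostElt (a : E.Vert) (l : List E.Edge) (h : E.IsPathFrom a l) :
    toConv E K (Leavitt.ghostElt K a l) = cyl K (FinPath.nil (E.endFrom a l)) ⟨a, l, h⟩ := by
  induction l generalizing a with
  | nil => exact toConv_vert K a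
  | cons e l ih =>
    rw [Leavitt.ghostElt, map_mul, ih _ h.2, toConv_ghost]
    have := cyl_append_mul_cyl K (α := FinPath.nil (E.endFrom (E.r e) l))
      (β := FinPath.nil (E.r e)) (δ := FinPath.single e) (ε := ⟨E.r e, l, h.2⟩) rfl rfl
    refine this.trans ?_
    congr 1
    exact FinPath.ext h.1 rfl

theorem toConv_mono (α β : E.FinPath) (h : α.range = β.range) :
    toConv E K (Leavitt.mono K α β) = cyl K α β := by
  rw [Leavitt.mono, map_mul, toConv_pathElt K _ _ α.isPath, toConv_ghostElt K _ _ β.isPath]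
  have h' : E.endFrom α.start α.edges = E.endFrom β.start β.edges := h
  rw [h']
  exact cyl_mul_cyl K h

/-! ### CK-morphisms on paths -/

theorem isPathFrom_map {E F : CKGr.{u, v}} (φ : E ⟶ F) {a : E.Vert} {l : List E.Edge}
    (h : E.IsPathFrom a l) :
    F.IsPathFrom (CKHom.onVert φ a) (l.map (CKHom.onEdge φ)) := by
  induction l generalizing a with
  | nil => trivial
  | cons e l ih =>
    refine ⟨by rw [CKHom.map_s, h.1], ?_⟩
    rw [CKHom.map_r]
    exact ih h.2

theorem endFrom_map {E F : CKGr.{u, v}} (φ : E ⟶ F) (a : E.Vert) (l : List E.Edge) :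
    F.endFrom (CKHom.onVert φ a) (l.map (CKHom.onEdge φ)) = CKHom.onVert φ (E.endFrom a l) := by
  induction l generalizing a with
  | nil => rfl
  | cons e l ih =>
    rw [List.map_cons, endFrom, CKHom.map_r]
    exact ih _

/-- The image of a finite path under a CK-morphism. -/
def FinPath.map {E F : CKGr.{u, v}} (φ : E ⟶ F) (α : E.FinPath) : F.FinPath :=
  ⟨CKHom.onVert φ α.start, α.edges.map (CKHom.onEdge φ), isPathFrom_map φ α.isPath⟩

theorem FinPath.range_map {E F : CKGr.{u, v}} (φ : E ⟶ F) (α : E.FinPath) :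
    (α.map φ).range = CKHom.onVert φ α.range := endFrom_map φ _ _

theorem FinPath.length_map {E F : CKGr.{u, v}} (φ : E ⟶ F) (α : E.FinPath) :
    (α.map φ).length = α.length := List.length_map _

theorem map_mono {E F : CKGr.{u, v}} (φ : E ⟶ F) (α β : E.FinPath) :
    Leavitt.map K φ (Leavitt.mono K α β) = Leavitt.mono K (α.map φ) (β.map φ) := by
  have h1 : ∀ a l, Leavitt.map K φ (Leavitt.pathElt K a l) =
      Leavitt.pathElt K (CKHom.onVert φ a) (l.map (CKHom.onEdge φ)) := by
    intro a l
    induction l generalizing a with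
    | nil => exact Leavitt.map_vert φ a
    | cons e l ih =>
      rw [Leavitt.pathElt, map_mul, ih, Leavitt.map_edge, List.map_cons, Leavitt.pathElt,
        CKHom.map_r]
  have h2 : ∀ a l, Leavitt.map K φ (Leavitt.ghostElt K a l) =
      Leavitt.ghostElt K (CKHom.onVert φ a) (l.map (CKHom.onEdge φ)) := by
    intro a l
    induction l generalizing a with
    | nil => exact Leavitt.map_vert φ a
    | cons e l ih =>
      rw [Leavitt.ghostElt, map_mul, ih, Leavitt.map_ghost, List.map_cons, Leavitt.ghostElt,
        CKHom.map_r]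
  rw [Leavitt.mono, map_mul, h1, h2]
  rfl

theorem cyl_ne_zero {α β : E.FinPath} (h : α.range = β.range) : cyl K α β ≠ 0 := by
  intro e
  obtain ⟨g, hg⟩ := cylinder_nonempty α β h
  have : (cyl K α β).fn g = 0 := by rw [e]; rfl
  rw [fn_cyl, Set.indicator_of_mem hg] at this
  exact one_ne_zero this

/-- For a CK-morphism `φ : E → F`, the homomorphism from `L_K(E)` to functions on `G_F` is
injective. -/
theorem injective_toConv_comp_map {E F : CKGr.{u, v}} (φ : E ⟶ F) :
    Function.Injective ((toConv F K).comp (Leavitt.map K φ)) := by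
  refine Leavitt.injective_of_graded _ (fun g => g.1.2.1) ?_ ?_
  · intro α β h g hg
    rw [NonUnitalAlgHom.comp_apply, map_mono,
      toConv_mono K _ _ (by rw [FinPath.range_map, FinPath.range_map, h])] at hg
    obtain ⟨x, hα, hβ, hx, rfl⟩ := mem_cylinder.1 (Set.mem_of_indicator_ne_zero hg)
    simp [arrow, FinPath.length_map]
  · intro a
    rw [NonUnitalAlgHom.comp_apply, Leavitt.map_vert, toConv_vert]
    exact cyl_ne_zero K rfl

/-! ### Restriction of functions to `G_E|_H` -/

/-- The restriction of functions from `G_E` to `G_E|_H`. -/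
def restrictConv (H : Set E.Vert) :
    ConvAlg K E.GraphGroupoid →ₗ[K] ConvAlg K (E.RestrictedGroupoid H) where
  toFun f := ⟨fun g => f.fn g.1, fun x => by
    constructor
    · refine (((f.2 x.1).1).preimage Subtype.val_injective.injOn).subset ?_
      rintro a ⟨ha, hne⟩
      exact ⟨congrArg Subtype.val ha, hne⟩
    · refine (((f.2 x.1).2).preimage Subtype.val_injective.injOn).subset ?_
      rintro a ⟨ha, hne⟩
      exact ⟨congrArg Subtype.val ha, hne⟩⟩
  map_add' _ _ := rfl
  map_smul' _ _ := rfl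

theorem fn_restrictConv (H : Set E.Vert) (f : ConvAlg K E.GraphGroupoid)
    (g : E.RestrictedGroupoid H) : (restrictConv K H f).fn g = f.fn g.1 := rfl

variable {K}

/-- The function `f` vanishes outside of `G_E|_H`. -/
def IsSupportedOn (H : Set E.Vert) (f : ConvAlg K E.GraphGroupoid) : Prop :=
  ∀ g, f.fn g ≠ 0 → g ∈ E.restrictSet H

/-- Restriction is multiplicative on functions that vanish outside of `G_E|_H`. -/
theorem restrictConv_mul {H : Set E.Vert} {f : ConvAlg K E.GraphGroupoid} (hf : IsSupportedOn H f)
    (f' : ConvAlg K E.GraphGroupoid) :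
    restrictConv K H (f * f') = restrictConv K H f * restrictConv K H f' := by
  ext g
  rw [fn_restrictConv, ConvAlg.fn_mul, ConvAlg.fn_mul]
  simp only [fn_restrictConv]
  have hinj : Function.Injective
      (fun p : E.RestrictedGroupoid H × E.RestrictedGroupoid H => (p.1.1, p.2.1)) := by
    rintro ⟨a, b⟩ ⟨a', b'⟩ e
    simp only [Prod.mk.injEq] at e
    exact Prod.ext (Subtype.ext e.1) (Subtype.ext e.2)
  rw [← finsum_mem_image (f := fun p : E.GraphGroupoid × E.GraphGroupoid =>
    f.fn p.1 * f'.fn p.2) hinj.injOn]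
  refine finsum_mem_inter_support_eq _ _ _ ?_
  ext ⟨a, b⟩
  constructor
  · rintro ⟨⟨h, e⟩, hne⟩
    have ha := hf a (left_ne_zero_of_mul hne)
    have hb : b ∈ E.restrictSet H := by
      have h3 := (mem_restrictSet.1 ha).2
      have h4 : a.1.2.2 = b.1.1 := congrArg (fun g => g.1.1) h
      have h5 : b.1.2.2 = g.1.1.2.2 := congrArg (fun g => g.1.2.2) e
      rw [h4] at h3
      exact mem_restrictSet.2 ⟨h3, h5 ▸ (mem_restrictSet.1 g.2).2⟩
    exact ⟨⟨(⟨a, ha⟩, ⟨b, hb⟩), ⟨Subtype.ext h, Subtype.ext e⟩, rfl⟩, hne⟩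
  · rintro ⟨⟨⟨a', b'⟩, ⟨h, e⟩, e'⟩, hne⟩
    simp only [Prod.mk.injEq] at e'
    obtain ⟨rfl, rfl⟩ := e'
    exact ⟨⟨congrArg Subtype.val h, congrArg Subtype.val e⟩, hne⟩

theorem eq_zero_of_restrictConv_eq_zero {H : Set E.Vert} {f : ConvAlg K E.GraphGroupoid}
    (hf : IsSupportedOn H f) (h : restrictConv K H f = 0) : f = 0 := by
  ext g
  by_contra hne
  have : (restrictConv K H f).fn ⟨g, hf g hne⟩ = 0 := by rw [h]; rfl
  exact hne this

theorem isSupportedOn_cyl {H : Set E.Vert} {α β : E.FinPath} (hα : α.start ∈ H)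
    (hβ : β.start ∈ H) : IsSupportedOn H (cyl K α β) := fun _ hg =>
  cylinder_subset_restrictSet hα hβ (Set.mem_of_indicator_ne_zero hg)

variable (K) in
/-- The functions that vanish outside of `G_E|_H`. -/
def supportedOn (H : Set E.Vert) : Submodule K (ConvAlg K E.GraphGroupoid) where
  carrier := {f | IsSupportedOn H f}
  zero_mem' := fun g hg => absurd rfl hg
  add_mem' := by
    intro f f' hf hf' g hg
    by_cases h : f.fn g = 0
    · exact hf' g (by rwa [ConvAlg.fn_add, h, zero_add] at hg)
    · exact hf g h
  smul_mem' := fun c f hf g hg => hf g (right_ne_zero_of_mul hg)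

end CKGr

/-! ### Direct limits of graphs -/

namespace CKGr

section Colimit

variable {I : Type w} [Preorder I] {𝓔 : I ⥤ CKGr.{u, v}} (c : Limits.Cocone 𝓔)

/-- The canonical morphism from a graph of the system to the vertex of the cocone. -/
def toPt (i : I) : 𝓔.obj i ⟶ c.pt := c.ι.app i

theorem map_comp_toPt {i j : I} (h : i ≤ j) : 𝓔.map (homOfLE h) ≫ toPt c j = toPt c i :=
  c.w (homOfLE h)

theorem onVert_toPt {i j : I} (h : i ≤ j) (a : (𝓔.obj i).Vert) :
    CKHom.onVert (toPt c j) (CKHom.onVert (𝓔.map (homOfLE h)) a) = CKHom.onVert (toPt c i) a :=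
  congrArg (fun φ : 𝓔.obj i ⟶ c.pt => CKHom.onVert φ a) (map_comp_toPt c h)

theorem onEdge_toPt {i j : I} (h : i ≤ j) (e : (𝓔.obj i).Edge) :
    CKHom.onEdge (toPt c j) (CKHom.onEdge (𝓔.map (homOfLE h)) e) = CKHom.onEdge (toPt c i) e :=
  congrArg (fun φ : 𝓔.obj i ⟶ c.pt => CKHom.onEdge φ e) (map_comp_toPt c h)

theorem FinPath.map_map_toPt {i j : I} (h : i ≤ j) (α : (𝓔.obj i).FinPath) :
    (α.map (𝓔.map (homOfLE h))).map (toPt c j) = α.map (toPt c i) := by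
  refine FinPath.ext (onVert_toPt c h _) ?_
  simp only [FinPath.map, List.map_map]
  exact List.map_congr_left fun e _ => onEdge_toPt c h e

/-- The union of the images of the graphs of the system in the vertex of the cocone. -/
def imageGraph : CKGr.{u, v} where
  Vert := {a : c.pt.Vert // ∃ i b, CKHom.onVert (toPt c i) b = a}
  Edge := {e : c.pt.Edge // ∃ i f, CKHom.onEdge (toPt c i) f = e}
  s e := ⟨c.pt.s e.1, by
    obtain ⟨_, i, f, rfl⟩ := e
    exact ⟨i, _, (CKHom.map_s (toPt c i) f).symm⟩⟩
  r e := ⟨c.pt.r e.1, by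
    obtain ⟨_, i, f, rfl⟩ := e
    exact ⟨i, _, (CKHom.map_r (toPt c i) f).symm⟩⟩

/-- The corestriction of the canonical morphisms. -/
def toImageGraph (i : I) : 𝓔.obj i ⟶ imageGraph c where
  onVert a := ⟨CKHom.onVert (toPt c i) a, i, a, rfl⟩
  onEdge e := ⟨CKHom.onEdge (toPt c i) e, i, e, rfl⟩
  map_s e := Subtype.ext (CKHom.map_s (toPt c i) e)
  map_r e := Subtype.ext (CKHom.map_r (toPt c i) e)
  injective_onVert _ _ h := CKHom.injective_onVert (toPt c i) (congrArg Subtype.val h)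
  injective_onEdge _ _ h := CKHom.injective_onEdge (toPt c i) (congrArg Subtype.val h)
  bijOn a ha := by
    have h := CKHom.bijOn (toPt c i) a ha
    refine ⟨fun e he => Subtype.ext (h.mapsTo he), fun e he f hf hef =>
      h.injOn he hf (congrArg Subtype.val hef), ?_⟩
    rintro ⟨e, he⟩ hs
    obtain ⟨f, hf, rfl⟩ := h.surjOn (congrArg Subtype.val hs)
    exact ⟨f, hf, rfl⟩

/-- The union of the images is included by a CK-morphism: a vertex that is regular in the union is
already regular in some graph of the system, and there it emits all of its edges. -/
def imageGraphInclusion [IsDirectedOrder I] : imageGraph c ⟶ c.pt where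
  onVert := Subtype.val
  onEdge := Subtype.val
  map_s _ := rfl
  map_r _ := rfl
  injective_onVert := Subtype.val_injective
  injective_onEdge := Subtype.val_injective
  bijOn a ha := by
    refine ⟨fun e he => congrArg Subtype.val he, Subtype.val_injective.injOn, ?_⟩
    obtain ⟨⟨⟨_, i, f, rfl⟩, hf⟩, hfin⟩ := ha
    have hfa : a = ⟨CKHom.onVert (toPt c i) ((𝓔.obj i).s f), i, _, rfl⟩ :=
      Eq.trans (Eq.symm hf) (Subtype.ext (CKHom.map_s (toPt c i) f))
    have hreg : (𝓔.obj i).IsRegular ((𝓔.obj i).s f) := by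
      refine ⟨⟨f, rfl⟩, Set.Finite.of_finite_image (f := CKHom.onEdge (toImageGraph c i))
        (hfin.subset ?_) (CKHom.injective_onEdge _).injOn⟩
      rintro _ ⟨e, he, rfl⟩
      rw [hfa]
      exact (CKHom.map_s (toImageGraph c i) e).trans (congrArg _ he)
    intro e he
    rw [hfa] at he
    obtain ⟨e', he', rfl⟩ := (CKHom.bijOn (toPt c i) _ hreg).surjOn he
    exact ⟨⟨_, i, e', rfl⟩, by rw [hfa]; exact Subtype.ext he, rfl⟩

variable {c} [IsDirectedOrder I]

/-- The union of the images is a direct limit as well, so that it must be the whole graph. -/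
theorem exists_section_of_isColimit (hc : Limits.IsColimit c) :
    ∃ d : c.pt ⟶ imageGraph c, d ≫ imageGraphInclusion c = 𝟙 c.pt := by
  let c' : Limits.Cocone 𝓔 :=
    { pt := imageGraph c
      ι :=
        { app := toImageGraph c
          naturality := by
            intro i j f
            refine CKHom.ext ?_ ?_
            · funext a
              exact Subtype.ext (onVert_toPt c (leOfHom f) a)
            · funext e
              exact Subtype.ext (onEdge_toPt c (leOfHom f) e) } }
  refine ⟨hc.desc c', hc.hom_ext fun i => ?_⟩
  rw [hc.fac_assoc]
  exact (Category.comp_id _).symm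

theorem exists_onVert_toPt_eq (hc : Limits.IsColimit c) (a : c.pt.Vert) :
    ∃ i b, CKHom.onVert (toPt c i) b = a := by
  obtain ⟨d, hd⟩ := exists_section_of_isColimit hc
  have h : (CKHom.onVert d a).1 = a :=
    congrArg (fun φ : c.pt ⟶ c.pt => CKHom.onVert φ a) hd
  rw [← h]
  exact (CKHom.onVert d a).2

theorem exists_onEdge_toPt_eq (hc : Limits.IsColimit c) (e : c.pt.Edge) :
    ∃ i f, CKHom.onEdge (toPt c i) f = e := by
  obtain ⟨d, hd⟩ := exists_section_of_isColimit hc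
  have h : (CKHom.onEdge d e).1 = e :=
    congrArg (fun φ : c.pt ⟶ c.pt => CKHom.onEdge φ e) hd
  rw [← h]
  exact (CKHom.onEdge d e).2

/-- Every finite path in the direct limit comes from a graph of the system. -/
theorem exists_map_toPt_eq (hc : Limits.IsColimit c) (α : c.pt.FinPath) :
    ∃ (i : I) (β : (𝓔.obj i).FinPath), β.map (toPt c i) = α := by
  obtain ⟨a, l, hl⟩ := α
  induction l generalizing a with
  | nil =>
    obtain ⟨i, b, rfl⟩ := exists_onVert_toPt_eq hc a
    exact ⟨i, FinPath.nil b, rfl⟩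
  | cons e l ih =>
    obtain ⟨i, β, hβ⟩ := ih _ hl.2
    obtain ⟨j, f, hf⟩ := exists_onEdge_toPt_eq hc e
    obtain ⟨m, hi, hj⟩ := exists_ge_ge i j
    rw [← FinPath.map_map_toPt c hi] at hβ
    rw [← onEdge_toPt c hj] at hf
    set f' := CKHom.onEdge (𝓔.map (homOfLE hj)) f
    set β' := β.map (𝓔.map (homOfLE hi))
    have h : (𝓔.obj m).r f' = β'.start := by
      apply CKHom.injective_onVert (toPt c m)
      rw [← CKHom.map_r, hf]
      exact (congrArg FinPath.start hβ).symm
    refine ⟨m, (FinPath.single f').append β' h, FinPath.ext ?_ ?_⟩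
    · exact (CKHom.map_s (toPt c m) f').symm.trans ((congrArg _ hf).trans hl.1)
    · have h2 : β'.edges.map (CKHom.onEdge (toPt c m)) = l := congrArg FinPath.edges hβ
      simp only [FinPath.map, FinPath.append, FinPath.single, List.singleton_append,
        List.map_cons, hf, h2]

end Colimit

end CKGr

/-! ### The Steinberg algebra is spanned by the characteristic functions of cylinder sets -/

namespace CKGr

open ArrowGroupoid Topology

variable {E : CKGr.{u, v}} (K : Type k) [Field K] (H : Set E.Vert)

/-- The functions on `G_E|_H` spanned by the characteristic functions of the sets `Z(α, β)` with
`s(α), s(β) ∈ H`. -/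
def cylSpan : Submodule K (ConvAlg K (E.RestrictedGroupoid H)) :=
  Submodule.span K {f | ∃ α β : E.FinPath, α.range = β.range ∧ α.start ∈ H ∧ β.start ∈ H ∧
    f = restrictConv K H (cyl K α β)}

/-- The sets whose characteristic functions are in `cylSpan`. -/
def IsCylSet (U : Set (E.RestrictedGroupoid H)) : Prop :=
  U.indicator 1 ∈ (cylSpan K H).map (ConvAlg.fnₗ K (E.RestrictedGroupoid H))

variable {K H}

theorem isCylSet_cylinder {α β : E.FinPath} (hα : α.start ∈ H) (hβ : β.start ∈ H) :
    IsCylSet K H (Subtype.val ⁻¹' cylinder α β) := by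
  by_cases h : α.range = β.range
  · exact ⟨_, Submodule.subset_span ⟨α, β, h, hα, hβ, rfl⟩, rfl⟩
  · have : (cylinder α β : Set E.GraphGroupoid) = ∅ :=
      Set.eq_empty_of_forall_notMem fun g hg => h (range_eq_of_mem_cylinder hg)
    rw [this, Set.preimage_empty, IsCylSet, Set.indicator_empty]
    exact zero_mem _

/-- As two cylinder sets are nested or disjoint, the span of their characteristic functions is
closed under pointwise multiplication. -/
theorem mul_mem_map_cylSpan {f f' : E.RestrictedGroupoid H → K}
    (hf : f ∈ (cylSpan K H).map (ConvAlg.fnₗ K (E.RestrictedGroupoid H)))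
    (hf' : f' ∈ (cylSpan K H).map (ConvAlg.fnₗ K (E.RestrictedGroupoid H))) :
    f * f' ∈ (cylSpan K H).map (ConvAlg.fnₗ K (E.RestrictedGroupoid H)) := by
  have hle : (cylSpan K H).map (ConvAlg.fnₗ K (E.RestrictedGroupoid H)) *
      (cylSpan K H).map (ConvAlg.fnₗ K (E.RestrictedGroupoid H)) ≤
      (cylSpan K H).map (ConvAlg.fnₗ K (E.RestrictedGroupoid H)) := by
    conv_lhs => rw [cylSpan, Submodule.map_span, Submodule.span_mul_span]
    refine Submodule.span_le.2 ?_
    have key : ∀ α β γ δ : E.FinPath, α.start ∈ H → β.start ∈ H → γ.start ∈ H → δ.start ∈ H →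
        α.length ≤ γ.length →
        IsCylSet K H (Subtype.val ⁻¹' cylinder α β ∩ Subtype.val ⁻¹' cylinder γ δ) := by
      intro α β γ δ hα hβ hγ hδ hl
      rw [← Set.preimage_inter]
      by_cases hne : (cylinder α β ∩ cylinder γ δ).Nonempty
      · obtain ⟨g, hg, hg'⟩ := hne
        rw [Set.inter_eq_right.2 (cylinder_subset_of_mem hg hg' hl)]
        exact isCylSet_cylinder hγ hδ
      · rw [Set.not_nonempty_iff_eq_empty.1 hne, Set.preimage_empty, IsCylSet,
          Set.indicator_empty]
        exact zero_mem _
    rintro _ ⟨_, ⟨_, ⟨α, β, -, hα, hβ, rfl⟩, rfl⟩, _, ⟨_, ⟨γ, δ, -, hγ, hδ, rfl⟩, rfl⟩, rfl⟩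
    have hmul : ConvAlg.fnₗ K _ (restrictConv K H (cyl K α β)) *
        ConvAlg.fnₗ K _ (restrictConv K H (cyl K γ δ)) =
        (Subtype.val ⁻¹' cylinder α β ∩ Subtype.val ⁻¹' cylinder γ δ :
          Set (E.RestrictedGroupoid H)).indicator 1 := by
      funext g
      refine (Set.inter_indicator_mul (s := (Subtype.val ⁻¹' cylinder α β :
        Set (E.RestrictedGroupoid H))) (t := Subtype.val ⁻¹' cylinder γ δ)
        (1 : E.RestrictedGroupoid H → K) 1 g).symm.trans ?_
      simp [Set.indicator]
    show _ * _ ∈ _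
    rw [hmul]
    rcases le_total α.length γ.length with hl | hl
    · exact key α β γ δ hα hβ hγ hδ hl
    · rw [Set.inter_comm]
      exact key γ δ α β hγ hδ hα hβ hl
  exact hle (Submodule.mul_mem_mul hf hf')

theorem IsCylSet.diff {U V : Set (E.RestrictedGroupoid H)} (hU : IsCylSet K H U)
    (hV : IsCylSet K H V) : IsCylSet K H (U \ V) := by
  classical
  have : (U \ V).indicator (1 : E.RestrictedGroupoid H → K) =
      U.indicator 1 - U.indicator 1 * V.indicator 1 := by
    funext g
    by_cases h1 : g ∈ U <;> by_cases h2 : g ∈ V <;> simp [h1, h2]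
  rw [IsCylSet, this]
  exact sub_mem hU (mul_mem_map_cylSpan hU hV)

theorem IsCylSet.union {U V : Set (E.RestrictedGroupoid H)} (hU : IsCylSet K H U)
    (hV : IsCylSet K H V) : IsCylSet K H (U ∪ V) := by
  classical
  have : (U ∪ V).indicator (1 : E.RestrictedGroupoid H → K) =
      U.indicator 1 + V.indicator 1 - U.indicator 1 * V.indicator 1 := by
    funext g
    by_cases h1 : g ∈ U <;> by_cases h2 : g ∈ V <;> simp [h1, h2]
  rw [IsCylSet, this]
  exact sub_mem (add_mem hU hV) (mul_mem_map_cylSpan hU hV)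

theorem isCylSet_empty : IsCylSet K H ∅ := by
  rw [IsCylSet, Set.indicator_empty]
  exact zero_mem _

theorem isCylSet_basicSet {α β : E.FinPath} (hα : α.start ∈ H) (hβ : β.start ∈ H)
    (hαβ : α.range = β.range) (F : Finset E.Edge) (hF : ∀ e ∈ F, E.s e = α.range) :
    IsCylSet K H (Subtype.val ⁻¹' basicSet α β hαβ F hF) := by
  classical
  have key : ∀ s : Finset {e // e ∈ F}, IsCylSet K H (⋃ e ∈ s, Subtype.val ⁻¹'
      cylinder (α.snoc e.1 (hF e.1 e.2)) (β.snoc e.1 ((hF e.1 e.2).trans hαβ))) := by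
    intro s
    induction s using Finset.induction_on with
    | empty => simpa using isCylSet_empty
    | insert e s _ ih =>
      rw [Finset.set_biUnion_insert]
      exact IsCylSet.union (isCylSet_cylinder (by exact hα) (by exact hβ)) ih
  convert (isCylSet_cylinder hα hβ).diff (key F.attach) using 1
  ext g
  simp [mem_basicSet]

theorem isCylSet_of_isCompact {U : Set (E.RestrictedGroupoid H)} (hU : IsOpen U)
    (hU' : IsCompact U) : IsCylSet K H U := by
  obtain ⟨D, hD, h1, h2⟩ : ∃ D, IsCylSet K H D ∧ U ⊆ D ∧ D ⊆ U := by
    refine hU'.induction_on (p := fun V => ∃ D, IsCylSet K H D ∧ V ⊆ D ∧ D ⊆ U)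
      ⟨∅, isCylSet_empty, subset_rfl, Set.empty_subset _⟩ ?_ ?_ ?_
    · rintro V V' h ⟨D, hD, h1, h2⟩
      exact ⟨D, hD, h.trans h1, h2⟩
    · rintro V V' ⟨D, hD, h1, h2⟩ ⟨D', hD', h1', h2'⟩
      exact ⟨D ∪ D', hD.union hD', Set.union_subset_union h1 h1', Set.union_subset h2 h2'⟩
    · intro g hg
      obtain ⟨V, hV, rfl⟩ := isOpen_induced_iff.1 hU
      obtain ⟨_, ⟨α, β, hαβ, F, hF, rfl⟩, hgB, hBV⟩ :=
        isTopologicalBasis_basicSet.exists_subset_of_mem_open hg hV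
      obtain ⟨x, hα, hβ, hx, e⟩ := basicSet_subset_cylinder hgB
      have h3 := mem_restrictSet.1 g.2
      rw [e, FinPath.source_concat, FinPath.source_concat] at h3
      refine ⟨Subtype.val ⁻¹' basicSet α β hαβ F hF, mem_nhdsWithin_of_mem_nhds
        (((isOpen_basicSet α β hαβ F hF).preimage continuous_subtype_val).mem_nhds hgB),
        _, isCylSet_basicSet h3.1 h3.2 hαβ F hF, subset_rfl, Set.preimage_mono hBV⟩
  rwa [h1.antisymm h2]

variable (K H) in
theorem steinbergSpan_eq_cylSpan :
    steinbergSpan K (E.RestrictedGroupoid H) = cylSpan K H := by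
  apply le_antisymm
  · refine Submodule.span_le.2 ?_
    rintro _ ⟨U, hU, hc, rfl⟩
    obtain ⟨f, hf, e⟩ := isCylSet_of_isCompact (K := K) hU.1 hc
    have : charFun K U hU = f := ConvAlg.ext fun g => (congrFun e g).symm
    rw [this]
    exact hf
  · refine Submodule.span_le.2 ?_
    rintro _ ⟨α, β, -, hα, hβ, rfl⟩
    exact Submodule.subset_span ⟨_, isOpenBisection_cylinder H α β,
      isCompact_preimage_cylinder hα hβ, rfl⟩

end CKGr

/-! ### Direct limits of algebras, and the corners -/

/-- A directed system of injective and jointly surjective homomorphisms is a direct limit. -/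
theorem isAlgDirectLimit_of_injective {K : Type k} [Field K] {I : Type w} [Preorder I]
    [IsDirectedOrder I] {C : I → Type u} [∀ i, NonUnitalRing (C i)] [∀ i, Module K (C i)]
    {ψ : ∀ i j, i ≤ j → (C i →ₙₐ[K] C j)} {A : Type v} [NonUnitalRing A] [Module K A]
    {θ : ∀ i, C i →ₙₐ[K] A} (hcomp : ∀ i j (hij : i ≤ j) (x : C i), θ j (ψ i j hij x) = θ i x)
    (hinj : ∀ i, Function.Injective (θ i)) (hsurj : ∀ a, ∃ i x, θ i x = a) :
    IsAlgDirectLimit.{u, v, w, t, k} K C ψ A θ where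
  compatible := hcomp
  universal B _ _ _ _ g hg := by
    choose ix x hx using hsurj
    have hwd : ∀ i (y : C i) (a : A), θ i y = a → g (ix a) (x a) = g i y := by
      rintro i y a h
      obtain ⟨j, h1, h2⟩ := exists_ge_ge (ix a) i
      rw [← hg _ j h1, ← hg _ j h2]
      congr 1
      apply hinj j
      rw [hcomp, hcomp, hx, h]
    refine ⟨{ toFun := fun a => g (ix a) (x a), map_smul' := ?_, map_zero' := ?_, map_add' := ?_,
              map_mul' := ?_ }, fun i y => hwd i y _ rfl, fun f hf => ?_⟩
    · intro c a
      rw [hwd _ (c • x a) _ (by rw [map_smul, hx]), map_smul]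
      rfl
    · rw [hwd (ix 0) 0 _ (map_zero _), map_zero]
    · intro a b
      obtain ⟨j, h1, h2⟩ := exists_ge_ge (ix a) (ix b)
      rw [hwd j (ψ _ j h1 (x a) + ψ _ j h2 (x b)) _ (by rw [map_add, hcomp, hcomp, hx, hx]),
        map_add, hg, hg]
    · intro a b
      obtain ⟨j, h1, h2⟩ := exists_ge_ge (ix a) (ix b)
      rw [hwd j (ψ _ j h1 (x a) * ψ _ j h2 (x b)) _ (by rw [map_mul, hcomp, hcomp, hx, hx]),
        map_mul, hg, hg]
    · ext a
      conv_lhs => rw [← hx a]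
      exact hf _ _

namespace CKGr

open ArrowGroupoid

variable {K : Type k} [Field K] {E F : CKGr.{u, v}}

section

variable (φ : E ⟶ F) {T : Finset E.Vert} {H : Set F.Vert}

theorem isSupportedOn_toConv_map (hH : ∀ a ∈ T, CKHom.onVert φ a ∈ H) {x : Leavitt K E}
    (hx : x ∈ Leavitt.corner K T) : IsSupportedOn H (toConv F K (Leavitt.map K φ x)) := by
  change _ ∈ supportedOn K H
  replace hx := Leavitt.mem_monoSpan_of_mem_corner hx
  induction hx using Submodule.span_induction with
  | mem x hx =>
    obtain ⟨α, β, h, ⟨hα, hβ⟩, rfl⟩ := hx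
    rw [map_mono, toConv_mono K _ _ (by rw [FinPath.range_map, FinPath.range_map, h])]
    exact isSupportedOn_cyl (hH _ hα) (hH _ hβ)
  | zero => rw [map_zero, map_zero]; exact zero_mem _
  | add x y _ _ hx hy => rw [map_add, map_add]; exact add_mem hx hy
  | smul c x _ hx => rw [map_smul, map_smul]; exact Submodule.smul_mem _ _ hx

variable (K) in
/-- The homomorphism from the corner of `L_K(E)` at `T` to functions on `G_F|_H` that is induced by
a CK-morphism `E → F` mapping `T` into `H`. -/
def cornerToConv (hH : ∀ a ∈ T, CKHom.onVert φ a ∈ H) :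
    Leavitt.corner K T →ₙₐ[K] ConvAlg K (F.RestrictedGroupoid H) where
  toFun x := restrictConv K H (toConv F K (Leavitt.map K φ x))
  map_smul' c x := by
    change restrictConv K H (toConv F K (Leavitt.map K φ (c • x.1))) = _
    rw [map_smul, map_smul, map_smul]; rfl
  map_zero' := by
    change restrictConv K H (toConv F K (Leavitt.map K φ 0)) = _
    rw [map_zero, map_zero, map_zero]
  map_add' x y := by
    change restrictConv K H (toConv F K (Leavitt.map K φ (x.1 + y.1))) = _
    rw [map_add, map_add, map_add]
  map_mul' x y := by
    change restrictConv K H (toConv F K (Leavitt.map K φ (x.1 * y.1))) = _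
    rw [map_mul, map_mul, restrictConv_mul (isSupportedOn_toConv_map φ hH x.2)]

variable (hH : ∀ a ∈ T, CKHom.onVert φ a ∈ H)

theorem cornerToConv_apply (x : Leavitt.corner K T) :
    cornerToConv K φ hH x = restrictConv K H (toConv F K (Leavitt.map K φ x)) := rfl

theorem injective_cornerToConv : Function.Injective (cornerToConv K φ hH) := by
  refine (injective_iff_map_eq_zero _).2 fun x hx => ?_
  have h := eq_zero_of_restrictConv_eq_zero (isSupportedOn_toConv_map φ hH x.2) hx
  exact Subtype.ext ((injective_iff_map_eq_zero _).1 (injective_toConv_comp_map K φ) x.1 h)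

theorem cornerToConv_mem (x : Leavitt.corner K T) : cornerToConv K φ hH x ∈ cylSpan K H := by
  rw [cornerToConv_apply]
  obtain ⟨x, hx⟩ := x
  dsimp only
  replace hx := Leavitt.mem_monoSpan_of_mem_corner hx
  induction hx using Submodule.span_induction with
  | mem x hx =>
    obtain ⟨α, β, h, ⟨hα, hβ⟩, rfl⟩ := hx
    have h' : (α.map φ).range = (β.map φ).range := by
      rw [FinPath.range_map, FinPath.range_map, h]
    rw [map_mono, toConv_mono K _ _ h']
    exact Submodule.subset_span ⟨_, _, h', hH _ hα, hH _ hβ, rfl⟩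
  | zero => rw [map_zero, map_zero, map_zero]; exact zero_mem _
  | add x y _ _ hx hy => rw [map_add, map_add, map_add]; exact add_mem hx hy
  | smul c x _ hx => rw [map_smul, map_smul, map_smul]; exact Submodule.smul_mem _ _ hx

end

theorem Leavitt.map_map {D : CKGr.{u, v}} (ψ : D ⟶ E) (φ : E ⟶ F) (x : Leavitt K D) :
    map K φ (map K ψ x) = map K (ψ ≫ φ) x := by
  induction mem_monoSpan_top x using Submodule.span_induction with
  | mem x hx =>
    obtain ⟨α, β, -, -, rfl⟩ := hx
    rw [map_mono, map_mono, map_mono]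
    congr 1 <;> exact FinPath.ext rfl List.map_map
  | zero => simp only [map_zero]
  | add x y _ _ hx hy => simp only [map_add, hx, hy]
  | smul c x _ hx => simp only [map_smul, hx]

section System

variable {I : Type w} [Preorder I] {𝓔 : I ⥤ CKGr.{u, v}} {c : Limits.Cocone 𝓔}
  {T : ∀ i, Finset (𝓔.obj i).Vert} {H : Set c.pt.Vert}
  (hH : ∀ i, ∀ a ∈ T i, CKHom.onVert (toPt c i) a ∈ H)

include hH in
theorem cornerToConv_cornerMap {i j : I} (hij : i ≤ j)
    (hT : ∀ a ∈ T i, CKHom.onVert (𝓔.map (homOfLE hij)) a ∈ T j) (x : Leavitt.corner K (T i)) :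
    cornerToConv K (toPt c j) (hH j) (Leavitt.cornerMap K (𝓔.map (homOfLE hij)) hT x) =
      cornerToConv K (toPt c i) (hH i) x := by
  rw [cornerToConv_apply, cornerToConv_apply]
  change restrictConv K H (toConv c.pt K (Leavitt.map K _ (Leavitt.map K _ x.1))) = _
  rw [Leavitt.map_map, map_comp_toPt]

/-- The images of the corners exhaust the span of the characteristic functions of cylinder sets. -/
theorem exists_cornerToConv_eq [IsDirectedOrder I] [Nonempty I] (hc : Limits.IsColimit c)
    (hT : ∀ (i j : I) (hij : i ≤ j), ∀ a ∈ T i, CKHom.onVert (𝓔.map (homOfLE hij)) a ∈ T j)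
    (hHT : ∀ a ∈ H, ∃ i, ∃ b ∈ T i, CKHom.onVert (toPt c i) b = a)
    {f : ConvAlg K (c.pt.RestrictedGroupoid H)} (hf : f ∈ cylSpan K H) :
    ∃ i, ∃ x : Leavitt.corner K (T i), cornerToConv K (toPt c i) (hH i) x = f := by
  induction hf using Submodule.span_induction with
  | mem f hf =>
    obtain ⟨α, β, h, hα, hβ, rfl⟩ := hf
    -- Both paths, with their starting vertices in the sets `T i`, are lifted to the same graph.
    have lift : ∀ α : c.pt.FinPath, α.start ∈ H → ∃ i, ∀ j, i ≤ j → ∃ α' : (𝓔.obj j).FinPath,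
        α'.map (toPt c j) = α ∧ α'.start ∈ T j := by
      intro α hα
      obtain ⟨i, α', hα'⟩ := exists_map_toPt_eq hc α
      obtain ⟨j, b, hb, hb'⟩ := hHT _ hα
      obtain ⟨m, hi, hj⟩ := exists_ge_ge i j
      refine ⟨m, fun n hn => ?_⟩
      have hpath := (FinPath.map_map_toPt c (hi.trans hn) α').trans hα'
      refine ⟨_, hpath, ?_⟩
      have hstart : CKHom.onVert (𝓔.map (homOfLE (hj.trans hn))) b =
          (α'.map (𝓔.map (homOfLE (hi.trans hn)))).start := by
        apply CKHom.injective_onVert (toPt c n)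
        rw [onVert_toPt, hb']
        exact (congrArg FinPath.start hpath).symm
      rw [← hstart]
      exact hT _ _ _ b hb
    obtain ⟨i, hi⟩ := lift α hα
    obtain ⟨j, hj⟩ := lift β hβ
    obtain ⟨m, him, hjm⟩ := exists_ge_ge i j
    obtain ⟨α', rfl, h1⟩ := hi m him
    obtain ⟨β', rfl, h2⟩ := hj m hjm
    refine ⟨m, ⟨_, Leavitt.mono_mem_corner h1 h2⟩, ?_⟩
    rw [cornerToConv_apply, map_mono, toConv_mono K _ _ h]
  | zero => exact ⟨Classical.arbitrary I, 0, map_zero _⟩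
  | add f f' _ _ hf hf' =>
    obtain ⟨i, x, rfl⟩ := hf
    obtain ⟨j, y, rfl⟩ := hf'
    obtain ⟨m, him, hjm⟩ := exists_ge_ge i j
    refine ⟨m, Leavitt.cornerMap K _ (hT i m him) x + Leavitt.cornerMap K _ (hT j m hjm) y, ?_⟩
    rw [map_add, cornerToConv_cornerMap hH, cornerToConv_cornerMap hH]
  | smul r f _ hf =>
    obtain ⟨i, x, rfl⟩ := hf
    exact ⟨i, r • x, map_smul _ _ _⟩

end System

end CKGr

end

theorem corollary2p12 {I : Type w} [Preorder I] [IsDirectedOrder I]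
    (𝓔 : I ⥤ CKGr.{u, v}) (c : Limits.Cocone 𝓔) (hc : Limits.IsColimit c)
    (T : ∀ i, Finset (𝓔.obj i).Vert)
    (hT : ∀ (i j : I) (hij : i ≤ j), ∀ a ∈ T i,
      CKGr.CKHom.onVert (𝓔.map (homOfLE hij)) a ∈ T j)
    (K : Type k) [Field K] :
    ∃ A : NonUnitalSubalgebra K (ArrowGroupoid.ConvAlg K
        (c.pt.RestrictedGroupoid (⋃ i, CKGr.CKHom.onVert (c.ι.app i) '' (T i : Set _)))),
      ArrowGroupoid.IsSteinbergAlgebra K A ∧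
      ∃ θ : ∀ i, CKGr.Leavitt.corner K (T i) →ₙₐ[K] A,
        IsAlgDirectLimit.{max u v k, max u v k, w, t, k} K (fun i => CKGr.Leavitt.corner K (T i))
          (fun i j hij => CKGr.Leavitt.cornerMap K (𝓔.map (homOfLE hij)) (hT i j hij)) A θ := by
  obtain ⟨H, hH⟩ : ∃ H : Set c.pt.Vert,
      H = ⋃ i, CKGr.CKHom.onVert (c.ι.app i) '' (T i : Set _) := ⟨_, rfl⟩
  rw [← hH]
  have hTH : ∀ i, ∀ a ∈ T i, CKGr.CKHom.onVert (CKGr.toPt c i) a ∈ H := by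
    intro i a ha
    rw [hH]
    exact Set.mem_iUnion.2 ⟨i, a, ha, rfl⟩
  have hHT : ∀ a ∈ H, ∃ i, ∃ b ∈ T i, CKGr.CKHom.onVert (CKGr.toPt c i) b = a := by
    intro a ha
    rw [hH] at ha
    obtain ⟨i, b, hb, h⟩ := Set.mem_iUnion.1 ha
    exact ⟨i, b, hb, h⟩
  rcases isEmpty_or_nonempty I with hI | hI
  · -- The empty system has the direct limit `0`, and `G_E|_T` is empty.
    have hempty : IsEmpty (c.pt.RestrictedGroupoid H) :=
      ⟨fun g => hI.elim (hHT _ (CKGr.mem_restrictSet.1 g.2).1).choose⟩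
    have hsub : ∀ f f' : ArrowGroupoid.ConvAlg K (c.pt.RestrictedGroupoid H), f = f' :=
      fun f f' => ArrowGroupoid.ConvAlg.ext fun g => hempty.elim g
    refine ⟨⊤, ?_, fun i => hI.elim i, fun i => hI.elim i, ?_⟩
    · refine Submodule.ext fun f => ?_
      rw [hsub f 0]
      simp only [zero_mem]
    · intro B _ _ _ _ g _
      refine ⟨0, fun i => hI.elim i, fun f _ => ?_⟩
      ext a
      rw [Subtype.ext (hsub a.1 (0 : (⊤ : NonUnitalSubalgebra K _)).1), map_zero, map_zero]
  · have hex := fun (f : ArrowGroupoid.ConvAlg K (c.pt.RestrictedGroupoid H)) hf =>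
      CKGr.exists_cornerToConv_eq (f := f) hTH hc hT hHT hf
    let A : NonUnitalSubalgebra K (ArrowGroupoid.ConvAlg K (c.pt.RestrictedGroupoid H)) :=
      { CKGr.cylSpan K H with
        mul_mem' := by
          intro f f' hf hf'
          obtain ⟨i, x, rfl⟩ := hex f hf
          obtain ⟨j, y, rfl⟩ := hex f' hf'
          obtain ⟨m, him, hjm⟩ := exists_ge_ge i j
          rw [← CKGr.cornerToConv_cornerMap hTH him (hT i m him),
            ← CKGr.cornerToConv_cornerMap hTH hjm (hT j m hjm), ← map_mul]
          exact CKGr.cornerToConv_mem _ _ _ }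
    refine ⟨A, (CKGr.steinbergSpan_eq_cylSpan K H).symm, fun i =>
      NonUnitalAlgHom.codRestrict (CKGr.cornerToConv K (CKGr.toPt c i) (hTH i)) A
        (CKGr.cornerToConv_mem _ _), isAlgDirectLimit_of_injective ?_ ?_ ?_⟩
    · intro i j hij x
      exact Subtype.ext (CKGr.cornerToConv_cornerMap hTH hij (hT i j hij) x)
    · intro i x y h
      exact CKGr.injective_cornerToConv _ (hTH i) (congrArg Subtype.val h)
    · rintro ⟨f, hf⟩
      obtain ⟨i, x, h⟩ := hex f hf
      exact ⟨i, x, Subtype.ext h⟩
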